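/- Let $G=(V,E)$ be a graph on $n$ vertices with all degrees at most $\Delta$, where $1\le\Delta\le n-1$, let $0<\varepsilon\le\frac1{5000}$ and $\alpha\ge 5000^3$, and assume $\Delta+1>\frac{\alpha\log n}{\varepsilon^2}$ (natural logarithm). A neighbor $u$ of $v$ is an $\varepsilon$-friend of $v$ if $|N(u)\cap N(v)|\ge(1-\varepsilon)\Delta$; a vertex is $\varepsilon$-sparse if it has fewer than $(1-\varepsilon)\Delta$ $\varepsilon$-friends. Let $V_S$ be a list of distinct $\varepsilon$-sparse vertices (for instance all of them), in any order. Algorithm Color-Sparse$(V_S)$ works as follows. Initially all vertices are blank and the lists $L(c)$, $c\in[\Delta+1]$, are empty. To *try* a color $c$ on $v$ means: go through $L(c)$, querying for each entry whether it is a neighbor of $v$, until a neighbor is found or the list ends; if there is none, assign $c(v)\leftarrow c$ and insert $v$ in $L(c)$. (1) Each $v\in V_S$ is put into $U$ independently with probability $\frac12$. (2) (One-Shot-Coloring) Each $v\in U$ samples a uniformly random color $c'(v)\in[\Delta+1]$; then, for the vertices $v\in U$ one after the other, $c'(v)$ is tried on $v$. Let $U'$ be the set of vertices colored in this step. (3)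 (Greedy-Coloring) The vertices of $S=V_S\setminus U'$ are considered in a uniformly random order; for each $v\in S$, while $v$ is blank, a fresh uniformly random color from $[\Delta+1]$ is drawn and tried on $v$. All random choices are independent. The running time is the number of elementary steps (coin flips, color draws, adjacency queries, loop tests, assignments, insertions, the initialization of colors and lists, and $|S|$ steps for the random permutation), each of unit cost. For $v\in V$ let $A(v)=[\Delta+1]\setminus\{c(u): u\in N(v)\cap V_S\}$. Then there are absolute constants $\gamma>0$ with $\gamma\cdot 5000^3\ge 1$ and $k\in\mathbb N$, and for every $d\in\mathbb N$ a constant $C=C(d)$, such that for all $n,\Delta,\varepsilon,\alpha,G,V_S$ as above: (a) with probability at least $1-n^{-d}$, Color-Sparse$(V_S)$ terminates, its running time is at most $C(\log n)^k\,\frac{n^2}{\Delta}$, and on termination $|L(c)|\le C(\log n)^k\,\frac n\Delta$ for every color $c\in[\Delta+1]$; (b) with probability at least $1-n^{-\gamma\alpha}$ (hence at least $1-\frac1n$), Color-Sparse$(V_S)$ terminates and on termination $|A(v)|\ge\frac{\varepsilon^2\Delta}{9e^6}$ for every vertex $v\in V$. -/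

import Mathlib

open MeasureTheory

namespace SparseColoring

/-! ### Sparse vertices -/

/-- The `ε`-friends of `v`: the neighbours `u` of `v` with `|N(u) ∩ N(v)| ≥ (1 - ε) Δ`. -/
def friends {n : ℕ} (G : SimpleGraph (Fin n)) (Δ : ℕ) (ε : ℝ) (v : Fin n) : Set (Fin n) :=
  {u | G.Adj v u ∧ (1 - ε) * Δ ≤ ((G.neighborSet u ∩ G.neighborSet v).ncard : ℝ)}

/-- A vertex is `ε`-dense if it has at least `(1 - ε) Δ` `ε`-friends. -/
def IsDense {n : ℕ} (G : SimpleGraph (Fin n)) (Δ : ℕ) (ε : ℝ) (v : Fin n) : Prop :=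
  (1 - ε) * Δ ≤ ((friends G Δ ε v).ncard : ℝ)

/-- A vertex is `ε`-sparse if it is not `ε`-dense. -/
def IsSparse {n : ℕ} (G : SimpleGraph (Fin n)) (Δ : ℕ) (ε : ℝ) (v : Fin n) : Prop :=
  ¬ IsDense G Δ ε v

/-! ### The algorithm, with a step counter

Unit-cost steps: a coin flip, a draw of a colour, an adjacency query to one entry of a list `L(c)`,
a loop test, an assignment or insertion, and initialising or reading one cell. -/

/-- The memory of the algorithm: the partial colouring `c(·)` (`none` is the blank colour `⊥`),
the lists `L(c)`, and the number of elementary steps executed so far. -/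
structure State (n Δ : ℕ) where
  color : Fin n → Option (Fin (Δ + 1))
  L : Fin (Δ + 1) → List (Fin n)
  time : ℕ

/-- Let `m` further steps elapse. -/
def State.tick {n Δ : ℕ} (s : State n Δ) (m : ℕ) : State n Δ :=
  { s with time := s.time + m }

/-- Initially every vertex is blank and every list is empty; writing this down takes
`n + (Δ + 1)` steps. -/
def initial (n Δ : ℕ) : State n Δ where
  color := fun _ => none
  L := fun _ => []
  time := n + (Δ + 1)

open Classical in
/-- Go through a list, querying the adjacency of `v` and the current entry, until a neighbour of `v`
is met or the list ends.  Returns whether a neighbour was found, and the number of queries. -/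
noncomputable def scan {n : ℕ} (G : SimpleGraph (Fin n)) (v : Fin n) : List (Fin n) → Bool × ℕ
  | [] => (false, 0)
  | u :: l => if G.Adj v u then (true, 1) else ((scan G v l).1, (scan G v l).2 + 1)

/-- "If no neighbour of `v` is in `L(c)`, then `c(v) ← c` and `L(c) ← L(c) ∪ {v}`."
The cost is one step per adjacency query, one for the test of the result,
and two for the assignment and the insertion. -/
noncomputable def tryColor {n Δ : ℕ} (G : SimpleGraph (Fin n)) (v : Fin n) (c : Fin (Δ + 1))
    (s : State n Δ) : State n Δ :=
  if (scan G v (s.L c)).1 then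
    s.tick ((scan G v (s.L c)).2 + 1)
  else
    { color := Function.update s.color v (some c)
      L := Function.update s.L c (v :: s.L c)
      time := s.time + (scan G v (s.L c)).2 + 3 }

/-- One-Shot-Coloring of the list `U`, where `c' v` is the colour sampled by `v`: first all samples
are made (one step each), then the vertices of `U` are treated one after the other
(one step for reading `v` and `c' v`, and the cost of `tryColor`). -/
noncomputable def oneShot {n Δ : ℕ} (G : SimpleGraph (Fin n)) (c' : Fin n → Fin (Δ + 1))
    (U : List (Fin n)) (s : State n Δ) : State n Δ :=
  U.foldl (fun s v => tryColor G v (c' v) (s.tick 1)) (s.tick U.length)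

/-- The state after `j` rounds of a loop, the `i`-th round being `body i`. -/
def rounds {σ : Type} (body : ℕ → σ → σ) (s : σ) : ℕ → σ
  | 0 => s
  | j + 1 => body j (rounds body s j)

open Classical in
/-- A while loop: rounds are executed as long as the state satisfies `cond`;
the value is `none` if the loop never ends. -/
noncomputable def whileLoop {σ : Type} (cond : σ → Prop) (body : ℕ → σ → σ) (s : σ) : Option σ :=
  if h : ∃ j, ¬ cond (rounds body s j) then some (rounds body s (Nat.find h)) else none

/-- The while loop of Greedy-Coloring at the vertex `v`: while `v` is blank, a colour is drawn and
tried.  Here `draw j` is the colour drawn in round `j`; a round costs one step for the loop test,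
one for the draw, and the cost of `tryColor`. -/
noncomputable def greedyVertex {n Δ : ℕ} (G : SimpleGraph (Fin n)) (draw : ℕ → Fin (Δ + 1))
    (v : Fin n) (s : State n Δ) : Option (State n Δ) :=
  whileLoop (fun s => s.color v = none) (fun j s => tryColor G v (draw j) (s.tick 2)) s

/-- Greedy-Coloring of the list `S` in the order `S[π(1)], S[π(2)], …`, where `π` is the given
permutation of the `|S|` positions.  Generating the permutation takes `|S|` steps; each vertex costs two steps (reading `S[π(i)]`, the last loop test) and
the cost of its rounds. -/
noncomputable def greedy {n Δ : ℕ} (G : SimpleGraph (Fin n)) (draw : Fin n × ℕ → Fin (Δ + 1))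
    (π : (m : ℕ) → Equiv.Perm (Fin m)) (S : List (Fin n)) (s : State n Δ) : Option (State n Δ) :=
  (List.ofFn fun i : Fin S.length => S.get (π S.length i)).foldlM
    (fun s v => greedyVertex G (fun j => draw (v, j)) v (s.tick 2)) (s.tick S.length)

/-- The random choices of Color-Sparse. -/
abbrev Tape (n Δ : ℕ) : Type :=
  -- `coin v`: whether `v` is added to `U`
  (Fin n → Bool) ×
  -- `c' v`: the colour sampled by `v` in One-Shot-Coloring
  (Fin n → Fin (Δ + 1)) ×
  -- for each `m`, the permutation that is used if the list given to Greedy-Coloring has length `m`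
  ((m : ℕ) → Equiv.Perm (Fin m)) ×
  -- `draw (v, j)`: the colour drawn in round `j` of the while loop at `v`
  (Fin n × ℕ → Fin (Δ + 1))

/-- Color-Sparse on the list `VS`, with the random choices `ω`; `none` means that it does not
terminate.  The coin flips cost one step each; so do the entries of `VS` that are gone through to
write down the list `S = VS \ U'` of the vertices left blank by One-Shot-Coloring. -/
noncomputable def colorSparse {n Δ : ℕ} (G : SimpleGraph (Fin n)) (VS : List (Fin n))
    (ω : Tape n Δ) : Option (State n Δ) :=
  let coin := ω.1
  let c' := ω.2.1
  let π := ω.2.2.1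
  let draw := ω.2.2.2
  let U := VS.filter fun v => coin v
  let s := oneShot G c' U ((initial n Δ).tick VS.length)
  let S := VS.filter fun v => (s.color v).isNone
  greedy G draw π S (s.tick VS.length)

/-! ### The probability space and the available colours -/

instance permMeasurableSpace (m : ℕ) : MeasurableSpace (Equiv.Perm (Fin m)) := ⊤

/-- The uniform distribution on a finite type. -/
noncomputable def unif (α : Type) [Fintype α] [Nonempty α] [MeasurableSpace α] : Measure α :=
  (PMF.uniformOfFintype α).toMeasure

instance unif_isProbabilityMeasure (α : Type) [Fintype α] [Nonempty α] [MeasurableSpace α] :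
    IsProbabilityMeasure (unif α) := by
  unfold unif
  infer_instance

/-- All random choices are independent and uniform. -/
noncomputable def tapeMeasure (n Δ : ℕ) : Measure (Tape n Δ) :=
  (Measure.pi fun _ : Fin n => unif Bool).prod
    ((Measure.pi fun _ : Fin n => unif (Fin (Δ + 1))).prod
      ((Measure.infinitePi fun m : ℕ => unif (Equiv.Perm (Fin m))).prod
        (Measure.infinitePi fun _ : Fin n × ℕ => unif (Fin (Δ + 1)))))

/-- `A(v)`: the colours that are not assigned to any neighbour of `v` in `VS`. -/
def available {n Δ : ℕ} (G : SimpleGraph (Fin n)) (VS : List (Fin n)) (s : State n Δ)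
    (v : Fin n) : Set (Fin (Δ + 1)) :=
  {c | ∀ u ∈ VS, G.Adj v u → s.color u ≠ some c}

end SparseColoring

/-!
All estimates are made for the uniform distribution on a finite space, namely for the coins, the
samples, the permutations of at most `n` positions and the first `T` draws of each while loop. A run
in which every while loop ends within `T` rounds depends only on these (`tapeMeasure_truncate`,
`colorSparse_of_succeeds`). Both phases of the algorithm process vertices one after the other with
independent randomness. Their analysis rests on one supermartingale principle, `expect_run_le`: if
a potential does not increase on average at any step taken from a good state, then its final
expectation on the event that all steps were good is at most its initial value.

*Available colours.* Every vertex `z` has at least `Δ + 1 - |W|` available colours, where `W` is the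
set of its neighbours in the list, and this increases by the *savings* of One-Shot-Coloring on `W`:
the number of coloured vertices of `W` minus the number of colours on them (`savings_le_available`).
So let `|W|` be almost `Δ`. As the vertices of `W` are sparse, there are of the order of `ε² Δ²`
non-adjacent pairs in `W` (`sum_card_nonNbrs_ge`). Count each pair at its later member `u`. A constant
proportion of the earlier non-neighbours of `u` in `W` have contributed colours which do not occur on
the neighbours of `u` when `u` is treated (`prob_few_surviving_le`), and by choosing one of these `u`
saves a colour. Here at most `3 Δ` vertices, each trying a colour with probability `1 / 2`, leave a
sixth of the colours unused (`prob_few_unused_le`), so that new colours keep appearing. Hence the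
savings are of the order of `ε² Δ` with high probability (`prob_savings_le_of_sparse`). The greedy
phase never destroys them, and it terminates as every vertex always has a free colour.

*Running time.* If `Δ = O(log n)`, then crude bounds suffice, up to factors `log n`. Otherwise, with
high probability at most `3 Δ / 4` neighbours of each vertex take part in One-Shot-Coloring. A vertex
with fewer than `Δ / 8` leftover neighbours therefore has at least `Δ / 8` free colours throughout.
If a vertex has at least `Δ / 8` leftover neighbours, then in the random order they hit every block
of about `n log n / Δ` consecutive positions (`prob_perm_avoid_le`, `prob_not_blocksHit_le`).
In both cases a vertex with `j` vertices after it has of the order of `j Δ / (n log n)` free colours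
when it is treated (`le_card_free`), so that its while loop hardly ever takes more than
`n (log n)² / j` rounds, a number which is fixed by the order alone. The harmonic sum over `j` bounds
the total number of rounds by `O(n (log n)³)` (`sum_grant_le`). The colours of these draws are
independent and uniform, hence each list receives `O((n / Δ) (log n)³)` entries
(`prob_many_draws_le`); the list lengths also bound the cost of a round.
-/

open scoped BigOperators

namespace SparseColoring

/-! ### Finite probability -/

open Classical in
/-- The probability of an event under the uniform distribution on a finite type. -/
noncomputable def prob {Ω : Type*} [Fintype Ω] (p : Ω → Prop) : ℝ :=
  𝔼 ω, if p ω then (1 : ℝ) else 0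

section Prob

variable {Ω Ω' : Type*} [Fintype Ω] [Fintype Ω']

theorem prob_nonneg (p : Ω → Prop) : 0 ≤ prob p :=
  Finset.expect_nonneg fun ω _ => by split_ifs <;> norm_num

theorem prob_le_expect {p : Ω → Prop} {f : Ω → ℝ} (h0 : ∀ ω, 0 ≤ f ω)
    (h : ∀ ω, p ω → 1 ≤ f ω) : prob p ≤ 𝔼 ω, f ω := by
  refine Finset.expect_le_expect fun ω _ => ?_
  split_ifs with hp
  · exact h ω hp
  · exact h0 ω

theorem prob_mono {p q : Ω → Prop} (h : ∀ ω, p ω → q ω) : prob p ≤ prob q := by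
  refine prob_le_expect (fun ω => by split_ifs <;> norm_num) fun ω hp => ?_
  rw [if_pos (h ω hp)]

theorem prob_or_le (p q : Ω → Prop) : prob (fun ω => p ω ∨ q ω) ≤ prob p + prob q := by
  unfold prob
  rw [← Finset.expect_add_distrib]
  refine Finset.expect_le_expect fun ω _ => ?_
  by_cases hp : p ω <;> by_cases hq : q ω <;> simp [hp, hq]

theorem prob_exists_le {κ : Type*} (A : Finset κ) (p : κ → Ω → Prop) :
    prob (fun ω => ∃ k ∈ A, p k ω) ≤ ∑ k ∈ A, prob (p k) := by
  classical
  unfold prob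
  rw [← Finset.expect_sum_comm]
  refine Finset.expect_le_expect fun ω _ => ?_
  split_ifs with h
  · obtain ⟨k, hk, hp⟩ := h
    refine le_trans ?_ (Finset.single_le_sum (f := fun k => if p k ω then (1 : ℝ) else 0)
      (fun k _ => by split_ifs <;> norm_num) hk)
    simp [hp]
  · exact Finset.sum_nonneg fun k _ => by split_ifs <;> norm_num

theorem prob_exists_le_card_mul {κ : Type*} (A : Finset κ) (p : κ → Ω → Prop) {q : ℝ}
    (h : ∀ k ∈ A, prob (p k) ≤ q) : prob (fun ω => ∃ k ∈ A, p k ω) ≤ A.card * q :=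
  (prob_exists_le A p).trans <| by simpa using Finset.sum_le_card_nsmul A _ q h

theorem expect_le_of_forall_le [Nonempty Ω] {f : Ω → ℝ} {q : ℝ} (h : ∀ ω, f ω ≤ q) :
    𝔼 ω, f ω ≤ q :=
  Finset.expect_le Finset.univ_nonempty fun ω _ => h ω

theorem expect_prod (f : Ω × Ω' → ℝ) : 𝔼 ω, f ω = 𝔼 a, 𝔼 b, f (a, b) := by
  rw [← Finset.univ_product_univ, Finset.expect_product]

/-- A bound that holds conditionally on the first component holds. -/
theorem prob_prod_le [Nonempty Ω] {p : Ω × Ω' → Prop} {q : ℝ}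
    (h : ∀ a, prob (fun b => p (a, b)) ≤ q) : prob p ≤ q := by
  unfold prob
  rw [expect_prod]
  exact expect_le_of_forall_le h

theorem prob_comp_equiv (e : Ω ≃ Ω') (p : Ω' → Prop) : prob (fun ω => p (e ω)) = prob p :=
  Fintype.expect_equiv e _ _ fun _ => rfl

theorem prob_fst_eq [Nonempty Ω'] (p : Ω → Prop) : prob (fun ω : Ω × Ω' => p ω.1) = prob p := by
  classical
  unfold prob
  rw [expect_prod]
  exact Finset.expect_congr rfl fun a _ => Finset.expect_const
    (s := (Finset.univ : Finset Ω')) Finset.univ_nonempty (if p a then (1 : ℝ) else 0)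

theorem prob_snd_eq [Nonempty Ω] (p : Ω' → Prop) : prob (fun ω : Ω × Ω' => p ω.2) = prob p := by
  classical
  unfold prob
  rw [expect_prod]
  exact Finset.expect_const (s := (Finset.univ : Finset Ω)) Finset.univ_nonempty
    (𝔼 b, if p b then (1 : ℝ) else 0)

theorem prob_mem (A : Finset Ω) : prob (fun ω => ω ∈ A) = A.card / Fintype.card Ω := by
  unfold prob
  rw [Fintype.expect_eq_sum_div_card, Finset.sum_boole]
  congr 3
  ext
  simp

end Prob

section Resample

/-- Process the entries of a list one after the other, the entry `v` being treated with the
randomness `x v`. -/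
def run {ι X σ : Type*} (step : σ → ι → X → σ) (x : ι → X) (l : List ι) (s : σ) : σ :=
  l.foldl (fun s v => step s v (x v)) s

theorem run_cons {ι X σ : Type*} (step : σ → ι → X → σ) (x : ι → X) (v : ι) (l : List ι) (s : σ) :
    run step x (v :: l) s = run step x l (step s v (x v)) := rfl

theorem run_congr {ι X σ : Type*} {step : σ → ι → X → σ} {x x' : ι → X} {l : List ι} (s : σ)
    (h : ∀ v ∈ l, x v = x' v) : run step x l s = run step x' l s := by
  induction l generalizing s with
  | nil => rfl
  | cons w l ih =>
    rw [run_cons, run_cons, h w (by simp)]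
    exact ih _ fun v hv => h v (by simp [hv])

/-- Every entry of the list is good at the moment when it is about to be processed. -/
def GoodPath {ι X σ : Type*} (step : σ → ι → X → σ) (Good : ι → σ → Prop) (x : ι → X)
    (l : List ι) (s : σ) : Prop :=
  ∀ pre v post, l = pre ++ v :: post → Good v (run step x pre s)

theorem goodPath_cons {ι X σ : Type*} {step : σ → ι → X → σ} {Good : ι → σ → Prop} {x : ι → X}
    {v : ι} {l : List ι} {s : σ} :
    GoodPath step Good x (v :: l) s ↔ Good v s ∧ GoodPath step Good x l (step s v (x v)) := by
  constructor
  · refine fun h => ⟨h [] v l rfl, fun pre w post hl => ?_⟩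
    exact h (v :: pre) w post (by rw [hl]; rfl)
  · rintro ⟨h1, h2⟩ pre w post hl
    cases pre with
    | nil =>
      obtain ⟨rfl, rfl⟩ := List.cons.inj hl
      exact h1
    | cons a pre =>
      obtain ⟨rfl, hl'⟩ := List.cons.inj hl
      exact h2 pre w post hl'

/-- The coordinates of a uniformly random function are independent. -/
theorem expect_prod_eq_prod_expect {ι X : Type*} [Fintype ι] [DecidableEq ι]
    [Fintype X] (f : ι → X → ℝ) :
    𝔼 x : ι → X, ∏ i, f i (x i) = ∏ i, 𝔼 y, f i y := by
  simp only [Fintype.expect_eq_sum_div_card, Finset.prod_div_distrib, Finset.prod_const,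
    Finset.prod_univ_sum, Fintype.card_pi, Finset.card_univ, Fintype.piFinset_univ, Nat.cast_pow]

variable {ι X σ : Type*} [Fintype ι] [DecidableEq ι] [Fintype X] [Nonempty X]

/-- Resampling one coordinate of a uniformly random function does not change its distribution. -/
theorem expect_resample (i : ι) (f : (ι → X) → ℝ) :
    𝔼 x, f x = 𝔼 x, 𝔼 y, f (Function.update x i y) := by
  let e : (ι → X) × X ≃ (ι → X) × X :=
    Function.Involutive.toPerm (fun p => (Function.update p.1 i p.2, p.1 i))
      (fun p => by simp)
  calc 𝔼 x, f x = 𝔼 x, 𝔼 _y : X, f x := by simp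
    _ = 𝔼 p : (ι → X) × X, f p.1 := (expect_prod fun p : (ι → X) × X => f p.1).symm
    _ = 𝔼 p : (ι → X) × X, f (Function.update p.1 i p.2) :=
        (Fintype.expect_equiv e _ _ fun _ => rfl).symm
    _ = _ := expect_prod _

open Classical in
/-- The supermartingale argument: if the potential does not increase on average when a good entry
is processed, then its final expectation on the event that all entries were good is at most its
initial value. -/
theorem expect_run_le (step : σ → ι → X → σ) (Good : ι → σ → Prop) (Ψ : List ι → σ → ℝ)
    (h0 : ∀ l s, 0 ≤ Ψ l s)
    (hstep : ∀ v l s, (v :: l).Nodup → Good v s → 𝔼 y, Ψ l (step s v y) ≤ Ψ (v :: l) s)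
    (l : List ι) (hl : l.Nodup) (s : σ) :
    𝔼 x : ι → X, (if GoodPath step Good x l s then Ψ [] (run step x l s) else 0) ≤ Ψ l s := by
  induction l generalizing s with
  | nil =>
    refine expect_le_of_forall_le fun x => ?_
    split_ifs
    · exact le_rfl
    · exact h0 _ _
  | cons v l ih =>
    have hvl := hl
    obtain ⟨hv, hl⟩ := List.nodup_cons.1 hl
    by_cases hg : Good v s
    · refine le_trans ?_ (hstep v l s hvl hg)
      rw [expect_resample v, Finset.expect_comm]
      refine Finset.expect_le_expect fun y _ => ?_
      refine le_trans (Finset.expect_le_expect fun x _ => ?_) (ih hl (step s v y))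
      have hne : ∀ w ∈ l, Function.update x v y w = x w := fun w hw =>
        Function.update_of_ne (fun h : w = v => hv (h ▸ hw)) _ _
      have hgood : GoodPath step Good (Function.update x v y) (v :: l) s ↔
          GoodPath step Good x l (step s v y) := by
        rw [goodPath_cons, Function.update_self]
        refine ⟨fun h pre w post e => ?_, fun h => ⟨hg, fun pre w post e => ?_⟩⟩
        · rw [← run_congr _ fun u hu => hne u (by rw [e]; simp [hu])]
          exact h.2 pre w post e
        · rw [run_congr _ fun u hu => hne u (by rw [e]; simp [hu])]
          exact h pre w post e
      rw [run_cons, Function.update_self, run_congr _ hne]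
      simp only [hgood, le_refl]
    · refine le_trans (expect_le_of_forall_le fun x => ?_) (h0 _ _)
      rw [if_neg fun h => hg (goodPath_cons.1 h).1]

open Classical in
/-- The exponential moment bound for the upper tail of a sum of independent events. -/
theorem prob_card_ge_le (J : Finset ι) (E : ι → Finset X) {p lam a : ℝ} (hlam : 0 ≤ lam)
    (hp : ∀ i ∈ J, ((E i).card : ℝ) ≤ p * Fintype.card X) :
    prob (fun x : ι → X => a ≤ ((Finset.card {i ∈ J | x i ∈ E i} : ℕ) : ℝ)) ≤
      Real.exp (J.card * (p * (Real.exp lam - 1)) - lam * a) := by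
  have hX : (0 : ℝ) < Fintype.card X := by exact_mod_cast Fintype.card_pos
  have hexp : 0 ≤ Real.exp lam - 1 := by linarith [Real.one_le_exp hlam]
  let f : ι → X → ℝ := fun i y => if i ∈ J ∧ y ∈ E i then Real.exp lam else 1
  have hf : ∀ x : ι → X, ∏ i, f i (x i) =
      Real.exp (lam * ((Finset.card {i ∈ J | x i ∈ E i} : ℕ) : ℝ)) := by
    intro x
    rw [Finset.prod_ite, Finset.prod_const_one, mul_one, Finset.prod_const, ← Real.exp_nat_mul,
      mul_comm]
    congr 4
    ext i
    simp
  have hE : ∀ i, 𝔼 y, f i y ≤ if i ∈ J then Real.exp (p * (Real.exp lam - 1)) else 1 := by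
    intro i
    split_ifs with hi
    · have h1 : ∀ y, f i y = 1 + (Real.exp lam - 1) * (if y ∈ E i then 1 else 0) := by
        intro y
        by_cases hy : y ∈ E i <;> simp [f, hi, hy]
      calc 𝔼 y, f i y = 1 + (Real.exp lam - 1) * ((E i).card / Fintype.card X) := by
            simp only [h1, Finset.expect_add_distrib, ← Finset.mul_expect, Fintype.expect_const,
              Fintype.expect_eq_sum_div_card (fun y => if y ∈ E i then (1 : ℝ) else 0)]
            simp
        _ ≤ 1 + (Real.exp lam - 1) * p := by
            have := (div_le_iff₀ hX).2 (hp i hi)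
            gcongr
        _ ≤ _ := by linarith [Real.add_one_le_exp (p * (Real.exp lam - 1))]
    · simp [f, hi]
  calc _ ≤ 𝔼 x : ι → X, Real.exp (-(lam * a)) * ∏ i, f i (x i) := by
        refine prob_le_expect (fun x => ?_) fun x hx => ?_
        · rw [hf]; positivity
        · rw [hf, ← Real.exp_add]
          exact Real.one_le_exp (by nlinarith)
    _ = Real.exp (-(lam * a)) * ∏ i, 𝔼 y, f i y := by
        rw [← Finset.mul_expect, expect_prod_eq_prod_expect]
    _ ≤ Real.exp (-(lam * a)) * ∏ i, if i ∈ J then Real.exp (p * (Real.exp lam - 1)) else 1 := by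
        refine mul_le_mul_of_nonneg_left (Finset.prod_le_prod (fun i _ => ?_) fun i _ => hE i)
          (Real.exp_nonneg _)
        exact Finset.expect_nonneg fun y _ => by
          simp only [f]; split_ifs <;> positivity
    _ = _ := by
        rw [Finset.prod_ite_mem, Finset.univ_inter, Finset.prod_const, ← Real.exp_nat_mul,
          ← Real.exp_add]
        ring_nf

end Resample

/-! ### Reduction to a finite probability space -/

section Transfer

variable {α : Type} [Fintype α] [Nonempty α] [MeasurableSpace α] [MeasurableSingletonClass α]

theorem unif_singleton (a : α) : unif α {a} = (Fintype.card α : ENNReal)⁻¹ := by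
  rw [unif, PMF.toMeasure_apply_singleton _ _ (MeasurableSet.singleton a)]
  simp

theorem unif_apply (p : α → Prop) : unif α {a | p a} = ENNReal.ofReal (prob p) := by
  classical
  have h : {a | p a} = ((Finset.univ.filter p : Finset α) : Set α) := by ext; simp
  have hc : (0 : ℝ) < Fintype.card α := by exact_mod_cast Fintype.card_pos
  rw [h, ← sum_measure_singleton]
  simp only [unif_singleton, Finset.sum_const, nsmul_eq_mul]
  have hp : prob p = (Finset.univ.filter p).card / Fintype.card α := by
    rw [← prob_mem]
    exact congrArg prob (by ext; simp)
  rw [hp, ENNReal.ofReal_div_of_pos hc, ENNReal.ofReal_natCast, ENNReal.ofReal_natCast,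
    ENNReal.div_eq_inv_mul, mul_comm]

/-- A measure on a finite type is determined by its values on points. -/
theorem eq_unif_of_singleton {μ : Measure α}
    (h : ∀ a, μ {a} = (Fintype.card α : ENNReal)⁻¹) : μ = unif α :=
  Measure.ext_of_singleton fun a => by rw [h, unif_singleton]

theorem unif_prod {β : Type} [Fintype β] [Nonempty β] [MeasurableSpace β]
    [MeasurableSingletonClass β] : (unif α).prod (unif β) = unif (α × β) := by
  refine eq_unif_of_singleton fun a => ?_
  rw [← Prod.mk.eta (p := a), ← Set.singleton_prod_singleton, Measure.prod_prod, unif_singleton,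
    unif_singleton, Fintype.card_prod, Nat.cast_mul, ENNReal.mul_inv (by simp) (by simp)]

/-- Finitely many coordinates of an infinite product of uniform distributions are uniform. -/
theorem map_infinitePi_unif {ι κ : Type} [Fintype κ] [DecidableEq κ] {β : ι → Type}
    [∀ i, Fintype (β i)] [∀ i, Nonempty (β i)] [∀ i, MeasurableSpace (β i)]
    [∀ i, MeasurableSingletonClass (β i)] (e : κ ↪ ι) :
    (Measure.infinitePi fun i => unif (β i)).map (fun x (k : κ) => x (e k)) =
      unif ((k : κ) → β (e k)) := by
  classical
  refine eq_unif_of_singleton fun a => ?_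
  rw [Measure.map_apply (by fun_prop) (MeasurableSet.singleton a)]
  have : (fun (x : (i : ι) → β i) (k : κ) => x (e k)) ⁻¹' {a} =
      Set.pi (Finset.univ.map e : Finset ι) fun i => {y | ∀ k, ∀ h : e k = i, y = h ▸ a k} := by
    ext x
    simp only [Set.mem_preimage, Set.mem_singleton_iff, Set.mem_pi, Finset.mem_coe,
      Finset.mem_map, Finset.mem_univ, true_and, Set.mem_ofPred_eq]
    constructor
    · rintro rfl i - k rfl
      rfl
    · intro h
      funext k
      exact h (e k) ⟨k, rfl⟩ k rfl
  have hs : ∀ k, {y : β (e k) | ∀ k', ∀ h : e k' = e k, y = h ▸ a k'} = {a k} := by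
    intro k
    ext y
    simp only [Set.mem_ofPred_eq, Set.mem_singleton_iff]
    constructor
    · exact fun h => h k rfl
    · rintro rfl k' h
      obtain rfl := e.injective h
      rfl
  rw [this, Measure.infinitePi_pi _ fun i _ => Set.Finite.measurableSet (Set.toFinite _),
    Finset.prod_map]
  simp only [hs, unif_singleton]
  rw [Fintype.card_pi, Nat.cast_prod, ENNReal.prod_inv_distrib]
  exact fun i _ j _ _ => by simp

theorem pi_unif {ι : Type} [Fintype ι] [DecidableEq ι] :
    (Measure.pi fun _ : ι => unif α) = unif (ι → α) := by
  refine eq_unif_of_singleton fun a => ?_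
  rw [Measure.pi_singleton]
  simp only [unif_singleton, Finset.prod_const, Fintype.card_pi, Finset.card_univ,
    Nat.cast_pow, ENNReal.inv_pow]

end Transfer

instance (m : ℕ) : MeasurableSingletonClass (Equiv.Perm (Fin m)) := ⟨fun _ => trivial⟩

/-- The part of a tape that is used if no permutation of more than `n` positions is needed and no
while loop lasts longer than `T` rounds. The coin and the sample of a vertex are paired. -/
abbrev FiniteTape (n Δ T : ℕ) : Type :=
  (Fin n → Bool × Fin (Δ + 1)) × ((m : Fin (n + 1)) → Equiv.Perm (Fin m)) ×
    (Fin n → Fin T → Fin (Δ + 1))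

/-- Forget all but finitely many random choices. -/
def truncate {n Δ : ℕ} (T : ℕ) (ω : Tape n Δ) : FiniteTape n Δ T :=
  (fun v => (ω.1 v, ω.2.1 v), fun m => ω.2.2.1 m, fun v j => ω.2.2.2 (v, j))

/-- Events that depend only on the truncated tape have their probability in the finite space. -/
theorem tapeMeasure_truncate {n Δ : ℕ} (T : ℕ) (p : FiniteTape n Δ T → Prop) :
    tapeMeasure n Δ {ω | p (truncate T ω)} = ENNReal.ofReal (prob p) := by
  classical
  let ePerm : Fin (n + 1) ↪ ℕ := ⟨fun i => i, Fin.val_injective⟩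
  let eDraw : Fin n × Fin T ↪ Fin n × ℕ :=
    ⟨fun q => (q.1, q.2), fun a b h => by
      simp only [Prod.mk.injEq] at h
      exact Prod.ext h.1 (Fin.ext h.2)⟩
  let g : Tape n Δ → (Fin n → Bool) × (Fin n → Fin (Δ + 1)) ×
      ((m : Fin (n + 1)) → Equiv.Perm (Fin m)) × (Fin n × Fin T → Fin (Δ + 1)) :=
    Prod.map id (Prod.map id (Prod.map (fun x k => x (ePerm k)) (fun x q => x (eDraw q))))
  have hg : MeasurePreserving g (tapeMeasure n Δ) (unif _) := by
    rw [← unif_prod, ← unif_prod, ← unif_prod, ← pi_unif, ← pi_unif]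
    exact (MeasurePreserving.id _).prod <| (MeasurePreserving.id _).prod <|
      MeasurePreserving.prod ⟨by fun_prop, map_infinitePi_unif ePerm⟩
        ⟨by fun_prop, map_infinitePi_unif eDraw⟩
  let e : (Fin n → Bool) × (Fin n → Fin (Δ + 1)) ×
      ((m : Fin (n + 1)) → Equiv.Perm (Fin m)) × (Fin n × Fin T → Fin (Δ + 1)) ≃
      FiniteTape n Δ T :=
    { toFun := fun t => (fun v => (t.1 v, t.2.1 v), t.2.2.1, fun v j => t.2.2.2 (v, j))
      invFun := fun t => (fun v => (t.1 v).1, fun v => (t.1 v).2, t.2.1, fun q => t.2.2 q.1 q.2)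
      left_inv := fun t => rfl
      right_inv := fun t => rfl }
  have : {ω | p (truncate T ω)} = g ⁻¹' {t | p (e t)} := rfl
  rw [this, hg.measure_preimage (Set.Finite.measurableSet (Set.toFinite _)).nullMeasurableSet,
    unif_apply, prob_comp_equiv]

/-! ### The colouring process behind the algorithm -/

section Run

variable {n Δ : ℕ}

open Classical in
/-- The colours not assigned to any neighbour of `v`. -/
noncomputable def free (G : SimpleGraph (Fin n)) (s : Fin n → Option (Fin (Δ + 1))) (v : Fin n) :
    Finset (Fin (Δ + 1)) :=
  {c | ∀ u, G.Adj v u → s u ≠ some c}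

open Classical in
/-- The effect on the colouring of trying the colour `c` on `v`. -/
noncomputable def assign (G : SimpleGraph (Fin n)) (s : Fin n → Option (Fin (Δ + 1))) (v : Fin n)
    (c : Fin (Δ + 1)) : Fin n → Option (Fin (Δ + 1)) :=
  if c ∈ free G s v then Function.update s v (some c) else s

/-- One-Shot-Coloring at a single vertex, including its coin flip. -/
noncomputable def oneStep (G : SimpleGraph (Fin n)) (s : Fin n → Option (Fin (Δ + 1))) (v : Fin n)
    (y : Bool × Fin (Δ + 1)) : Fin n → Option (Fin (Δ + 1)) :=
  if y.1 then assign G s v y.2 else s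

open Classical in
/-- The effect of the while loop at `v` on the colouring: `v` gets the first free colour drawn.
If there is none, the colouring is not changed. -/
noncomputable def greedyStep (G : SimpleGraph (Fin n)) (s : Fin n → Option (Fin (Δ + 1)))
    (v : Fin n) (draw : ℕ → Fin (Δ + 1)) : Fin n → Option (Fin (Δ + 1)) :=
  if h : ∃ j, draw j ∈ free G s v then Function.update s v (some (draw (Nat.find h))) else s

theorem mem_free {G : SimpleGraph (Fin n)} {s : Fin n → Option (Fin (Δ + 1))} {v : Fin n}
    {c : Fin (Δ + 1)} : c ∈ free G s v ↔ ∀ u, G.Adj v u → s u ≠ some c := by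
  simp [free]

/-- The lists `L(c)` are the colour classes, without repetitions. -/
def State.Valid (s : State n Δ) : Prop :=
  ∀ c, (s.L c).Nodup ∧ ∀ u, u ∈ s.L c ↔ s.color u = some c

theorem initial_valid : (initial n Δ).Valid := fun c => by simp [initial]

theorem State.Valid.tick {s : State n Δ} (h : s.Valid) (m : ℕ) : (s.tick m).Valid := h

theorem scan_fst (G : SimpleGraph (Fin n)) (v : Fin n) (l : List (Fin n)) :
    (scan G v l).1 = true ↔ ∃ u ∈ l, G.Adj v u := by
  induction l with
  | nil => simp [scan]
  | cons u l ih =>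
    by_cases h : G.Adj v u
    · simp [scan, h]
    · simp [scan, h, ih]

theorem scan_snd_le (G : SimpleGraph (Fin n)) (v : Fin n) (l : List (Fin n)) :
    (scan G v l).2 ≤ l.length := by
  induction l with
  | nil => simp [scan]
  | cons u l ih =>
    by_cases h : G.Adj v u <;> simp [scan, h, ih]

theorem State.Valid.scan_iff {s : State n Δ} (h : s.Valid) (G : SimpleGraph (Fin n)) (v : Fin n)
    (c : Fin (Δ + 1)) : (scan G v (s.L c)).1 = true ↔ c ∉ free G s.color v := by
  rw [scan_fst, mem_free]
  push Not
  exact exists_congr fun u => by rw [(h c).2, and_comm]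

theorem tryColor_of_not_mem_free {G : SimpleGraph (Fin n)} {s : State n Δ} (h : s.Valid)
    {v : Fin n} {c : Fin (Δ + 1)} (hc : c ∉ free G s.color v) :
    tryColor G v c s = s.tick ((scan G v (s.L c)).2 + 1) := by
  rw [tryColor, if_pos ((h.scan_iff G v c).2 hc)]

theorem tryColor_of_mem_free {G : SimpleGraph (Fin n)} {s : State n Δ} (h : s.Valid)
    {v : Fin n} {c : Fin (Δ + 1)} (hc : c ∈ free G s.color v) :
    tryColor G v c s =
      { color := Function.update s.color v (some c)
        L := Function.update s.L c (v :: s.L c)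
        time := s.time + (scan G v (s.L c)).2 + 3 } := by
  rw [tryColor, if_neg fun h' => (h.scan_iff G v c).1 h' hc]

theorem tryColor_color {G : SimpleGraph (Fin n)} {s : State n Δ} (h : s.Valid) (v : Fin n)
    (c : Fin (Δ + 1)) : (tryColor G v c s).color = assign G s.color v c := by
  by_cases hc : c ∈ free G s.color v
  · rw [tryColor_of_mem_free h hc, assign, if_pos hc]
  · rw [tryColor_of_not_mem_free h hc, assign, if_neg hc]
    rfl

theorem State.Valid.tryColor {G : SimpleGraph (Fin n)} {s : State n Δ} (h : s.Valid) {v : Fin n}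
    (hv : s.color v = none) (c : Fin (Δ + 1)) : (tryColor G v c s).Valid := by
  by_cases hc : c ∈ free G s.color v
  · rw [tryColor_of_mem_free h hc]
    intro c'
    have hvL : ∀ c', v ∉ s.L c' := fun c' hm => by
      rw [(h c').2, hv] at hm
      cases hm
    by_cases hcc : c' = c
    · subst hcc
      simp only [Function.update_self, List.nodup_cons, List.mem_cons]
      refine ⟨⟨hvL c', (h c').1⟩, fun u => ?_⟩
      by_cases hu : u = v
      · subst hu; simp
      · simp [hu, (h c').2]
    · simp only [Function.update_of_ne hcc]
      refine ⟨(h c').1, fun u => ?_⟩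
      by_cases hu : u = v
      · subst hu
        simp [hvL c', Ne.symm hcc]
      · simp [hu, (h c').2]
  · rw [tryColor_of_not_mem_free h hc]
    exact h.tick _

theorem tryColor_time_le (G : SimpleGraph (Fin n)) (v : Fin n) (c : Fin (Δ + 1)) (s : State n Δ) :
    (tryColor G v c s).time ≤ s.time + (s.L c).length + 3 := by
  have := scan_snd_le G v (s.L c)
  unfold SparseColoring.tryColor State.tick
  split_ifs <;> dsimp only <;> omega

theorem tryColor_length_le (G : SimpleGraph (Fin n)) (v : Fin n) (c : Fin (Δ + 1)) (s : State n Δ)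
    (c' : Fin (Δ + 1)) :
    ((tryColor G v c s).L c').length ≤ (s.L c').length + if c = c' then 1 else 0 := by
  unfold SparseColoring.tryColor State.tick
  split_ifs with h1 h2 h2
  · simp
  · simp
  · subst h2; simp
  · simp [Function.update_of_ne (Ne.symm h2)]

theorem State.Valid.length_le {s : State n Δ} (h : s.Valid) (c : Fin (Δ + 1)) :
    (s.L c).length ≤ n := by
  simpa using (h c).1.length_le_card

theorem assign_of_ne (G : SimpleGraph (Fin n)) (s : Fin n → Option (Fin (Δ + 1))) {u v : Fin n}
    (h : u ≠ v) (c : Fin (Δ + 1)) : assign G s v c u = s u := by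
  unfold assign
  split_ifs
  · exact Function.update_of_ne h _ _
  · rfl

theorem oneStep_of_ne (G : SimpleGraph (Fin n)) (s : Fin n → Option (Fin (Δ + 1))) {u v : Fin n}
    (h : u ≠ v) (y : Bool × Fin (Δ + 1)) : oneStep G s v y u = s u := by
  unfold oneStep
  split_ifs
  · exact assign_of_ne G s h _
  · rfl

theorem greedyStep_of_ne (G : SimpleGraph (Fin n)) (s : Fin n → Option (Fin (Δ + 1)))
    {u v : Fin n} (h : u ≠ v) (draw : ℕ → Fin (Δ + 1)) : greedyStep G s v draw u = s u := by
  unfold greedyStep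
  split_ifs
  · exact Function.update_of_ne h _ _
  · rfl

/-- A step that only changes the value at the vertex treated: a run does not change the values
outside its list. -/
theorem run_apply_of_not_mem {X β : Type*} {step : (Fin n → β) → Fin n → X → Fin n → β}
    (hstep : ∀ s v y u, u ≠ v → step s v y u = s u) {x : Fin n → X} {l : List (Fin n)}
    (s : Fin n → β) {u : Fin n} (hu : u ∉ l) : run step x l s u = s u := by
  induction l generalizing s with
  | nil => rfl
  | cons v l ih =>
    rw [run_cons, ih _ fun h => hu (by simp [h]), hstep]
    rintro rfl
    simp at hu

/-! ### One-Shot-Coloring as a run -/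

/-- The loop of One-Shot-Coloring follows the colouring process. The list `L(c)` grows at most once per
sample `c`, and each vertex costs at most `N + 4` steps if no list gets longer than `N`. -/
theorem foldl_oneShot {G : SimpleGraph (Fin n)} (x : Fin n → Bool × Fin (Δ + 1))
    {l : List (Fin n)} (hl : l.Nodup) {s : State n Δ} (hs : s.Valid)
    (hblank : ∀ v ∈ l, s.color v = none) {N : ℕ}
    (hN : ∀ c, (s.L c).length + l.countP (fun v => (x v).2 = c) ≤ N) :
    ∀ s', s' = (l.filter fun v => (x v).1).foldl
        (fun s v => tryColor G v (x v).2 (s.tick 1)) s →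
      s'.Valid ∧ s'.color = run (oneStep G) x l s.color ∧
      (∀ c, (s'.L c).length ≤ (s.L c).length + l.countP (fun v => (x v).2 = c)) ∧
      s'.time ≤ s.time + l.length * (N + 4) := by
  induction l generalizing s with
  | nil =>
    rintro s' rfl
    exact ⟨hs, rfl, fun c => by simp, by simp⟩
  | cons v l ih =>
    rintro s' rfl
    obtain ⟨hv, hl⟩ := List.nodup_cons.1 hl
    simp only [List.countP_cons, decide_eq_true_eq] at hN
    by_cases hx : (x v).1
    · have h1 : ((v :: l).filter fun v => (x v).1) = v :: l.filter fun v => (x v).1 := by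
        simp [hx]
      rw [h1, List.foldl_cons]
      have hlen := tryColor_length_le G v (x v).2 (s.tick 1)
      obtain ⟨i1, i2, i3, i4⟩ := ih hl (s := tryColor G v (x v).2 (s.tick 1))
        ((hs.tick 1).tryColor (hblank v (by simp)) _) (fun u hu => by
          rw [tryColor_color (hs.tick 1), assign_of_ne _ _ (ne_of_mem_of_not_mem hu hv)]
          exact hblank u (by simp [hu]))
        (fun c => by
          have a := hlen c
          have b := hN c
          simp only [State.tick] at a ⊢
          omega) _ rfl
      refine ⟨i1, ?_, fun c => ?_, ?_⟩
      · rw [i2, tryColor_color (hs.tick 1), run_cons, oneStep, if_pos hx]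
        rfl
      · have a := hlen c
        have b := i3 c
        simp only [List.countP_cons, decide_eq_true_eq]
        simp only [State.tick] at a b ⊢
        omega
      · have a := tryColor_time_le G v (x v).2 (s.tick 1)
        have b := hN (x v).2
        have a' : (s.tick 1).time = s.time + 1 := rfl
        have a'' : (s.tick 1).L = s.L := rfl
        rw [a', a''] at a
        rw [List.length_cons, Nat.add_mul]
        omega
    · have h1 : ((v :: l).filter fun v => (x v).1) = l.filter fun v => (x v).1 := by
        simp [hx]
      rw [h1]
      obtain ⟨i1, i2, i3, i4⟩ := ih hl hs (fun u hu => hblank u (by simp [hu]))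
        (fun c => by have b := hN c; omega) _ rfl
      refine ⟨i1, ?_, fun c => ?_, ?_⟩
      · rw [i2, run_cons, oneStep, if_neg hx]
      · have b := i3 c
        simp only [List.countP_cons, decide_eq_true_eq]
        omega
      · simp only [List.length_cons]
        nlinarith

/-! ### The while loop of Greedy-Coloring -/

/-- As long as the colours drawn are not free, the rounds of the while loop only cost time. -/
theorem rounds_eq_tick {G : SimpleGraph (Fin n)} {draw : ℕ → Fin (Δ + 1)} {v : Fin n}
    {s : State n Δ} (hs : s.Valid) {N : ℕ} (hN : ∀ c, (s.L c).length ≤ N) :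
    ∀ j, (∀ i < j, draw i ∉ free G s.color v) → ∃ m ≤ j * (N + 3),
      rounds (fun j s => tryColor G v (draw j) (s.tick 2)) s j = s.tick m := by
  intro j
  induction j with
  | zero => exact fun _ => ⟨0, by simp, rfl⟩
  | succ j ih =>
    intro h
    obtain ⟨m, hm, e⟩ := ih fun i hi => h i (by omega)
    refine ⟨m + 2 + ((scan G v (s.L (draw j))).2 + 1), ?_, ?_⟩
    · have := scan_snd_le G v (s.L (draw j))
      have := hN (draw j)
      linarith
    · rw [rounds, e, tryColor_of_not_mem_free ((hs.tick m).tick 2) (h j (by omega))]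
      simp only [State.tick]
      congr 1
      omega

/-- If one of the first `t` colours drawn is free, then the while loop at a blank vertex ends within `t`
rounds, each of them costing at most `N + 5` steps. -/
theorem greedyVertex_eq {G : SimpleGraph (Fin n)} {draw : ℕ → Fin (Δ + 1)} {v : Fin n}
    {s : State n Δ} (hs : s.Valid) (hv : s.color v = none) {N : ℕ} (hN : ∀ c, (s.L c).length ≤ N)
    {t : ℕ} (ht : ∃ j < t, draw j ∈ free G s.color v) :
    ∃ s', greedyVertex G draw v s = some s' ∧ s'.Valid ∧
      s'.color = greedyStep G s.color v draw ∧
      (∀ c, (s'.L c).length ≤ (s.L c).length + (List.range t).countP fun j => draw j = c) ∧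
      s'.time ≤ s.time + t * (N + 5) := by
  classical
  obtain ⟨j₁, hj₁, hf₁⟩ := ht
  have hex : ∃ j, draw j ∈ free G s.color v := ⟨j₁, hf₁⟩
  set j₀ := Nat.find hex with hj₀
  have hf : draw j₀ ∈ free G s.color v := Nat.find_spec hex
  have hmin : ∀ i < j₀, draw i ∉ free G s.color v := fun i hi => Nat.find_min hex hi
  have hlt : j₀ < t := (Nat.find_min' hex hf₁).trans_lt hj₁
  set body : ℕ → State n Δ → State n Δ := fun j s => tryColor G v (draw j) (s.tick 2)
  obtain ⟨m, hm, hr⟩ := rounds_eq_tick hs hN j₀ hmin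
  have hr' : rounds body s (j₀ + 1) = tryColor G v (draw j₀) ((s.tick m).tick 2) := by
    rw [rounds, hr]
  have hval : ((s.tick m).tick 2).Valid := hs
  have hcol : (rounds body s (j₀ + 1)).color = Function.update s.color v (some (draw j₀)) := by
    rw [hr', tryColor_of_mem_free hval hf]
    rfl
  have hend : ¬ (rounds body s (j₀ + 1)).color v = none := by
    rw [hcol]; simp
  have hwex : ∃ j, ¬ (rounds body s j).color v = none := ⟨_, hend⟩
  have hfind : Nat.find hwex = j₀ + 1 := by
    rw [Nat.find_eq_iff]
    refine ⟨hend, fun i hi => ?_⟩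
    obtain ⟨m', -, e⟩ := rounds_eq_tick hs hN i fun k hk => hmin k (by omega)
    rw [not_not, e]
    exact hv
  refine ⟨rounds body s (j₀ + 1), ?_, ?_, ?_, fun c => ?_, ?_⟩
  · rw [greedyVertex, whileLoop, dif_pos hwex]
    exact congrArg (fun k => some (rounds body s k)) (by convert hfind)
  · rw [hr']
    exact hval.tryColor hv _
  · rw [hcol, greedyStep, dif_pos hex]
  · rw [hr']
    refine (tryColor_length_le G v (draw j₀) _ c).trans ?_
    simp only [State.tick]
    gcongr
    split_ifs with hc
    · exact List.countP_pos_iff.2 ⟨j₀, by simpa using hlt, by simpa using hc⟩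
    · exact Nat.zero_le _
  · rw [hr']
    have a := tryColor_time_le G v (draw j₀) ((s.tick m).tick 2)
    have b := hN (draw j₀)
    have a' : ((s.tick m).tick 2).time = s.time + m + 2 := rfl
    have a'' : ((s.tick m).tick 2).L = s.L := rfl
    rw [a', a''] at a
    have d := Nat.mul_le_mul_right (N + 5) (Nat.succ_le_of_lt hlt)
    have e : j₀.succ * (N + 5) = j₀ * (N + 3) + 2 * j₀ + (N + 5) := by rw [Nat.succ_eq_add_one]; ring
    omega

/-- If every while loop has a free colour among its first `t v` draws, then Greedy-Coloring
terminates, with bounds for the lists and for the time. -/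
theorem foldlM_greedyVertex {G : SimpleGraph (Fin n)} {draw : Fin n → ℕ → Fin (Δ + 1)}
    {t : Fin n → ℕ} {l : List (Fin n)} (hl : l.Nodup) {s : State n Δ} (hs : s.Valid)
    (hblank : ∀ v ∈ l, s.color v = none) {N : ℕ}
    (hN : ∀ s' : State n Δ, s'.Valid →
      (∀ c, (s'.L c).length ≤ (s.L c).length +
        (l.map fun v => (List.range (t v)).countP fun j => draw v j = c).sum) →
      ∀ c, (s'.L c).length ≤ N)
    (hgood : ∀ pre v post, l = pre ++ v :: post →
      ∃ j < t v, draw v j ∈ free G (run (greedyStep G) draw pre s.color) v) :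
    ∃ s', l.foldlM (fun s v => greedyVertex G (draw v) v (s.tick 2)) s = some s' ∧ s'.Valid ∧
      s'.color = run (greedyStep G) draw l s.color ∧
      (∀ c, (s'.L c).length ≤ (s.L c).length +
        (l.map fun v => (List.range (t v)).countP fun j => draw v j = c).sum) ∧
      s'.time ≤ s.time + (l.map fun v => 2 + t v * (N + 5)).sum := by
  induction l generalizing s with
  | nil => exact ⟨s, rfl, hs, rfl, by simp, by simp⟩
  | cons v l ih =>
    obtain ⟨hv, hl⟩ := List.nodup_cons.1 hl
    obtain ⟨s₁, e₁, v₁, c₁, l₁, t₁⟩ := greedyVertex_eq (hs.tick 2) (hblank v (by simp))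
      (hN _ (hs.tick 2) fun c => by simp [State.tick]) (hgood [] v l rfl)
    obtain ⟨s₂, e₂, v₂, c₂, l₂, t₂⟩ := ih hl v₁
      (fun u hu => by
        rw [c₁, greedyStep_of_ne _ _ (ne_of_mem_of_not_mem hu hv)]
        exact hblank u (by simp [hu]))
      (fun s' hs' h => hN s' hs' fun c => (h c).trans (by
        have := l₁ c
        simp only [State.tick, List.map_cons, List.sum_cons] at this ⊢
        omega))
      (fun pre w post e => by
        have := hgood (v :: pre) w post (by rw [e]; rfl)
        rw [run_cons] at this
        rw [c₁]
        exact this)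
    refine ⟨s₂, ?_, v₂, ?_, fun c => ?_, ?_⟩
    · rw [List.foldlM_cons, e₁]
      exact e₂
    · rw [c₂, c₁, run_cons]
      rfl
    · have a := l₁ c
      have b := l₂ c
      simp only [State.tick, List.map_cons, List.sum_cons] at a b ⊢
      omega
    · simp only [State.tick, List.map_cons, List.sum_cons] at t₁ t₂ ⊢
      omega

/-! ### Color-Sparse as a colouring process -/

/-- The colouring after One-Shot-Coloring, where `x v` is the coin and the sample of `v`. -/
noncomputable def oneShotColoring (G : SimpleGraph (Fin n)) (VS : List (Fin n))
    (x : Fin n → Bool × Fin (Δ + 1)) : Fin n → Option (Fin (Δ + 1)) :=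
  run (oneStep G) x VS fun _ => none

/-- The vertices left blank by One-Shot-Coloring. -/
noncomputable def leftover (G : SimpleGraph (Fin n)) (VS : List (Fin n))
    (x : Fin n → Bool × Fin (Δ + 1)) : List (Fin n) :=
  VS.filter fun v => (oneShotColoring G VS x v).isNone

/-- The list `S[π(1)], S[π(2)], …`. -/
def shuffle (S : List (Fin n)) (π : Equiv.Perm (Fin S.length)) : List (Fin n) :=
  List.ofFn fun i => S.get (π i)

theorem shuffle_nodup {S : List (Fin n)} (hS : S.Nodup) (π : Equiv.Perm (Fin S.length)) :
    (shuffle S π).Nodup :=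
  List.nodup_ofFn.2 ((List.nodup_iff_injective_get.1 hS).comp π.injective)

theorem shuffle_length (S : List (Fin n)) (π : Equiv.Perm (Fin S.length)) :
    (shuffle S π).length = S.length := List.length_ofFn

theorem mem_shuffle {S : List (Fin n)} {π : Equiv.Perm (Fin S.length)} {v : Fin n} :
    v ∈ shuffle S π ↔ v ∈ S := by
  rw [shuffle, List.mem_ofFn, List.mem_iff_get]
  exact ⟨fun ⟨i, hi⟩ => ⟨π i, hi⟩, fun ⟨i, hi⟩ => ⟨π.symm i, by simpa using hi⟩⟩

theorem leftover_nodup {G : SimpleGraph (Fin n)} {VS : List (Fin n)} (hVS : VS.Nodup)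
    (x : Fin n → Bool × Fin (Δ + 1)) : (leftover G VS x).Nodup := hVS.filter _

theorem length_le_of_nodup {l : List (Fin n)} (hl : l.Nodup) : l.length ≤ n := by
  simpa using hl.length_le_card

/-- If every while loop meets a free colour in time, then Color-Sparse terminates with the result of the
colouring process, and its running time is bounded by the numbers of rounds and the list lengths.
The bound `N` on the lists has to follow from the numbers of samples and draws of each colour; this is
the hypothesis `hN`. -/
theorem colorSparse_eq_some {G : SimpleGraph (Fin n)} {VS : List (Fin n)} (hVS : VS.Nodup)
    (hΔ : Δ < n) {ω : Tape n Δ} {x : Fin n → Bool × Fin (Δ + 1)}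
    (hx : x = fun v => (ω.1 v, ω.2.1 v)) {l : List (Fin n)}
    (hl : l = shuffle (leftover G VS x) (ω.2.2.1 _)) {draw : Fin n → ℕ → Fin (Δ + 1)}
    (hdraw : draw = fun v j => ω.2.2.2 (v, j)) {t : Fin n → ℕ} {N : ℕ}
    (hN₁ : ∀ c, VS.countP (fun v => (x v).2 = c) ≤ N)
    (hN : ∀ s' : State n Δ, s'.Valid →
      (∀ c, (s'.L c).length ≤ VS.countP (fun v => (x v).2 = c) +
        (l.map fun v => (List.range (t v)).countP fun j => draw v j = c).sum) →
      ∀ c, (s'.L c).length ≤ N)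
    (hgood : ∀ pre v post, l = pre ++ v :: post →
      ∃ j < t v, draw v j ∈ free G (run (greedyStep G) draw pre (oneShotColoring G VS x)) v) :
    ∃ s, colorSparse G VS ω = some s ∧
      s.color = run (greedyStep G) draw l (oneShotColoring G VS x) ∧
      (∀ c, (s.L c).length ≤ N) ∧
      s.time ≤ n * (N + 13) + (l.map t).sum * (N + 5) := by
  set U := VS.filter fun v => ω.1 v with hU
  set s₀ : State n Δ := (initial n Δ).tick VS.length
  obtain ⟨v₁, c₁, l₁, t₁⟩ := foldl_oneShot (G := G) x hVS (s := s₀.tick U.length)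
    ((initial_valid.tick VS.length).tick U.length) (fun _ _ => rfl) (N := N)
    (fun c => by
      have := hN₁ c
      have e : (s₀.tick U.length).L c = [] := rfl
      rw [e, List.length_nil]
      omega) (oneShot G ω.2.1 U s₀) (by rw [hx]; rfl)
  set s₁ := oneShot G ω.2.1 U s₀ with hs₁
  have c₁' : s₁.color = oneShotColoring G VS x := c₁
  have hS : (VS.filter fun v => (s₁.color v).isNone) = leftover G VS x := by
    rw [c₁']; rfl
  have l₁' : ∀ c, (s₁.L c).length ≤ VS.countP (fun v => (x v).2 = c) := fun c => by
    have := l₁ c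
    have e : (s₀.tick U.length).L c = [] := rfl
    rw [e, List.length_nil] at this
    omega
  set S := leftover G VS x with hSdef
  have hnd : l.Nodup := hl ▸ shuffle_nodup (leftover_nodup hVS x) _
  obtain ⟨s₂, e₂, v₂, c₂, l₂, t₂⟩ := foldlM_greedyVertex (G := G) (draw := draw) (t := t) hnd
    (s := (s₁.tick VS.length).tick S.length) ((v₁.tick VS.length).tick S.length)
    (fun v hv => by
      rw [hl, mem_shuffle, hSdef, leftover, List.mem_filter] at hv
      exact (congrFun c₁' v).trans (Option.isNone_iff_eq_none.1 hv.2))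
    (N := N) (fun s' hs' h => hN s' hs' fun c => (h c).trans (by
      have := l₁' c
      have e : ((s₁.tick VS.length).tick S.length).L c = s₁.L c := rfl
      rw [e]
      omega))
    (fun pre v post e => by
      have := hgood pre v post e
      rwa [← c₁'] at this)
  refine ⟨s₂, ?_, ?_, hN s₂ v₂ fun c => (l₂ c).trans ?_, ?_⟩
  · rw [← e₂, hl, hdraw]
    show greedy G ω.2.2.2 ω.2.2.1 (VS.filter fun v => (s₁.color v).isNone)
      (s₁.tick VS.length) = _
    rw [hS]
    rfl
  · rw [c₂, ← c₁']
    rfl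
  · have := l₁' c
    have e : ((s₁.tick VS.length).tick S.length).L c = s₁.L c := rfl
    rw [e]
    omega
  · have e₀ : (s₀.tick U.length).time = n + (Δ + 1) + VS.length + U.length := rfl
    have e₁ : ((s₁.tick VS.length).tick S.length).time = s₁.time + VS.length + S.length := rfl
    have h1 : VS.length ≤ n := length_le_of_nodup hVS
    have h2 : U.length ≤ n := length_le_of_nodup (hVS.filter _)
    have h3 : S.length ≤ n := length_le_of_nodup (leftover_nodup hVS x)
    have h4 : (l.map fun v => 2 + t v * (N + 5)).sum = 2 * l.length + (l.map t).sum * (N + 5) := by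
      rw [List.sum_map_add, List.sum_map_mul_right]
      simp [mul_comm]
    have h5 : l.length = S.length := by rw [hl, shuffle_length]
    have h6 := Nat.mul_le_mul_right (N + 4) h1
    rw [e₀] at t₁
    rw [e₁, h4, h5] at t₂
    have h7 : n * (N + 13) = n * (N + 4) + 9 * n := by ring
    omega

end Run

/-! ### Random permutations -/

open Classical in
/-- If one more position outside `B` has to avoid `D`, then the number of permutations shrinks by
the factor `(k - d - b) / (k - b)`, since all positions outside `B` are equivalent. -/
theorem card_perm_avoid_insert {k : ℕ} (B D : Finset (Fin k)) {a : Fin k} (ha : a ∉ B) :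
    (k - B.card) * (Finset.univ.filter fun π : Equiv.Perm (Fin k) =>
        ∀ i ∈ insert a B, π i ∉ D).card =
      (k - B.card - D.card) * (Finset.univ.filter fun π : Equiv.Perm (Fin k) =>
        ∀ i ∈ B, π i ∉ D).card := by
  set P := Finset.univ.filter fun π : Equiv.Perm (Fin k) => ∀ i ∈ B, π i ∉ D with hP
  have hsymm : ∀ y ∈ Bᶜ, (P.filter fun π => π y ∉ D).card = (P.filter fun π => π a ∉ D).card := by
    intro y hy
    rw [Finset.mem_compl] at hy
    have hfix : ∀ i ∈ B, Equiv.swap a y i = i := fun i hi =>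
      Equiv.swap_apply_of_ne_of_ne (ne_of_mem_of_not_mem hi ha) (ne_of_mem_of_not_mem hi hy)
    refine Finset.card_bij (fun π _ => π * Equiv.swap a y) (fun π hπ => ?_)
      (fun π _ π' _ h => mul_right_cancel h) (fun π hπ => ⟨π * Equiv.swap a y, ?_, ?_⟩)
    · simp only [hP, Finset.mem_filter, Finset.mem_univ, true_and, Equiv.Perm.mul_apply,
        Equiv.swap_apply_left] at hπ ⊢
      exact ⟨fun i hi => by rw [hfix i hi]; exact hπ.1 i hi, hπ.2⟩
    · simp only [hP, Finset.mem_filter, Finset.mem_univ, true_and, Equiv.Perm.mul_apply,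
        Equiv.swap_apply_right] at hπ ⊢
      exact ⟨fun i hi => by rw [hfix i hi]; exact hπ.1 i hi, hπ.2⟩
    · rw [mul_assoc, Equiv.swap_mul_self, mul_one]
  have hcount : ∀ π ∈ P, (Bᶜ.filter fun y => π y ∉ D).card = k - B.card - D.card := by
    intro π hπ
    simp only [hP, Finset.mem_filter, Finset.mem_univ, true_and] at hπ
    have e : Bᶜ.filter (fun y => π y ∉ D) = Bᶜ \ D.map π.symm.toEmbedding := by
      ext y
      simp [Finset.mem_map_equiv]
    rw [e, Finset.card_sdiff_of_subset, Finset.card_compl, Finset.card_map, Fintype.card_fin]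
    intro y hy
    rw [Finset.mem_map_equiv, Equiv.symm_symm] at hy
    exact Finset.mem_compl.2 fun hB => hπ y hB hy
  have hdouble := Finset.sum_card_bipartiteAbove_eq_sum_card_bipartiteBelow
    (s := Bᶜ) (t := P) (fun (y : Fin k) (π : Equiv.Perm (Fin k)) => π y ∉ D)
  simp only [Finset.bipartiteAbove, Finset.bipartiteBelow] at hdouble
  rw [Finset.sum_congr rfl hsymm, Finset.sum_congr rfl hcount, Finset.sum_const, Finset.sum_const,
    Finset.card_compl, Fintype.card_fin, smul_eq_mul, smul_eq_mul] at hdouble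
  rw [mul_comm _ P.card, ← hdouble]
  congr 2
  ext π
  simp [hP, and_comm]

/-- A random permutation maps `B` into the complement of `D` with probability at most
`(1 - |D| / k) ^ |B|`. -/
theorem prob_perm_avoid_le {k : ℕ} (B D : Finset (Fin k)) :
    prob (fun π : Equiv.Perm (Fin k) => ∀ i ∈ B, π i ∉ D) ≤
      (1 - (D.card : ℝ) / k) ^ B.card := by
  classical
  have hcard : (0 : ℝ) < Fintype.card (Equiv.Perm (Fin k)) := by exact_mod_cast Fintype.card_pos
  have hform : ∀ B : Finset (Fin k), prob (fun π : Equiv.Perm (Fin k) => ∀ i ∈ B, π i ∉ D) =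
      (Finset.univ.filter fun π : Equiv.Perm (Fin k) => ∀ i ∈ B, π i ∉ D).card /
        Fintype.card (Equiv.Perm (Fin k)) := fun B => by
    rw [← prob_mem]
    exact congrArg prob (by ext; simp)
  induction B using Finset.induction_on with
  | empty =>
    rw [hform]
    simp
  | insert a B ha ih =>
    have hBk : B.card < k := by
      have := Finset.card_lt_univ_of_notMem ha
      simpa using this
    have hDk : D.card ≤ k := by simpa using D.card_le_univ
    have hk : (0 : ℝ) < k := by exact_mod_cast (by omega : 0 < k)
    have hq : (0 : ℝ) < (k - B.card : ℕ) := by exact_mod_cast (by omega : 0 < k - B.card)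
    have h := card_perm_avoid_insert B D ha
    have h' : ((k - B.card : ℕ) : ℝ) *
        prob (fun π : Equiv.Perm (Fin k) => ∀ i ∈ insert a B, π i ∉ D) =
        ((k - B.card - D.card : ℕ) : ℝ) * prob (fun π : Equiv.Perm (Fin k) => ∀ i ∈ B, π i ∉ D) := by
      rw [hform, hform, ← mul_div_assoc, ← mul_div_assoc]
      congr 1
      exact_mod_cast h
    have hratio : ((k - B.card - D.card : ℕ) : ℝ) ≤ (k - B.card : ℕ) * (1 - (D.card : ℝ) / k) := by
      have h1 : (0 : ℝ) ≤ 1 - (D.card : ℝ) / k := by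
        rw [sub_nonneg, div_le_one hk]
        exact_mod_cast hDk
      rcases le_total D.card (k - B.card) with hle | hle
      · rw [Nat.cast_sub hle]
        have : ((k - B.card : ℕ) : ℝ) * (D.card / k) ≤ D.card := by
          rw [mul_div_assoc', div_le_iff₀ hk, mul_comm]
          gcongr
          exact Nat.sub_le _ _
        linarith
      · rw [Nat.sub_eq_zero_of_le hle]
        simpa using mul_nonneg hq.le h1
    rw [Finset.card_insert_of_notMem ha, pow_succ]
    have hp := prob_nonneg (fun π : Equiv.Perm (Fin k) => ∀ i ∈ B, π i ∉ D)
    refine le_of_mul_le_mul_left ?_ hq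
    rw [h']
    calc _ ≤ ((k - B.card : ℕ) : ℝ) * (1 - (D.card : ℝ) / k) *
          prob (fun π : Equiv.Perm (Fin k) => ∀ i ∈ B, π i ∉ D) := by gcongr
      _ = (k - B.card : ℕ) * (prob (fun π : Equiv.Perm (Fin k) => ∀ i ∈ B, π i ∉ D) *
          (1 - (D.card : ℝ) / k)) := by ring
      _ ≤ _ := by
        have h1 : (0 : ℝ) ≤ 1 - (D.card : ℝ) / k := by
          rw [sub_nonneg, div_le_one hk]
          exact_mod_cast hDk
        gcongr

/-! ### Surviving colours in One-Shot-Coloring -/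

section Survive

variable {n Δ : ℕ}

open Classical in
theorem expect_coin_color (A : Finset (Fin (Δ + 1))) (a : ℝ) :
    𝔼 y : Bool × Fin (Δ + 1), (1 + a * (if y.1 = true ∧ y.2 ∈ A then 1 else 0)) =
      1 + a * (A.card / (2 * ((Δ : ℝ) + 1))) := by
  have h : (Finset.univ.filter fun y : Bool × Fin (Δ + 1) => y.1 = true ∧ y.2 ∈ A) =
      {true} ×ˢ A := by
    ext y
    simp only [Finset.mem_filter, Finset.mem_univ, true_and, Finset.mem_product,
      Finset.mem_singleton]
  rw [Finset.expect_add_distrib, ← Finset.mul_expect,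
    Finset.expect_const Finset.univ_nonempty, Fintype.expect_eq_sum_div_card, Finset.sum_boole, h,
    Finset.card_product]
  simp

open Classical in
/-- The colours which belong to `K` or occur on `M`, and do not occur on `Y`. -/
noncomputable def surviving (K : Finset (Fin (Δ + 1))) (M Y : Finset (Fin n))
    (s : Fin n → Option (Fin (Δ + 1))) : Finset (Fin (Δ + 1)) :=
  {c | (c ∈ K ∨ ∃ m ∈ M, s m = some c) ∧ ∀ y ∈ Y, s y ≠ some c}

theorem mem_surviving {K : Finset (Fin (Δ + 1))} {M Y : Finset (Fin n)}
    {s : Fin n → Option (Fin (Δ + 1))} {c : Fin (Δ + 1)} :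
    c ∈ surviving K M Y s ↔ (c ∈ K ∨ ∃ m ∈ M, s m = some c) ∧ ∀ y ∈ Y, s y ≠ some c := by
  simp [surviving]

theorem oneStep_cases (G : SimpleGraph (Fin n)) (s : Fin n → Option (Fin (Δ + 1))) (v : Fin n)
    (y : Bool × Fin (Δ + 1)) :
    oneStep G s v y = s ∧ ¬ (y.1 = true ∧ y.2 ∈ free G s v) ∨
      (y.1 = true ∧ y.2 ∈ free G s v) ∧ oneStep G s v y = Function.update s v (some y.2) := by
  unfold oneStep assign
  split_ifs with h1 h2
  · exact Or.inr ⟨⟨h1, h2⟩, rfl⟩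
  · exact Or.inl ⟨rfl, fun h => h2 h.2⟩
  · exact Or.inl ⟨rfl, fun h => h1 h.1⟩

/-- A step at a blank vertex destroys at most the colour sampled, and only if the coin allows it. -/
theorem erase_surviving_subset {G : SimpleGraph (Fin n)} {K : Finset (Fin (Δ + 1))}
    {M Y : Finset (Fin n)} {s : Fin n → Option (Fin (Δ + 1))} {v : Fin n} (hv : s v = none)
    (y : Bool × Fin (Δ + 1)) {c : Fin (Δ + 1)} (hc : c ∈ surviving K M Y s)
    (h : v ∈ Y → ¬ (y.1 = true ∧ y.2 = c)) : c ∈ surviving K M Y (oneStep G s v y) := by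
  rcases oneStep_cases G s v y with ⟨e, -⟩ | ⟨⟨hb, -⟩, e⟩
  · rwa [e]
  · rw [mem_surviving] at hc ⊢
    rw [e]
    refine ⟨hc.1.imp_right ?_, fun w hw => ?_⟩
    · rintro ⟨m, hm, hmc⟩
      refine ⟨m, hm, ?_⟩
      rw [Function.update_of_ne, hmc]
      rintro rfl
      rw [hv] at hmc
      cases hmc
    · by_cases hwv : w = v
      · subst hwv
        rw [Function.update_self]
        exact fun e => h hw ⟨hb, Option.some.inj e⟩
      · rw [Function.update_of_ne hwv]
        exact hc.2 w hw

open Classical in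
theorem card_surviving_sub_le {G : SimpleGraph (Fin n)} {K : Finset (Fin (Δ + 1))}
    {M Y : Finset (Fin n)} {s : Fin n → Option (Fin (Δ + 1))} {v : Fin n} (hv : s v = none)
    (y : Bool × Fin (Δ + 1)) :
    ((surviving K M Y s).card : ℝ) - (if y.1 = true ∧ y.2 ∈ surviving K M Y s then 1 else 0) ≤
      (surviving K M Y (oneStep G s v y)).card := by
  split_ifs with h
  · have : (surviving K M Y s).erase y.2 ⊆ surviving K M Y (oneStep G s v y) := fun c hc => by
      rw [Finset.mem_erase] at hc
      exact erase_surviving_subset hv y hc.2 fun _ h => hc.1 h.2.symm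
    have := Finset.card_le_card this
    rw [Finset.card_erase_of_mem h.2] at this
    have h1 : (surviving K M Y s).card ≤ (surviving K M Y (oneStep G s v y)).card + 1 := by omega
    have : ((surviving K M Y s).card : ℝ) ≤ (surviving K M Y (oneStep G s v y)).card + 1 := by
      exact_mod_cast h1
    linarith
  · rw [sub_zero]
    exact_mod_cast Finset.card_le_card fun c hc =>
      erase_surviving_subset hv y hc fun _ h' => h ⟨h'.1, h'.2 ▸ hc⟩

theorem card_surviving_le {G : SimpleGraph (Fin n)} {K : Finset (Fin (Δ + 1))}
    {M Y : Finset (Fin n)} {s : Fin n → Option (Fin (Δ + 1))} {v : Fin n} (hv : s v = none)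
    (hY : v ∉ Y) (y : Bool × Fin (Δ + 1)) :
    ((surviving K M Y s).card : ℝ) ≤ (surviving K M Y (oneStep G s v y)).card := by
  exact_mod_cast Finset.card_le_card fun c hc =>
    erase_surviving_subset hv y hc fun h => (hY h).elim

open Classical in
/-- The neighbours of a vertex, as a finite set. -/
noncomputable def nbrs (G : SimpleGraph (Fin n)) (v : Fin n) : Finset (Fin n) := {u | G.Adj v u}

theorem mem_nbrs {G : SimpleGraph (Fin n)} {u v : Fin n} : u ∈ nbrs G v ↔ G.Adj v u := by
  simp [nbrs]

open Classical in
/-- If a vertex of `M` samples a colour that occurs neither on its neighbours nor on `Y ∪ M`, then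
a new colour survives. -/
theorem card_surviving_add_le {G : SimpleGraph (Fin n)} {M Y : Finset (Fin n)}
    {s : Fin n → Option (Fin (Δ + 1))} {v : Fin n} (hv : s v = none)
    (hM : v ∈ M) (hY : v ∉ Y) (y : Bool × Fin (Δ + 1)) :
    ((surviving ∅ M Y s).card : ℝ) + (if y.1 = true ∧
        y.2 ∈ surviving Finset.univ ∅ (nbrs G v ∪ Y ∪ M) s then 1 else 0) ≤
      (surviving ∅ M Y (oneStep G s v y)).card := by
  split_ifs with h
  · have h2 := (mem_surviving.1 h.2).2
    have hfree : y.2 ∈ free G s v := mem_free.2 fun u hu =>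
      h2 u (by simp [mem_nbrs, hu])
    have hnot : y.2 ∉ surviving ∅ M Y s := fun hc => by
      obtain ⟨hc | ⟨m, hm, e⟩, -⟩ := mem_surviving.1 hc
      · simp at hc
      · exact h2 m (by simp [hm]) e
    have hsub : insert y.2 (surviving ∅ M Y s) ⊆ surviving ∅ M Y (oneStep G s v y) := by
      intro c hc
      rcases Finset.mem_insert.1 hc with rfl | hc
      · rcases oneStep_cases G s v y with ⟨-, e⟩ | ⟨-, e⟩
        · exact (e ⟨h.1, hfree⟩).elim
        · rw [e, mem_surviving]
          refine ⟨Or.inr ⟨v, hM, by simp⟩, fun w hw => ?_⟩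
          rw [Function.update_of_ne (ne_of_mem_of_not_mem hw hY)]
          exact h2 w (by simp [hw])
      · exact erase_surviving_subset hv y hc fun h => (hY h).elim
    have := Finset.card_le_card hsub
    rw [Finset.card_insert_of_notMem hnot] at this
    exact_mod_cast this
  · rw [add_zero]
    exact card_surviving_le hv hY y

theorem exp_neg_mul_le_of_sub {lam B B' : ℝ} (hlam : 0 ≤ lam) (p : Prop) [Decidable p]
    (h : B - (if p then 1 else 0) ≤ B') :
    Real.exp (-(lam * B')) ≤
      Real.exp (-(lam * B)) * (1 + (Real.exp lam - 1) * (if p then 1 else 0)) := by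
  split_ifs at h ⊢
  · rw [mul_one, add_sub_cancel, ← Real.exp_add]
    exact Real.exp_le_exp.2 (by nlinarith)
  · rw [mul_zero, add_zero, mul_one]
    exact Real.exp_le_exp.2 (by nlinarith)

theorem exp_neg_mul_le_of_add {lam B B' : ℝ} (hlam : 0 ≤ lam) (p : Prop) [Decidable p]
    (h : B + (if p then 1 else 0) ≤ B') :
    Real.exp (-(lam * B')) ≤
      Real.exp (-(lam * B)) * (1 + (Real.exp (-lam) - 1) * (if p then 1 else 0)) := by
  split_ifs at h ⊢
  · rw [mul_one, add_sub_cancel, ← Real.exp_add]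
    exact Real.exp_le_exp.2 (by nlinarith)
  · rw [mul_zero, add_zero, mul_one]
    exact Real.exp_le_exp.2 (by nlinarith)

theorem exp_sub_one_le {lam : ℝ} (h0 : 0 ≤ lam) (h1 : lam ≤ 1 / 10) :
    Real.exp lam - 1 ≤ 11 / 10 * lam := by
  have := Real.abs_exp_sub_one_sub_id_le (x := lam) (by rw [abs_of_nonneg h0]; linarith)
  have := (abs_le.1 this).2
  nlinarith

theorem exp_neg_sub_one_le {lam : ℝ} (h0 : 0 ≤ lam) (h1 : lam ≤ 1 / 10) :
    Real.exp (-lam) - 1 ≤ -(9 / 10 * lam) := by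
  have := Real.abs_exp_sub_one_sub_id_le (x := -lam) (by rw [abs_neg, abs_of_nonneg h0]; linarith)
  have := (abs_le.1 this).2
  nlinarith

/-- The loss step: at a vertex of `Y` the exponent shrinks by the factor `1 - q`. Each colour is
destroyed with probability at most `1 / (2 (Δ + 1))`, and `exp lam - 1 ≤ 11 / 10 * lam`, which is
where the condition `11 / 20 ≤ q (Δ + 1)` comes from. -/
theorem expect_exp_surviving_le (G : SimpleGraph (Fin n)) {K : Finset (Fin (Δ + 1))}
    {M Y : Finset (Fin n)} {s : Fin n → Option (Fin (Δ + 1))} {v : Fin n} (hv : s v = none)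
    {lam q : ℝ} (h0 : 0 ≤ lam) (h1 : lam ≤ 1 / 10) (hq : 11 / 20 ≤ q * ((Δ : ℝ) + 1)) :
    𝔼 y, Real.exp (-(lam * (surviving K M Y (oneStep G s v y)).card)) ≤
      Real.exp (-(lam * (1 - q) * (surviving K M Y s).card)) := by
  classical
  set B : ℝ := ((surviving K M Y s).card : ℝ) with hB
  have hB0 : 0 ≤ B := Nat.cast_nonneg _
  have hΔ : (0 : ℝ) < (Δ : ℝ) + 1 := by positivity
  calc _ ≤ 𝔼 y : Bool × Fin (Δ + 1), Real.exp (-(lam * B)) * (1 + (Real.exp lam - 1) *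
        (if y.1 = true ∧ y.2 ∈ surviving K M Y s then 1 else 0)) :=
        Finset.expect_le_expect fun y _ =>
          exp_neg_mul_le_of_sub h0 _ (card_surviving_sub_le hv y)
    _ = Real.exp (-(lam * B)) * (1 + (Real.exp lam - 1) * (B / (2 * ((Δ : ℝ) + 1)))) := by
        rw [← Finset.mul_expect, expect_coin_color]
    _ ≤ Real.exp (-(lam * B)) * Real.exp (lam * q * B) := by
        gcongr
        refine le_trans ?_ (Real.add_one_le_exp _)
        suffices h : (Real.exp lam - 1) * (B / (2 * ((Δ : ℝ) + 1))) ≤ lam * q * B by linarith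
        have : B / (2 * ((Δ : ℝ) + 1)) ≤ 10 / 11 * q * B := by
          rw [div_le_iff₀ (by positivity)]
          nlinarith
        calc _ ≤ 11 / 10 * lam * (10 / 11 * q * B) := by
              gcongr
              exact exp_sub_one_le h0 h1
          _ = _ := by ring
    _ = _ := by rw [← Real.exp_add]; ring_nf

/-- The gain step: a vertex of `M` which sees at least `(Δ + 1) / 6` usable colours contributes a new
surviving colour with probability at least `1 / 12`. -/
theorem expect_exp_surviving_le_of_gain (G : SimpleGraph (Fin n)) {M Y : Finset (Fin n)}
    {s : Fin n → Option (Fin (Δ + 1))} {v : Fin n} (hv : s v = none) (hM : v ∈ M) (hY : v ∉ Y)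
    {lam : ℝ} (h0 : 0 ≤ lam) (h1 : lam ≤ 1 / 10)
    (hg : ((Δ : ℝ) + 1) / 6 ≤ (surviving Finset.univ ∅ (nbrs G v ∪ Y ∪ M) s).card) :
    𝔼 y, Real.exp (-(lam * (surviving ∅ M Y (oneStep G s v y)).card)) ≤
      Real.exp (-(lam * (surviving ∅ M Y s).card) - 3 / 40 * lam) := by
  classical
  set B : ℝ := ((surviving ∅ M Y s).card : ℝ) with hB
  set A := surviving Finset.univ ∅ (nbrs G v ∪ Y ∪ M) s
  have hΔ : (0 : ℝ) < (Δ : ℝ) + 1 := by positivity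
  calc _ ≤ 𝔼 y : Bool × Fin (Δ + 1), Real.exp (-(lam * B)) * (1 + (Real.exp (-lam) - 1) *
        (if y.1 = true ∧ y.2 ∈ A then 1 else 0)) :=
        Finset.expect_le_expect fun y _ =>
          exp_neg_mul_le_of_add h0 _ (card_surviving_add_le hv hM hY y)
    _ = Real.exp (-(lam * B)) * (1 + (Real.exp (-lam) - 1) * (A.card / (2 * ((Δ : ℝ) + 1)))) := by
        rw [← Finset.mul_expect, expect_coin_color]
    _ ≤ Real.exp (-(lam * B)) * Real.exp (-(3 / 40 * lam)) := by
        gcongr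
        refine le_trans ?_ (Real.add_one_le_exp _)
        suffices h : (Real.exp (-lam) - 1) * (A.card / (2 * ((Δ : ℝ) + 1))) ≤ -(3 / 40 * lam) by
          linarith
        have : 1 / 12 ≤ A.card / (2 * ((Δ : ℝ) + 1)) := by
          rw [le_div_iff₀ (by positivity)]
          linarith
        have := exp_neg_sub_one_le h0 h1
        nlinarith
    _ = _ := by rw [← Real.exp_add]; ring_nf

/-- A step outside `Y` cannot destroy a colour. -/
theorem expect_exp_surviving_le_of_not_mem (G : SimpleGraph (Fin n)) {K : Finset (Fin (Δ + 1))}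
    {M Y : Finset (Fin n)} {s : Fin n → Option (Fin (Δ + 1))} {v : Fin n} (hv : s v = none)
    (hY : v ∉ Y) {lam : ℝ} (h0 : 0 ≤ lam) :
    𝔼 y, Real.exp (-(lam * (surviving K M Y (oneStep G s v y)).card)) ≤
      Real.exp (-(lam * (surviving K M Y s).card)) :=
  expect_le_of_forall_le fun y => Real.exp_le_exp.2 <| neg_le_neg <|
    mul_le_mul_of_nonneg_left (card_surviving_le hv hY y) h0

/-- Requirement on the state before `v` is processed: `v` is blank and, if it belongs to `M`, it
sees many usable colours. -/
def Gainful (G : SimpleGraph (Fin n)) (M Y : Finset (Fin n)) (v : Fin n)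
    (s : Fin n → Option (Fin (Δ + 1))) : Prop :=
  s v = none ∧
    (v ∈ M → ((Δ : ℝ) + 1) / 6 ≤ (surviving Finset.univ ∅ (nbrs G v ∪ Y ∪ M) s).card)

theorem countP_mem_le_card {l : List (Fin n)} (hl : l.Nodup) (Y : Finset (Fin n)) :
    l.countP (fun v => v ∈ Y) ≤ Y.card := by
  rw [List.countP_eq_length_filter, ← List.toFinset_card_of_nodup (hl.filter _)]
  exact Finset.card_le_card fun v hv => by simpa using (List.mem_filter.1 (List.mem_toFinset.1 hv)).2

/-- The lower tail of the number of surviving colours: each vertex of `Y` multiplies the exponent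
by `1 - q`, and each vertex of `M` contributes the factor `exp (-ν)`. -/
theorem prob_surviving_le (G : SimpleGraph (Fin n)) {K : Finset (Fin (Δ + 1))}
    {M Y : Finset (Fin n)} (hMY : Disjoint M Y) (hKM : M.Nonempty → K = ∅) {lam q ν b : ℝ}
    (h0 : 0 ≤ lam) (h1 : lam ≤ 1 / 10) (hq : 11 / 20 ≤ q * ((Δ : ℝ) + 1)) (hq0 : 0 ≤ q)
    (hq1 : q ≤ 1) (hν : M.Nonempty → ν ≤ 3 / 40 * (lam * (1 - q) ^ Y.card)) {l : List (Fin n)}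
    (hl : l.Nodup) :
    prob (fun x : Fin n → Bool × Fin (Δ + 1) =>
        GoodPath (oneStep G) (Gainful G M Y) x l (fun _ => none) ∧
          ((surviving K M Y (run (oneStep G) x l fun _ => none)).card : ℝ) ≤ b) ≤
      Real.exp (lam * b - lam * (1 - q) ^ Y.card * K.card - ν * l.countP (fun v => v ∈ M)) := by
  classical
  have hq' : 0 ≤ 1 - q := by linarith
  have hpow : ∀ j : ℕ, (1 - q) ^ j ≤ 1 := fun j => pow_le_one₀ hq' (by linarith)
  let Ψ : List (Fin n) → (Fin n → Option (Fin (Δ + 1))) → ℝ := fun l s =>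
    Real.exp (-(ν * l.countP (fun v => v ∈ M))) *
      Real.exp (-(lam * (1 - q) ^ l.countP (fun v => v ∈ Y) * (surviving K M Y s).card))
  have key := expect_run_le (oneStep G) (Gainful G M Y) Ψ (fun _ _ => by positivity) ?_ l hl
    (fun _ => none)
  · have hinit : (surviving K M Y fun _ => none) = K := by
      ext c; simp [mem_surviving]
    calc _ ≤ 𝔼 x : Fin n → Bool × Fin (Δ + 1), Real.exp (lam * b) *
          (if GoodPath (oneStep G) (Gainful G M Y) x l (fun _ => none) then
            Ψ [] (run (oneStep G) x l fun _ => none) else 0) := by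
          refine prob_le_expect (fun x => by split_ifs <;> positivity) fun x hx => ?_
          rw [if_pos hx.1]
          simp only [Ψ, List.countP_nil, Nat.cast_zero, mul_zero, neg_zero, Real.exp_zero, one_mul,
            pow_zero, mul_one]
          rw [← Real.exp_add]
          exact Real.one_le_exp (by nlinarith [hx.2])
      _ ≤ Real.exp (lam * b) * Ψ l (fun _ => none) := by
          rw [← Finset.mul_expect]
          gcongr
      _ ≤ _ := by
          simp only [Ψ, hinit]
          rw [← Real.exp_add, ← Real.exp_add]
          refine Real.exp_le_exp.2 ?_
          have : (1 - q) ^ Y.card ≤ (1 - q) ^ l.countP (fun v => v ∈ Y) :=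
            pow_le_pow_of_le_one hq' (by linarith) (countP_mem_le_card hl Y)
          have : lam * (1 - q) ^ Y.card * K.card ≤
            lam * (1 - q) ^ l.countP (fun v => v ∈ Y) * K.card := by gcongr
          linarith
  · intro v l s hvl hg
    set j := l.countP (fun v => v ∈ Y) with hj
    have hlam : 0 ≤ lam * (1 - q) ^ j := by positivity
    have hlam' : lam * (1 - q) ^ j ≤ 1 / 10 := (mul_le_of_le_one_right h0 (hpow j)).trans h1
    simp only [Ψ]
    rw [← Finset.mul_expect]
    by_cases hY : v ∈ Y
    · have hM : v ∉ M := fun h => Finset.disjoint_left.1 hMY h hY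
      rw [List.countP_cons_of_neg (by simpa using hM), List.countP_cons_of_pos (by simpa using hY),
        ← hj, pow_succ, ← mul_assoc]
      gcongr
      exact expect_exp_surviving_le G hg.1 hlam hlam' hq
    · rw [List.countP_cons_of_neg (p := fun v => decide (v ∈ Y)) (by simpa using hY), ← hj]
      by_cases hM : v ∈ M
      · rw [List.countP_cons_of_pos (by simpa using hM)]
        obtain rfl := hKM ⟨v, hM⟩
        have hstep := expect_exp_surviving_le_of_gain G hg.1 hM hY hlam hlam' (hg.2 hM)
        refine (mul_le_mul_of_nonneg_left hstep (Real.exp_nonneg _)).trans ?_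
        rw [← Real.exp_add, ← Real.exp_add]
        refine Real.exp_le_exp.2 ?_
        have h2 : (1 - q) ^ Y.card ≤ (1 - q) ^ j :=
          pow_le_pow_of_le_one hq' (by linarith) (countP_mem_le_card (List.nodup_cons.1 hvl).2 Y)
        have h3 := hν ⟨v, hM⟩
        have h4 : lam * (1 - q) ^ Y.card ≤ lam * (1 - q) ^ j := by gcongr
        push_cast
        linarith
      · rw [List.countP_cons_of_neg (by simpa using hM)]
        gcongr
        exact expect_exp_surviving_le_of_not_mem G hg.1 hY hlam

end Survive

/-! ### The part of a list before an entry -/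

section Before

variable {n : ℕ}

/-- The entries of a list before the first occurrence of `u`. -/
def before (l : List (Fin n)) (u : Fin n) : List (Fin n) := l.takeWhile fun v => v ≠ u

theorem before_append {pre post : List (Fin n)} {u : Fin n} (h : u ∉ pre) :
    before (pre ++ u :: post) u = pre := by
  induction pre with
  | nil => simp [before]
  | cons a pre ih =>
    rw [List.mem_cons, not_or] at h
    have := ih h.2
    simp only [before] at this ⊢
    rw [List.cons_append, List.takeWhile_cons_of_pos (by simpa using Ne.symm h.1), this]

theorem before_eq {l pre post : List (Fin n)} {u : Fin n} (hl : l.Nodup) (h : l = pre ++ u :: post) :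
    before l u = pre := by
  rw [h]
  refine before_append fun hu => ?_
  rw [h, List.nodup_append] at hl
  exact hl.2.2 u hu u (by simp) rfl

theorem before_nodup {l : List (Fin n)} (hl : l.Nodup) (u : Fin n) : (before l u).Nodup :=
  hl.sublist (List.takeWhile_sublist _)

theorem not_mem_before (l : List (Fin n)) (u : Fin n) : u ∉ before l u := fun h => by
  simpa using List.mem_takeWhile_imp h

theorem mem_before_or {l : List (Fin n)} {u m : Fin n} (hu : u ∈ l) (hm : m ∈ l) (h : u ≠ m) :
    m ∈ before l u ∨ u ∈ before l m := by
  induction l with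
  | nil => simp at hu
  | cons a l ih =>
    by_cases ha : a = u
    · subst ha
      exact Or.inr (by simp [before, h])
    · by_cases ha' : a = m
      · subst ha'
        exact Or.inl (by simp [before, ha])
      · have h1 := (List.mem_cons.1 hu).resolve_left fun e => ha e.symm
        have h2 := (List.mem_cons.1 hm).resolve_left fun e => ha' e.symm
        have e1 : before (a :: l) u = a :: before l u :=
          List.takeWhile_cons_of_pos (by simpa using ha)
        have e2 : before (a :: l) m = a :: before l m :=
          List.takeWhile_cons_of_pos (by simpa using ha')
        rw [e1, e2]
        exact (ih h1 h2).imp (List.mem_cons_of_mem _) (List.mem_cons_of_mem _)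

end Before

section Tails

variable {n Δ : ℕ}

theorem run_oneStep_eq_none (G : SimpleGraph (Fin n)) (x : Fin n → Bool × Fin (Δ + 1))
    {l pre post : List (Fin n)} {v : Fin n} (hl : l.Nodup) (h : l = pre ++ v :: post) :
    run (oneStep G) x pre (fun _ => none) v = none := by
  refine run_apply_of_not_mem (fun s v y u h => oneStep_of_ne G s h y) _ ?_
  rw [← before_eq hl h]
  exact not_mem_before l v

theorem exp_neg_le_one_sub {Δ : ℕ} (hΔ : 0 < Δ) :
    Real.exp (-(11 / 20 / (Δ : ℝ))) ≤ 1 - 11 / 20 / ((Δ : ℝ) + 1) := by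
  have h : (0 : ℝ) < Δ := by exact_mod_cast hΔ
  have h1 : 1 - 11 / 20 / ((Δ : ℝ) + 1) = ((11 / 20) / ((Δ : ℝ) + 9 / 20) + 1)⁻¹ := by
    field_simp
    ring
  rw [h1, Real.exp_neg]
  refine inv_anti₀ (by positivity) ?_
  refine le_trans ?_ (Real.add_one_le_exp _)
  gcongr
  linarith

theorem exp_le_one_sub_pow {Δ k : ℕ} (hΔ : 0 < Δ) {m : ℕ} (hm : m ≤ k * Δ) :
    Real.exp (-(11 / 20 * k)) ≤ (1 - 11 / 20 / ((Δ : ℝ) + 1)) ^ m := by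
  have h : (0 : ℝ) < Δ := by exact_mod_cast hΔ
  have h1 := exp_neg_le_one_sub hΔ
  have h2 : (1 : ℝ) - 11 / 20 / ((Δ : ℝ) + 1) ≤ 1 := by
    have : 0 ≤ 11 / 20 / ((Δ : ℝ) + 1) := by positivity
    linarith
  calc Real.exp (-(11 / 20 * k)) = Real.exp (-(11 / 20 / (Δ : ℝ))) ^ (k * Δ) := by
        rw [← Real.exp_nat_mul]
        push_cast
        congr 1
        field_simp
    _ ≤ (1 - 11 / 20 / ((Δ : ℝ) + 1)) ^ (k * Δ) := by gcongr
    _ ≤ _ := pow_le_pow_of_le_one ((Real.exp_nonneg _).trans h1) h2 hm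

/-- At most `3 Δ` vertices, each participating with probability `1 / 2`, leave about a fraction
`exp (-3 / 2) > 1 / 6` of the colours unused. -/
theorem prob_few_unused_le (G : SimpleGraph (Fin n)) (hΔ : 0 < Δ) {Y : Finset (Fin n)}
    (hY : Y.card ≤ 3 * Δ) {l : List (Fin n)} (hl : l.Nodup) :
    prob (fun x : Fin n → Bool × Fin (Δ + 1) =>
        ((surviving Finset.univ ∅ Y (run (oneStep G) x l fun _ => none)).card : ℝ) ≤
          ((Δ : ℝ) + 1) / 6) ≤ Real.exp (-(((Δ : ℝ) + 1) / 500)) := by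
  have hΔ' : (0 : ℝ) < (Δ : ℝ) + 1 := by positivity
  have hexp : (19 / 100 : ℝ) ≤ Real.exp (-(11 / 20 * (3 : ℕ))) := by
    rw [Real.exp_neg, show (11 / 20 * ((3 : ℕ) : ℝ)) = 33 / 20 by norm_num]
    rw [le_inv_comm₀ (by norm_num) (Real.exp_pos _)]
    refine le_of_pow_le_pow_left₀ (n := 20) (by norm_num) (by norm_num) ?_
    rw [← Real.exp_nat_mul, show ((20 : ℕ) : ℝ) * (33 / 20) = (33 : ℕ) * 1 by norm_num,
      Real.exp_nat_mul]
    calc Real.exp 1 ^ 33 ≤ 2.7182818286 ^ 33 := by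
          gcongr
          exact Real.exp_one_lt_d9.le
      _ ≤ _ := by norm_num
  have hpow := hexp.trans (exp_le_one_sub_pow hΔ hY)
  have hq : 11 / 20 / ((Δ : ℝ) + 1) ≤ 1 := by
    rw [div_le_one hΔ']
    have : (0 : ℝ) ≤ Δ := Nat.cast_nonneg _
    linarith
  refine (prob_mono fun x hx => ?_).trans
    ((prob_surviving_le G (K := Finset.univ) (M := ∅) (Y := Y) (lam := 1 / 10)
      (q := 11 / 20 / ((Δ : ℝ) + 1)) (ν := 0) (b := ((Δ : ℝ) + 1) / 6) (by simp) (by simp)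
      (by norm_num) le_rfl (by field_simp; rfl) (by positivity) hq (by simp) hl).trans ?_)
  · exact ⟨fun pre v post h => ⟨run_oneStep_eq_none G x hl h, by simp⟩, hx⟩
  · rw [Finset.card_univ, Fintype.card_fin]
    push_cast
    refine Real.exp_le_exp.2 ?_
    nlinarith

theorem countP_mem_eq_card {l : List (Fin n)} (hl : l.Nodup) {M : Finset (Fin n)}
    (hM : ∀ m ∈ M, m ∈ l) : l.countP (fun v => v ∈ M) = M.card := by
  rw [List.countP_eq_length_filter, ← List.toFinset_card_of_nodup (hl.filter _)]
  congr 1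
  ext v
  simp only [List.mem_toFinset, List.mem_filter, decide_eq_true_eq]
  exact ⟨fun h => h.2, fun h => ⟨hM v h, h⟩⟩

/-- With high probability, at least a fortieth of the vertices of `M` contribute a colour that
does not occur on `Y`. -/
theorem prob_few_surviving_le (G : SimpleGraph (Fin n)) (hΔ : 0 < Δ)
    (hG : ∀ v, (nbrs G v).card ≤ Δ) {M Y : Finset (Fin n)} (hM : M.card ≤ Δ) (hY : Y.card ≤ Δ)
    (hMY : Disjoint M Y) {l : List (Fin n)} (hl : l.Nodup) (hMl : ∀ m ∈ M, m ∈ l) :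
    prob (fun x : Fin n → Bool × Fin (Δ + 1) =>
        ((surviving ∅ M Y (run (oneStep G) x l fun _ => none)).card : ℝ) ≤ M.card / 40) ≤
      Real.exp (-((M.card : ℝ) / 2000)) + n * Real.exp (-(((Δ : ℝ) + 1) / 500)) := by
  have hΔ' : (0 : ℝ) < (Δ : ℝ) + 1 := by positivity
  have hq : 11 / 20 / ((Δ : ℝ) + 1) ≤ 1 := by
    rw [div_le_one hΔ']
    have : (0 : ℝ) ≤ Δ := Nat.cast_nonneg _
    linarith
  have hpow : (9 / 20 : ℝ) ≤ (1 - 11 / 20 / ((Δ : ℝ) + 1)) ^ Y.card := by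
    refine le_trans ?_ (exp_le_one_sub_pow (k := 1) hΔ (by omega))
    have := Real.add_one_le_exp (-(11 / 20 * ((1 : ℕ) : ℝ)))
    push_cast at this ⊢
    linarith
  have hmain := prob_surviving_le G (K := (∅ : Finset (Fin (Δ + 1)))) (M := M) (Y := Y)
    (lam := 1 / 10) (q := 11 / 20 / ((Δ : ℝ) + 1)) (ν := 27 / 8000) (b := M.card / 40) hMY
    (fun _ => rfl) (by norm_num) le_rfl (by field_simp; rfl) (by positivity) hq
    (fun _ => by linarith) hl
  have hbad := prob_exists_le_card_mul M
    (fun (m : Fin n) (x : Fin n → Bool × Fin (Δ + 1)) =>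
      ((surviving Finset.univ ∅ (nbrs G m ∪ Y ∪ M)
        (run (oneStep G) x (before l m) fun _ => none)).card : ℝ) ≤ ((Δ : ℝ) + 1) / 6)
    fun m _ => prob_few_unused_le G hΔ (by
      have h1 := Finset.card_union_le (nbrs G m ∪ Y) M
      have h2 := Finset.card_union_le (nbrs G m) Y
      have h3 := hG m
      omega) (before_nodup hl m)
  refine (prob_mono fun x hx => ?_).trans ((prob_or_le _ _).trans
    (add_le_add (hmain.trans ?_) (hbad.trans ?_)))
  · by_contra! hcon
    obtain ⟨h1, h2⟩ := hcon
    refine not_lt_of_ge hx (h1 fun pre v post h => ⟨run_oneStep_eq_none G x hl h, fun hv => ?_⟩)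
    have := (h2 v hv).le
    rwa [before_eq hl h] at this
  · rw [countP_mem_eq_card hl hMl]
    refine Real.exp_le_exp.2 ?_
    have : (0 : ℝ) ≤ M.card := Nat.cast_nonneg _
    simp only [Finset.card_empty, Nat.cast_zero, mul_zero, sub_zero]
    linarith
  · gcongr
    simpa using M.card_le_univ

/-! ### Savings -/

open Classical in
/-- The number of coloured vertices of `W` minus the number of colours on `W`. -/
noncomputable def savings (W : Finset (Fin n)) (s : Fin n → Option (Fin (Δ + 1))) : ℝ :=
  ((W.filter fun w => s w ≠ none).card : ℝ) - (surviving ∅ W ∅ s).card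

open Classical in
/-- Colouring a vertex of `W` with a colour that already occurs on `W` saves a colour. -/
theorem savings_add_le {G : SimpleGraph (Fin n)} {W M : Finset (Fin n)} (hMW : M ⊆ W)
    {s : Fin n → Option (Fin (Δ + 1))} {v : Fin n} (hv : s v = none) (y : Bool × Fin (Δ + 1)) :
    savings W s + (if v ∈ W ∧ y.1 = true ∧ y.2 ∈ surviving ∅ M (nbrs G v) s then 1 else 0) ≤
      savings W (oneStep G s v y) := by
  rcases oneStep_cases G s v y with ⟨e, hn⟩ | ⟨-, e⟩
  · rw [e, if_neg, add_zero]
    rintro ⟨-, hb, hc⟩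
    exact hn ⟨hb, mem_free.2 fun u hu => (mem_surviving.1 hc).2 u (mem_nbrs.2 hu)⟩
  · rw [e]
    unfold savings
    by_cases hW : v ∈ W
    · have h1 : (W.filter fun w => Function.update s v (some y.2) w ≠ none) =
          insert v (W.filter fun w => s w ≠ none) := by
        ext w
        by_cases hw : w = v
        · subst hw; simp [hW]
        · simp [hw]
      have hcol : ∀ c, c ∈ surviving ∅ W ∅ (Function.update s v (some y.2)) →
          c = y.2 ∨ c ∈ surviving ∅ W ∅ s := by
        intro c hc
        obtain ⟨hc | ⟨w, hw, hwc⟩, -⟩ := mem_surviving.1 hc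
        · simp at hc
        · by_cases hwv : w = v
          · subst hwv
            rw [Function.update_self] at hwc
            exact Or.inl (Option.some.inj hwc).symm
          · rw [Function.update_of_ne hwv] at hwc
            exact Or.inr (mem_surviving.2 ⟨Or.inr ⟨w, hw, hwc⟩, by simp⟩)
      rw [h1, Finset.card_insert_of_notMem (by simp [hv])]
      split_ifs with h
      · have h2 : surviving ∅ W ∅ (Function.update s v (some y.2)) ⊆ surviving ∅ W ∅ s := by
          intro c hc
          rcases hcol c hc with rfl | hc
          · obtain ⟨hc | ⟨m, hm, hmc⟩, -⟩ := mem_surviving.1 h.2.2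
            · simp at hc
            · exact mem_surviving.2 ⟨Or.inr ⟨m, hMW hm, hmc⟩, by simp⟩
          · exact hc
        have h3 : ((surviving ∅ W ∅ (Function.update s v (some y.2))).card : ℝ) ≤
            (surviving ∅ W ∅ s).card := by exact_mod_cast Finset.card_le_card h2
        push_cast
        linarith
      · have h2 : surviving ∅ W ∅ (Function.update s v (some y.2)) ⊆
            insert y.2 (surviving ∅ W ∅ s) := fun c hc => Finset.mem_insert.2 (hcol c hc)
        have h3 : ((surviving ∅ W ∅ (Function.update s v (some y.2))).card : ℝ) ≤
            (surviving ∅ W ∅ s).card + 1 := by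
          exact_mod_cast (Finset.card_le_card h2).trans (Finset.card_insert_le _ _)
        push_cast
        linarith
    · have hne : ∀ w ∈ W, Function.update s v (some y.2) w = s w := fun w hw =>
        Function.update_of_ne (ne_of_mem_of_not_mem hw hW) _ _
      have h1 : (W.filter fun w => Function.update s v (some y.2) w ≠ none) =
          W.filter fun w => s w ≠ none :=
        Finset.filter_congr fun w hw => by rw [hne w hw]
      have h2 : surviving ∅ W ∅ (Function.update s v (some y.2)) = surviving ∅ W ∅ s := by
        ext c
        rw [mem_surviving, mem_surviving]
        simp only [Finset.notMem_empty, false_or, false_imp_iff, implies_true, and_true]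
        exact exists_congr fun w => and_congr_right fun hw => by rw [hne w hw]
      rw [h1, h2, if_neg fun h => hW h.1, add_zero]

/-- The lower tail of the savings, given that every vertex `v` saves a colour with conditional
probability at least `5 ν v / 3`. -/
theorem prob_savings_le (G : SimpleGraph (Fin n)) {W : Finset (Fin n)} (M : Fin n → Finset (Fin n))
    (hM : ∀ v, M v ⊆ W) (ν : Fin n → ℝ) (a : ℝ) {l : List (Fin n)} (hl : l.Nodup) :
    prob (fun x : Fin n → Bool × Fin (Δ + 1) =>
        GoodPath (oneStep G) (fun v s => s v = none ∧
          (ν v ≤ 0 ∨ v ∈ W ∧ ν v ≤ 3 / 10 * (surviving ∅ (M v) (nbrs G v) s).card / ((Δ : ℝ) + 1)))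
          x l (fun _ => none) ∧ savings W (run (oneStep G) x l fun _ => none) ≤ a) ≤
      Real.exp (a - (l.map ν).sum) := by
  classical
  have hΔ : (0 : ℝ) < (Δ : ℝ) + 1 := by positivity
  set Good : Fin n → (Fin n → Option (Fin (Δ + 1))) → Prop := fun v s => s v = none ∧
    (ν v ≤ 0 ∨ v ∈ W ∧ ν v ≤ 3 / 10 * (surviving ∅ (M v) (nbrs G v) s).card / ((Δ : ℝ) + 1))
    with hGood
  let Ψ : List (Fin n) → (Fin n → Option (Fin (Δ + 1))) → ℝ := fun l s =>
    Real.exp (-(l.map ν).sum) * Real.exp (-(1 * savings W s))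
  have key := expect_run_le (oneStep G) Good Ψ (fun _ _ => by positivity) ?_ l hl (fun _ => none)
  · calc _ ≤ 𝔼 x : Fin n → Bool × Fin (Δ + 1), Real.exp a *
          (if GoodPath (oneStep G) Good x l (fun _ => none) then
            Ψ [] (run (oneStep G) x l fun _ => none) else 0) := by
          refine prob_le_expect (fun x => by split_ifs <;> positivity) fun x hx => ?_
          rw [if_pos hx.1]
          simp only [Ψ, List.map_nil, List.sum_nil, neg_zero, Real.exp_zero, one_mul]
          rw [← Real.exp_add]
          exact Real.one_le_exp (by linarith [hx.2])
      _ ≤ Real.exp a * Ψ l (fun _ => none) := by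
          rw [← Finset.mul_expect]
          gcongr
      _ = _ := by
          have : savings W (fun _ => (none : Option (Fin (Δ + 1)))) = 0 := by
            simp [savings, surviving]
          simp only [Ψ, this]
          rw [← Real.exp_add, ← Real.exp_add]
          ring_nf
  · rintro v l s - ⟨hv, hg⟩
    have hadd := fun y => savings_add_le (G := G) (hM v) hv y
    simp only [Ψ, List.map_cons, List.sum_cons]
    rw [← Finset.mul_expect, neg_add, add_comm (-ν v), Real.exp_add, mul_assoc]
    refine mul_le_mul_of_nonneg_left ?_ (Real.exp_nonneg _)
    rw [← Real.exp_add]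
    rcases hg with h0 | ⟨hW, hν⟩
    · refine expect_le_of_forall_le fun y => Real.exp_le_exp.2 ?_
      have h1 := hadd y
      have h2 : (0 : ℝ) ≤ if v ∈ W ∧ y.1 = true ∧ y.2 ∈ surviving ∅ (M v) (nbrs G v) s
        then 1 else 0 := by split_ifs <;> norm_num
      linarith
    · set A := surviving ∅ (M v) (nbrs G v) s
      simp only [hW, true_and] at hadd
      calc _ ≤ 𝔼 y : Bool × Fin (Δ + 1), Real.exp (-(1 * savings W s)) *
            (1 + (Real.exp (-1) - 1) * (if y.1 = true ∧ y.2 ∈ A then 1 else 0)) :=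
            Finset.expect_le_expect fun y _ => exp_neg_mul_le_of_add zero_le_one _ (hadd y)
        _ = Real.exp (-(1 * savings W s)) *
              (1 + (Real.exp (-1) - 1) * (A.card / (2 * ((Δ : ℝ) + 1)))) := by
            rw [← Finset.mul_expect, expect_coin_color]
        _ ≤ Real.exp (-(1 * savings W s)) * Real.exp (-ν v) := by
            gcongr
            refine le_trans ?_ (Real.add_one_le_exp _)
            have h1 : Real.exp (-1) ≤ 2 / 5 := by
              rw [Real.exp_neg, inv_le_comm₀ (Real.exp_pos _) (by norm_num)]
              linarith [Real.exp_one_gt_d9]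
            have h2 : (0 : ℝ) ≤ A.card / (2 * ((Δ : ℝ) + 1)) := by positivity
            have h3 : 3 / 10 * (A.card : ℝ) / ((Δ : ℝ) + 1) =
              3 / 5 * (A.card / (2 * ((Δ : ℝ) + 1))) := by field_simp; ring
            rw [h3] at hν
            nlinarith
        _ = _ := by rw [← Real.exp_add]; ring_nf

end Tails

/-! ### Non-adjacent pairs among sparse vertices -/

section Pairs

variable {n Δ : ℕ}

open Classical in
/-- The non-neighbours of `u` in `W`, without `u` itself. -/
noncomputable def nonNbrs (G : SimpleGraph (Fin n)) (W : Finset (Fin n)) (u : Fin n) :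
    Finset (Fin n) :=
  {m ∈ W | m ≠ u ∧ ¬ G.Adj u m}

open Classical in
/-- If fewer than `0.45 ε Δ` vertices of a set `W` of about `Δ` vertices had more than `0.45 ε Δ`
non-neighbours in `W`, then the remaining vertices of `W` would be dense. -/
theorem sum_card_nonNbrs_ge (G : SimpleGraph (Fin n)) {ε : ℝ} (hε : 0 < ε) (hε1 : ε ≤ 1 / 5000)
    (hεΔ : 1000 ≤ ε * Δ) {W : Finset (Fin n)} (hW : ∀ v ∈ W, IsSparse G Δ ε v)
    (hcard : (Δ : ℝ) + 1 - ε ^ 2 * Δ / 3600 ≤ W.card) :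
    (ε * Δ) ^ 2 / 5 ≤ ∑ u ∈ W, ((nonNbrs G W u).card : ℝ) := by
  by_contra! hsum
  set η := ε * Δ with hη
  have hηΔ : η ≤ Δ / 5000 := by
    have : (0 : ℝ) ≤ Δ := Nat.cast_nonneg _
    nlinarith
  have hW' : (Δ : ℝ) - η / 1000 ≤ W.card := by
    have : ε ^ 2 * Δ / 3600 = ε * η / 3600 := by rw [hη]; ring
    nlinarith
  -- the vertices with few non-neighbours; each of them sees almost all of `W`, hence any two
  -- adjacent ones have almost `Δ` common neighbours, so they are friends
  set T := W.filter fun u => ((nonNbrs G W u).card : ℝ) ≤ 9 / 20 * η with hT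
  have hTW : (W.card : ℝ) - 9 / 20 * η ≤ T.card := by
    have h1 : ((W.filter fun u => ¬ ((nonNbrs G W u).card : ℝ) ≤ 9 / 20 * η).card : ℝ) *
        (9 / 20 * η) ≤ ∑ u ∈ W, ((nonNbrs G W u).card : ℝ) := by
      rw [← nsmul_eq_mul, ← Finset.sum_const]
      refine (Finset.sum_le_sum fun u hu => ?_).trans
        (Finset.sum_le_sum_of_subset_of_nonneg (Finset.filter_subset _ _)
          fun _ _ _ => Nat.cast_nonneg _)
      exact (not_le.1 (Finset.mem_filter.1 hu).2).le
    have h2 := Finset.card_filter_add_card_filter_not (s := W)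
      fun u => ((nonNbrs G W u).card : ℝ) ≤ 9 / 20 * η
    have h3 : (T.card : ℝ) +
        (W.filter fun u => ¬ ((nonNbrs G W u).card : ℝ) ≤ 9 / 20 * η).card = W.card := by
      exact_mod_cast h2
    nlinarith
  have hTne : T.Nonempty := by
    rw [← Finset.card_pos]
    have : (0 : ℝ) < T.card := by linarith
    exact_mod_cast this
  obtain ⟨u, hu⟩ := hTne
  obtain ⟨huW, hud⟩ := Finset.mem_filter.1 hu
  refine hW u huW ?_
  have hnon : ∀ A ⊆ W, ∀ v, A.card ≤ (A.filter fun w => G.Adj v w).card +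
      (nonNbrs G W v).card + 1 := by
    intro A hA v
    have : A ⊆ insert v ((A.filter fun w => G.Adj v w) ∪ nonNbrs G W v) := by
      intro w hw
      by_cases h1 : w = v
      · simp [h1]
      · by_cases h2 : G.Adj v w
        · simp [hw, h2]
        · simp [nonNbrs, hA hw, h1, h2]
    have h1 := Finset.card_le_card this
    have h2 := Finset.card_insert_le v ((A.filter fun w => G.Adj v w) ∪ nonNbrs G W v)
    have h3 := Finset.card_union_le (A.filter fun w => G.Adj v w) (nonNbrs G W v)
    omega
  have hfriend : ((T.filter fun w => G.Adj u w : Finset (Fin n)) : Set (Fin n)) ⊆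
      friends G Δ ε u := by
    intro w hw
    obtain ⟨hwT, huw⟩ := Finset.mem_filter.1 (Finset.mem_coe.1 hw)
    obtain ⟨hwW, hwd⟩ := Finset.mem_filter.1 hwT
    refine ⟨huw, ?_⟩
    have h1 := hnon W subset_rfl u
    have h2 := hnon (W.filter fun m => G.Adj u m) (Finset.filter_subset _ _) w
    have h3 : ((W.filter fun m => G.Adj u m).filter fun m => G.Adj w m).card ≤
        (G.neighborSet w ∩ G.neighborSet u).ncard := by
      rw [← Set.ncard_coe_finset]
      refine Set.ncard_le_ncard (fun m hm => ?_) (Set.toFinite _)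
      simp only [Finset.coe_filter, Finset.mem_filter] at hm
      exact ⟨hm.2, hm.1.2⟩
    have h4 : (W.card : ℝ) ≤ (G.neighborSet w ∩ G.neighborSet u).ncard +
        (nonNbrs G W u).card + (nonNbrs G W w).card + 2 := by
      exact_mod_cast (by omega : W.card ≤ (G.neighborSet w ∩ G.neighborSet u).ncard +
        (nonNbrs G W u).card + (nonNbrs G W w).card + 2)
    have : (1 - ε) * Δ = Δ - η := by rw [hη]; ring
    linarith
  have h5 := Set.ncard_le_ncard hfriend (Set.toFinite _)
  rw [Set.ncard_coe_finset] at h5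
  have h6 := hnon T (Finset.filter_subset _ _) u
  have h7 : (T.card : ℝ) ≤ (friends G Δ ε u).ncard + (nonNbrs G W u).card + 1 := by
    exact_mod_cast (by omega : T.card ≤ (friends G Δ ε u).ncard + (nonNbrs G W u).card + 1)
  have : (1 - ε) * Δ = Δ - η := by rw [hη]; ring
  unfold IsDense
  linarith

open Classical in
/-- The non-neighbours of `u` in `W` that precede `u` in the list. -/
noncomputable def earlier (G : SimpleGraph (Fin n)) (W : Finset (Fin n)) (l : List (Fin n))
    (u : Fin n) : Finset (Fin n) :=
  {m ∈ W | m ∈ before l u ∧ ¬ G.Adj u m}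

/-- Each non-adjacent pair is counted at its later member. -/
theorem sum_card_nonNbrs_le (G : SimpleGraph (Fin n)) {W : Finset (Fin n)} {l : List (Fin n)}
    (hW : ∀ w ∈ W, w ∈ l) :
    ∑ u ∈ W, (nonNbrs G W u).card ≤ 2 * ∑ u ∈ W, (earlier G W l u).card := by
  classical
  have h1 : ∀ u ∈ W, (nonNbrs G W u).card ≤ (earlier G W l u).card +
      (W.filter fun m => u ∈ earlier G W l m).card := by
    intro u hu
    refine (Finset.card_le_card fun m hm => ?_).trans (Finset.card_union_le _ _)
    simp only [nonNbrs, Finset.mem_filter] at hm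
    simp only [earlier, Finset.mem_union, Finset.mem_filter]
    rcases mem_before_or (hW u hu) (hW m hm.1) (Ne.symm hm.2.1) with h | h
    · exact Or.inl ⟨hm.1, h, hm.2.2⟩
    · exact Or.inr ⟨hm.1, hu, h, fun h' => hm.2.2 h'.symm⟩
  have h2 := Finset.sum_card_bipartiteAbove_eq_sum_card_bipartiteBelow
    (s := W) (t := W) (fun (u m : Fin n) => u ∈ earlier G W l m)
  simp only [Finset.bipartiteAbove, Finset.bipartiteBelow] at h2
  have h3 : ∀ m, W.filter (fun u => u ∈ earlier G W l m) = earlier G W l m := fun m => by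
    ext u
    simp [earlier]
  simp only [h3] at h2
  calc _ ≤ ∑ u ∈ W, ((earlier G W l u).card + (W.filter fun m => u ∈ earlier G W l m).card) :=
        Finset.sum_le_sum h1
    _ = _ := by rw [Finset.sum_add_distrib, h2]; ring

/-- The savings on a set `W` are at least proportional to the number of non-adjacent pairs, where
only vertices with at least `τ` earlier non-neighbours are taken into account. -/
theorem prob_savings_le_of_earlier (G : SimpleGraph (Fin n)) (hΔ : 0 < Δ)
    (hG : ∀ v, (nbrs G v).card ≤ Δ) {W : Finset (Fin n)} (hW : W.card ≤ Δ) {l : List (Fin n)}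
    (hl : l.Nodup) (τ a : ℝ) :
    prob (fun x : Fin n → Bool × Fin (Δ + 1) => savings W (oneShotColoring G l x) ≤ a) ≤
      Real.exp (a - (l.map fun u => if u ∈ W ∧ τ ≤ (earlier G W l u).card then
          3 / 400 * ((earlier G W l u).card / ((Δ : ℝ) + 1)) else 0).sum) +
        n * (Real.exp (-(τ / 2000)) + n * Real.exp (-(((Δ : ℝ) + 1) / 500))) := by
  classical
  set M := earlier G W l with hM
  have hMW : ∀ u, M u ⊆ W := fun u => Finset.filter_subset _ _
  set ν : Fin n → ℝ := fun u => if u ∈ W ∧ τ ≤ (M u).card then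
    3 / 400 * ((M u).card / ((Δ : ℝ) + 1)) else 0 with hν
  have hΔ' : (0 : ℝ) < (Δ : ℝ) + 1 := by positivity
  have hbad := prob_exists_le_card_mul (W.filter fun u => τ ≤ (M u).card)
    (fun (u : Fin n) (x : Fin n → Bool × Fin (Δ + 1)) =>
      ((surviving ∅ (M u) (nbrs G u)
        (run (oneStep G) x (before l u) fun _ => none)).card : ℝ) ≤ (M u).card / 40)
    (q := Real.exp (-(τ / 2000)) + n * Real.exp (-(((Δ : ℝ) + 1) / 500)))
    fun u hu => (prob_few_surviving_le G hΔ hG ((Finset.card_le_card (hMW u)).trans hW) (hG u)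
      (Finset.disjoint_left.2 fun m hm h => by
        simp only [hM, earlier, Finset.mem_filter] at hm
        exact hm.2.2 (mem_nbrs.1 h)) (before_nodup hl u) fun m hm => by
        simp only [hM, earlier, Finset.mem_filter] at hm
        exact hm.2.1).trans (by
          have := (Finset.mem_filter.1 hu).2
          gcongr)
  refine (prob_mono fun x hx => ?_).trans ((prob_or_le _ _).trans
    (add_le_add (prob_savings_le G M hMW ν a hl) (hbad.trans ?_)))
  · by_contra! hcon
    obtain ⟨h1, h2⟩ := hcon
    refine not_lt_of_ge hx (h1 fun pre v post h => ⟨run_oneStep_eq_none G x hl h, ?_⟩)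
    by_cases hv : v ∈ W ∧ τ ≤ (M v).card
    · refine Or.inr ⟨hv.1, ?_⟩
      have := (h2 v (Finset.mem_filter.2 hv)).le
      rw [before_eq hl h] at this
      simp only [hν, if_pos hv]
      rw [mul_div_assoc', div_le_div_iff_of_pos_right hΔ']
      linarith
    · exact Or.inl (by simp only [hν, if_neg hv]; exact le_rfl)
  · gcongr
    simpa using (W.filter fun u => τ ≤ ((M u).card : ℝ)).card_le_univ

open Classical in
/-- The neighbours of `z` in the list. -/
noncomputable def listNbrs (G : SimpleGraph (Fin n)) (l : List (Fin n)) (z : Fin n) :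
    Finset (Fin n) :=
  {u ∈ l.toFinset | G.Adj z u}

theorem mem_listNbrs {G : SimpleGraph (Fin n)} {l : List (Fin n)} {u z : Fin n} :
    u ∈ listNbrs G l z ↔ u ∈ l ∧ G.Adj z u := by simp [listNbrs]

theorem listNbrs_subset (G : SimpleGraph (Fin n)) (l : List (Fin n)) (z : Fin n) :
    listNbrs G l z ⊆ nbrs G z := fun _ hu => mem_nbrs.2 (mem_listNbrs.1 hu).2

/-- A vertex with almost `Δ` sparse neighbours in the list saves `ε² Δ / 3600` colours with high
probability. -/
theorem prob_savings_le_of_sparse (G : SimpleGraph (Fin n)) (hΔ : 0 < Δ)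
    (hG : ∀ v, (nbrs G v).card ≤ Δ) {ε : ℝ} (hε : 0 < ε) (hε1 : ε ≤ 1 / 5000)
    (hεΔ : 1000 ≤ ε ^ 2 * Δ) {l : List (Fin n)} (hl : l.Nodup) (hS : ∀ v ∈ l, IsSparse G Δ ε v)
    {z : Fin n} (hz : (Δ : ℝ) + 1 - ε ^ 2 * Δ / 3600 ≤ (listNbrs G l z).card) :
    prob (fun x : Fin n → Bool × Fin (Δ + 1) =>
        savings (listNbrs G l z) (oneShotColoring G l x) ≤ ε ^ 2 * Δ / 3600) ≤
      3 * n ^ 2 * Real.exp (-(ε ^ 2 * Δ / 100000)) := by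
  classical
  set W := listNbrs G l z with hWdef
  have hΔ1 : (1 : ℝ) ≤ Δ := by exact_mod_cast hΔ
  have hW : W.card ≤ Δ := (Finset.card_le_card (listNbrs_subset G l z)).trans (hG z)
  have hWl : ∀ w ∈ W, w ∈ l := fun w hw => (mem_listNbrs.1 hw).1
  -- vertices with fewer than `τ` earlier non-neighbours account for at most `Δ τ` pairs, a fifth of
  -- the number of non-adjacent pairs that exist
  set τ : ℝ := ε ^ 2 * Δ / 50 with hτ
  have hpairs := sum_card_nonNbrs_ge G hε hε1 (Δ := Δ) (by nlinarith)
    (fun v hv => hS v (hWl v hv)) hz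
  have hpairs' : ∑ u ∈ W, ((nonNbrs G W u).card : ℝ) ≤
      2 * ∑ u ∈ W, ((earlier G W l u).card : ℝ) := by
    exact_mod_cast sum_card_nonNbrs_le G hWl
  have hsplit : ∑ u ∈ W, ((earlier G W l u).card : ℝ) ≤
      (∑ u ∈ W with τ ≤ (earlier G W l u).card, ((earlier G W l u).card : ℝ)) + Δ * τ := by
    rw [← Finset.sum_filter_add_sum_filter_not W fun u => τ ≤ (earlier G W l u).card]
    gcongr
    calc _ ≤ ∑ u ∈ W with ¬ τ ≤ (earlier G W l u).card, τ :=
          Finset.sum_le_sum fun u hu => (not_le.1 (Finset.mem_filter.1 hu).2).le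
      _ ≤ Δ * τ := by
          rw [Finset.sum_const, nsmul_eq_mul]
          have : 0 ≤ τ := by positivity
          gcongr
          exact (Finset.card_filter_le _ _).trans hW
  have hsum : (l.map fun u => if u ∈ W ∧ τ ≤ (earlier G W l u).card then
      3 / 400 * ((earlier G W l u).card / ((Δ : ℝ) + 1)) else 0).sum =
      3 / 400 * ((∑ u ∈ W with τ ≤ (earlier G W l u).card, ((earlier G W l u).card : ℝ)) /
        ((Δ : ℝ) + 1)) := by
    rw [← List.sum_toFinset _ hl, ← Finset.sum_filter, Finset.sum_div, Finset.mul_sum]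
    refine Finset.sum_congr ?_ fun _ _ => rfl
    ext u
    simp only [Finset.mem_filter, List.mem_toFinset]
    exact ⟨fun h => h.2, fun h => ⟨hWl u h.1, h⟩⟩
  refine (prob_savings_le_of_earlier G hΔ hG hW hl τ _).trans ?_
  rw [hsum]
  have hn : (1 : ℝ) ≤ n := by exact_mod_cast Fin.pos z
  have hbig : 2 / 25 * (ε ^ 2 * Δ) * Δ ≤
      ∑ u ∈ W with τ ≤ (earlier G W l u).card, ((earlier G W l u).card : ℝ) := by
    have : Δ * τ = (ε * Δ) ^ 2 / 50 := by rw [hτ]; ring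
    have : (ε * Δ) ^ 2 = ε ^ 2 * Δ * Δ := by ring
    nlinarith
  have hdiv : 1 / 25 * (ε ^ 2 * Δ) ≤
      (∑ u ∈ W with τ ≤ (earlier G W l u).card, ((earlier G W l u).card : ℝ)) /
        ((Δ : ℝ) + 1) := by
    rw [le_div_iff₀ (by positivity)]
    refine le_trans ?_ hbig
    have : 0 ≤ ε ^ 2 * Δ := by positivity
    nlinarith
  have e1 : Real.exp (ε ^ 2 * Δ / 3600 - 3 / 400 *
      ((∑ u ∈ W with τ ≤ (earlier G W l u).card, ((earlier G W l u).card : ℝ)) /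
        ((Δ : ℝ) + 1))) ≤ Real.exp (-(ε ^ 2 * Δ / 100000)) := Real.exp_le_exp.2 (by linarith)
  have e2 : Real.exp (-(τ / 2000)) = Real.exp (-(ε ^ 2 * Δ / 100000)) := by
    rw [hτ]; congr 1; ring
  have e3 : Real.exp (-(((Δ : ℝ) + 1) / 500)) ≤ Real.exp (-(ε ^ 2 * Δ / 100000)) := by
    refine Real.exp_le_exp.2 ?_
    have : ε ^ 2 ≤ 1 := by nlinarith
    nlinarith
  set E := Real.exp (-(ε ^ 2 * Δ / 100000)) with hE
  have hE0 : 0 < E := Real.exp_pos _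
  rw [e2]
  calc _ ≤ E + n * (E + n * E) := by gcongr
    _ ≤ 3 * n ^ 2 * E := by
        have h1 : E ≤ n * E := le_mul_of_one_le_left hE0.le hn
        have h2 : n * E ≤ n * (n * E) := by gcongr
        linarith

end Pairs

/-! ### Greedy-Coloring with finitely many draws -/

section Greedy

variable {n Δ : ℕ}

/-- Continue finitely many draws by a constant sequence. -/
def extend {T : ℕ} (dr : Fin n → Fin T → Fin (Δ + 1)) (v : Fin n) (j : ℕ) : Fin (Δ + 1) :=
  if h : j < T then dr v ⟨j, h⟩ else 0

/-- Each while loop meets a free colour among its first `t v` draws. -/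
def Succeeds (G : SimpleGraph (Fin n)) (t : Fin n → ℕ) (draw : Fin n → ℕ → Fin (Δ + 1))
    (l : List (Fin n)) (s : Fin n → Option (Fin (Δ + 1))) : Prop :=
  GoodPath (greedyStep G) (fun v s => ∃ j < t v, draw v j ∈ free G s v) draw l s

theorem greedyStep_congr {G : SimpleGraph (Fin n)} {s : Fin n → Option (Fin (Δ + 1))} {v : Fin n}
    {draw draw' : ℕ → Fin (Δ + 1)} {t : ℕ} (h : ∀ j < t, draw j = draw' j)
    (hex : ∃ j < t, draw j ∈ free G s v) : greedyStep G s v draw = greedyStep G s v draw' := by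
  classical
  obtain ⟨j, hj, hf⟩ := hex
  have h1 : ∃ j, draw j ∈ free G s v := ⟨j, hf⟩
  have h2 : ∃ j, draw' j ∈ free G s v := ⟨j, h j hj ▸ hf⟩
  have hlt : Nat.find h1 < t := (Nat.find_min' h1 hf).trans_lt hj
  have hfind : Nat.find h2 = Nat.find h1 := by
    rw [Nat.find_eq_iff]
    refine ⟨h _ hlt ▸ Nat.find_spec h1, fun i hi => ?_⟩
    rw [← h i (hi.trans hlt)]
    exact Nat.find_min h1 hi
  have e : draw' (Nat.find h2) = draw (Nat.find h1) := by rw [hfind, h _ hlt]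
  unfold greedyStep
  rw [dif_pos h1, dif_pos h2]
  congr 2
  convert e.symm

/-- Whether the while loops succeed within the given numbers of rounds, and with which result,
depends only on the draws of these rounds. -/
theorem Succeeds.congr {G : SimpleGraph (Fin n)} {t : Fin n → ℕ}
    {draw draw' : Fin n → ℕ → Fin (Δ + 1)} (h : ∀ v, ∀ j < t v, draw v j = draw' v j)
    {l : List (Fin n)} {s : Fin n → Option (Fin (Δ + 1))} (hs : Succeeds G t draw l s) :
    Succeeds G t draw' l s := by
  induction l generalizing s with
  | nil => exact fun pre v post e => by simp at e
  | cons v l ih =>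
    obtain ⟨h1, h2⟩ := goodPath_cons.1 hs
    refine goodPath_cons.2 ⟨?_, ?_⟩
    · obtain ⟨j, hj, hf⟩ := h1
      exact ⟨j, hj, h v j hj ▸ hf⟩
    · rw [← greedyStep_congr (h v) h1]
      exact ih h2

/-- The probability that the first `t` draws all miss a set `A` of colours. -/
theorem prob_draws_miss_le {T t : ℕ} (ht : t ≤ T) (A : Finset (Fin (Δ + 1))) {a : ℝ}
    (ha : a ≤ A.card) :
    prob (fun row : Fin T → Fin (Δ + 1) => ∀ j : Fin T, (j : ℕ) < t → row j ∉ A) ≤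
      Real.exp (-(a * t / ((Δ : ℝ) + 1))) := by
  classical
  have hΔ : (0 : ℝ) < (Δ : ℝ) + 1 := by positivity
  let f : Fin T → Fin (Δ + 1) → ℝ := fun j y => if (j : ℕ) < t ∧ y ∈ A then 0 else 1
  have hf : ∀ j : Fin T, 𝔼 y, f j y ≤
      if j ∈ Finset.univ.filter (fun j : Fin T => (j : ℕ) < t) then
        Real.exp (-(a / ((Δ : ℝ) + 1))) else 1 := by
    intro j
    split_ifs with hj
    · have hj' : (j : ℕ) < t := (Finset.mem_filter.1 hj).2
      have h1 : ∀ y, f j y = 1 - (if y ∈ A then 1 else 0) := fun y => by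
        by_cases hy : y ∈ A <;> simp [f, hj', hy]
      simp only [h1]
      rw [Finset.expect_sub_distrib, Finset.expect_const Finset.univ_nonempty,
        Fintype.expect_eq_sum_div_card (fun y => if y ∈ A then (1 : ℝ) else 0), Finset.sum_boole,
        Fintype.card_fin]
      have h2 : (Finset.univ.filter fun y => y ∈ A) = A := by ext; simp
      rw [h2]
      push_cast
      have h3 := Real.add_one_le_exp (-(a / ((Δ : ℝ) + 1)))
      have h4 : a / ((Δ : ℝ) + 1) ≤ A.card / ((Δ : ℝ) + 1) := by gcongr
      linarith
    · exact expect_le_of_forall_le fun y => by simp only [f]; split_ifs <;> norm_num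
  have hcard : (Finset.univ.filter fun j : Fin T => (j : ℕ) < t).card = t := by
    rw [Fin.card_filter_val_lt, min_eq_right ht]
  calc _ ≤ 𝔼 row : Fin T → Fin (Δ + 1), ∏ j, f j (row j) := by
        refine prob_le_expect (fun row => Finset.prod_nonneg fun j _ => ?_) fun row h => ?_
        · simp only [f]; split_ifs <;> norm_num
        · rw [Finset.prod_eq_one fun j _ => ?_]
          simp only [f]
          rw [if_neg fun h' => h j h'.1 h'.2]
    _ = ∏ j, 𝔼 y, f j y := expect_prod_eq_prod_expect f
    _ ≤ ∏ j, if j ∈ Finset.univ.filter (fun j : Fin T => (j : ℕ) < t) then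
        Real.exp (-(a / ((Δ : ℝ) + 1))) else 1 :=
        Finset.prod_le_prod (fun j _ => Finset.expect_nonneg fun y _ => by
          simp only [f]; split_ifs <;> norm_num) fun j _ => hf j
    _ = _ := by
        rw [Finset.prod_ite_mem, Finset.univ_inter, Finset.prod_const, ← Real.exp_nat_mul, hcard]
        ring_nf

/-- The draws at `v` are independent of the state before `v` is treated. -/
theorem prob_vertex_fails_le (G : SimpleGraph (Fin n)) {T t : ℕ} (ht : t ≤ T) {l : List (Fin n)}
    {v : Fin n} (hv : v ∉ l) (s : Fin n → Option (Fin (Δ + 1))) (a : ℝ) :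
    prob (fun dr : Fin n → Fin T → Fin (Δ + 1) =>
        a ≤ (free G (run (greedyStep G) (extend dr) l s) v).card ∧
          ∀ j < t, extend dr v j ∉ free G (run (greedyStep G) (extend dr) l s) v) ≤
      Real.exp (-(a * t / ((Δ : ℝ) + 1))) := by
  classical
  unfold prob
  rw [expect_resample v]
  refine expect_le_of_forall_le fun dr => ?_
  have hrun : ∀ row, run (greedyStep G) (extend (Function.update dr v row)) l s =
      run (greedyStep G) (extend dr) l s := fun row => run_congr s fun w hw => by
    funext j
    simp only [extend]
    rw [Function.update_of_ne (ne_of_mem_of_not_mem hw hv)]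
  simp only [hrun]
  by_cases ha : a ≤ (free G (run (greedyStep G) (extend dr) l s) v).card
  · refine le_trans ?_ (prob_draws_miss_le ht _ ha)
    refine Finset.expect_le_expect fun row _ => ?_
    split_ifs with h1 h2
    · exact le_rfl
    · refine (h2 fun j hj => ?_).elim
      have := h1.2 j hj
      simpa [extend] using this
    · exact zero_le_one
    · exact le_rfl
  · simp only [ha, false_and, if_false, Finset.expect_const_zero]
    positivity

/-- Either some while loop fails although sufficiently many colours are free, which is unlikely, or
all of them succeed. -/
theorem prob_greedy_fails_le (G : SimpleGraph (Fin n)) {T : ℕ} {t : Fin n → ℕ}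
    (ht : ∀ v, t v ≤ T) {l : List (Fin n)} (hl : l.Nodup) (s : Fin n → Option (Fin (Δ + 1)))
    (a : Fin n → ℝ) {q : ℝ} (hq0 : 0 ≤ q)
    (hq : ∀ v ∈ l, Real.exp (-(a v * t v / ((Δ : ℝ) + 1))) ≤ q)
    (ha : ∀ (dr : Fin n → Fin T → Fin (Δ + 1)) pre v post, l = pre ++ v :: post →
      a v ≤ (free G (run (greedyStep G) (extend dr) pre s) v).card) :
    prob (fun dr : Fin n → Fin T → Fin (Δ + 1) => ¬ Succeeds G t (extend dr) l s) ≤ n * q := by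
  classical
  have h := prob_exists_le_card_mul l.toFinset
    (fun v (dr : Fin n → Fin T → Fin (Δ + 1)) =>
      a v ≤ (free G (run (greedyStep G) (extend dr) (before l v) s) v).card ∧
          ∀ j < t v, extend dr v j ∉ free G (run (greedyStep G) (extend dr) (before l v) s) v)
    fun v hv => (prob_vertex_fails_le G (ht v) (not_mem_before l v) s (a v)).trans
      (hq v (List.mem_toFinset.1 hv))
  refine (prob_mono fun dr hdr => ?_).trans (h.trans ?_)
  · simp only [Succeeds, GoodPath] at hdr
    push Not at hdr
    obtain ⟨pre, v, post, e, hj⟩ := hdr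
    refine ⟨v, by simp [e], ?_⟩
    rw [before_eq hl e]
    exact ⟨ha dr pre v post e, hj⟩
  · gcongr
    simpa using l.toFinset.card_le_univ

open Classical in
/-- Every coloured neighbour blocks at most one colour. -/
theorem succ_le_card_free_add (G : SimpleGraph (Fin n)) (s : Fin n → Option (Fin (Δ + 1)))
    (v : Fin n) :
    Δ + 1 ≤ (free G s v).card + ((nbrs G v).filter fun u => s u ≠ none).card := by
  have h : Finset.univ ⊆ free G s v ∪
      ((nbrs G v).filter fun u => s u ≠ none).image fun u => (s u).getD 0 := by
    intro c _
    rw [Finset.mem_union, or_iff_not_imp_left, mem_free]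
    push Not
    rintro ⟨u, hu, e⟩
    exact Finset.mem_image.2 ⟨u, Finset.mem_filter.2 ⟨mem_nbrs.2 hu, by simp [e]⟩, by simp [e]⟩
  have h1 := Finset.card_le_card h
  rw [Finset.card_univ, Fintype.card_fin] at h1
  exact h1.trans ((Finset.card_union_le _ _).trans (by gcongr; exact Finset.card_image_le))

/-! ### Random order: blocks of positions -/

/-- The positions of the neighbours of `v` in a list. -/
noncomputable def nbrPositions (G : SimpleGraph (Fin n)) (S : List (Fin n)) (v : Fin n) :
    Finset (Fin S.length) :=
  open Classical in {i | G.Adj v (S.get i)}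

/-- The `r`-th block of `b` positions, counted from the end. -/
def block (k b r : ℕ) : Finset (Fin k) :=
  {i | k ≤ i + (r + 1) * b ∧ i + r * b < k}

theorem mem_block {k b r : ℕ} {i : Fin k} :
    i ∈ block k b r ↔ k ≤ i + (r + 1) * b ∧ i + r * b < k := by simp [block]

theorem card_block {k b r : ℕ} (h : (r + 1) * b ≤ k) : (block k b r).card = b := by
  have h2 : (r + 1) * b = r * b + b := by ring
  have h1 : (block k b r).map Fin.valEmbedding = Finset.Ico (k - (r + 1) * b) (k - r * b) := by
    ext i
    simp only [Finset.mem_map, mem_block, Fin.valEmbedding_apply, Finset.mem_Ico]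
    constructor
    · rintro ⟨i, hi, rfl⟩
      omega
    · intro hi
      exact ⟨⟨i, by omega⟩, by simp only; omega, rfl⟩
  rw [← Finset.card_map Fin.valEmbedding, h1, Nat.card_Ico]
  omega

/-- Every complete block contains a neighbour of `v`. -/
def BlocksHit (G : SimpleGraph (Fin n)) (S : List (Fin n)) (π : Equiv.Perm (Fin S.length))
    (b : ℕ) (v : Fin n) : Prop :=
  ∀ r, (r + 1) * b ≤ S.length → ∃ i ∈ block S.length b r, π i ∈ nbrPositions G S v

theorem prob_not_blocksHit_le (G : SimpleGraph (Fin n)) {S : List (Fin n)} (hS : S.Nodup) {b : ℕ}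
    (hb : 0 < b) (v : Fin n) :
    prob (fun π : Equiv.Perm (Fin S.length) => ¬ BlocksHit G S π b v) ≤
      n * Real.exp (-((nbrPositions G S v).card * b / n)) := by
  have hSn := length_le_of_nodup hS
  have h := prob_exists_le_card_mul
    ((Finset.range S.length).filter fun r => (r + 1) * b ≤ S.length)
    (fun r (π : Equiv.Perm (Fin S.length)) =>
      ∀ i ∈ block S.length b r, π i ∉ nbrPositions G S v)
    (q := Real.exp (-((nbrPositions G S v).card * b / n))) fun r hr => by
      have hr' := (Finset.mem_filter.1 hr).2
      have hpos : 0 < S.length := by have := Finset.mem_range.1 (Finset.mem_filter.1 hr).1; omega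
      have hpos' : (0 : ℝ) < S.length := by exact_mod_cast hpos
      refine (prob_perm_avoid_le _ _).trans ?_
      rw [card_block hr']
      have h1 : (0 : ℝ) ≤ 1 - (nbrPositions G S v).card / S.length := by
        rw [sub_nonneg, div_le_one hpos']
        exact_mod_cast (by simpa using (nbrPositions G S v).card_le_univ)
      calc _ ≤ Real.exp (-((nbrPositions G S v).card / S.length)) ^ b := by
            gcongr
            have := Real.add_one_le_exp (-((nbrPositions G S v).card / S.length : ℝ))
            linarith
        _ ≤ _ := by
            rw [← Real.exp_nat_mul]
            refine Real.exp_le_exp.2 ?_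
            rw [mul_neg, neg_le_neg_iff, mul_comm (b : ℝ), div_mul_eq_mul_div]
            gcongr
  refine (prob_mono fun π hπ => ?_).trans (h.trans ?_)
  · simp only [BlocksHit] at hπ
    push Not at hπ
    obtain ⟨r, hr, hπ⟩ := hπ
    refine ⟨r, Finset.mem_filter.2 ⟨Finset.mem_range.2 ?_, hr⟩, hπ⟩
    nlinarith
  · gcongr
    exact (Finset.card_filter_le _ _).trans (by simpa using hSn)

open Classical in
/-- If every block contains a neighbour of `v`, then at least `⌊j / b⌋` neighbours come after `v`,
where `j` is the number of vertices after `v`. -/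
theorem BlocksHit.le_card {G : SimpleGraph (Fin n)} {S : List (Fin n)} (hS : S.Nodup)
    {π : Equiv.Perm (Fin S.length)} {b : ℕ} {v : Fin n} (h : BlocksHit G S π b v)
    {pre post : List (Fin n)} (e : shuffle S π = pre ++ v :: post) :
    post.length / b ≤ ((nbrs G v).filter fun u => u ∈ post).card := by
  have hlen : S.length = pre.length + 1 + post.length := by
    rw [← shuffle_length S π, e]
    simp
    omega
  have hr : ∀ r < post.length / b, (r + 1) * b ≤ post.length := fun r hr =>
    (Nat.mul_le_mul_right b hr).trans (Nat.div_mul_le_self _ _)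
  have hex : ∀ r, ∃ i, r < post.length / b → i ∈ block S.length b r ∧ π i ∈ nbrPositions G S v := by
    intro r
    by_cases hlt : r < post.length / b
    · obtain ⟨i, h1, h2⟩ := h r ((hr r hlt).trans (by omega))
      exact ⟨i, fun _ => ⟨h1, h2⟩⟩
    · have : 0 < S.length := by omega
      exact ⟨⟨0, this⟩, fun h => (hlt h).elim⟩
  choose i hi using hex
  have hget : ∀ p : Fin S.length, S.get (π p) = (shuffle S π)[(p : ℕ)]'(by
      rw [shuffle_length]; exact p.2) := fun p => by simp [shuffle]
  rw [← Finset.card_range (post.length / b)]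
  refine Finset.card_le_card_of_injOn (fun r => S.get (π (i r))) (fun r hr' => ?_)
    fun r hr₁ r' hr₂ heq => ?_
  · have hlt : r < post.length / b := by simpa using hr'
    obtain ⟨h1, h2⟩ := hi r hlt
    have h3 := hr r hlt
    rw [mem_block] at h1
    simp only [nbrPositions, Finset.mem_filter, Finset.mem_univ, true_and] at h2
    refine Finset.mem_coe.2 (Finset.mem_filter.2 ⟨mem_nbrs.2 h2, ?_⟩)
    show S.get (π (i r)) ∈ post
    rw [hget]
    simp only [e]
    rw [List.getElem_append_right (by omega), List.getElem_cons]
    rw [dif_neg (by omega)]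
    exact List.getElem_mem _
  · have h1 := hi r (by simpa using hr₁)
    have h2 := hi r' (by simpa using hr₂)
    have h3 : i r = i r' := π.injective (List.nodup_iff_injective_get.1 hS heq)
    rw [h3, mem_block] at h1
    have h4 := mem_block.1 h2.1
    obtain ⟨⟨a1, a2⟩, -⟩ := h1
    obtain ⟨b1, b2⟩ := h4
    have c1 : r * b < (r' + 1) * b := by omega
    have c2 : r' * b < (r + 1) * b := by omega
    have d1 := lt_of_mul_lt_mul_right c1 (Nat.zero_le b)
    have d2 := lt_of_mul_lt_mul_right c2 (Nat.zero_le b)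
    omega

end Greedy

/-! ### Available colours -/

section Available

variable {n Δ : ℕ}

/-- The order in which Greedy-Coloring treats the vertices. -/
noncomputable def order (G : SimpleGraph (Fin n)) {VS : List (Fin n)} (hVS : VS.Nodup)
    (x : Fin n → Bool × Fin (Δ + 1)) (π : (m : Fin (n + 1)) → Equiv.Perm (Fin m)) : List (Fin n) :=
  shuffle (leftover G VS x)
    (π ⟨_, Nat.lt_succ_of_le (length_le_of_nodup (leftover_nodup (G := G) hVS x))⟩)

theorem order_nodup (G : SimpleGraph (Fin n)) {VS : List (Fin n)} (hVS : VS.Nodup)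
    (x : Fin n → Bool × Fin (Δ + 1)) (π : (m : Fin (n + 1)) → Equiv.Perm (Fin m)) :
    (order G hVS x π).Nodup := shuffle_nodup (leftover_nodup hVS x) _

theorem mem_order {G : SimpleGraph (Fin n)} {VS : List (Fin n)} {hVS : VS.Nodup}
    {x : Fin n → Bool × Fin (Δ + 1)} {π : (m : Fin (n + 1)) → Equiv.Perm (Fin m)} {v : Fin n} :
    v ∈ order G hVS x π ↔ v ∈ VS ∧ oneShotColoring G VS x v = none := by
  rw [order, mem_shuffle, leftover, List.mem_filter, Option.isNone_iff_eq_none]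

theorem run_greedyStep_of_not_mem (G : SimpleGraph (Fin n)) (draw : Fin n → ℕ → Fin (Δ + 1))
    {l : List (Fin n)} (s : Fin n → Option (Fin (Δ + 1))) {u : Fin n} (hu : u ∉ l) :
    run (greedyStep G) draw l s u = s u :=
  run_apply_of_not_mem (fun s _ y _ h => greedyStep_of_ne G s h y) s hu

/-- On a tape whose truncation is successful, Color-Sparse follows the colouring process. -/
theorem colorSparse_of_succeeds {G : SimpleGraph (Fin n)} {VS : List (Fin n)} (hVS : VS.Nodup)
    (hΔ : Δ < n) {T : ℕ} {t : Fin n → ℕ} (ht : ∀ v, t v ≤ T) {ω : Tape n Δ}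
    {τ : FiniteTape n Δ T} (hτ : τ = truncate T ω)
    (hgood : Succeeds G t (extend τ.2.2) (order G hVS τ.1 τ.2.1) (oneShotColoring G VS τ.1))
    {N : ℕ} (hN₁ : ∀ c, VS.countP (fun v => (τ.1 v).2 = c) ≤ N)
    (hN : ∀ s' : State n Δ, s'.Valid →
      (∀ c, (s'.L c).length ≤ VS.countP (fun v => (τ.1 v).2 = c) +
        ((order G hVS τ.1 τ.2.1).map fun v =>
          (List.range (t v)).countP fun j => extend τ.2.2 v j = c).sum) →
      ∀ c, (s'.L c).length ≤ N) :
    ∃ s, colorSparse G VS ω = some s ∧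
      (∀ w, oneShotColoring G VS τ.1 w ≠ none → s.color w = oneShotColoring G VS τ.1 w) ∧
      (∀ c, (s.L c).length ≤ N) ∧
      s.time ≤ n * (N + 13) + ((order G hVS τ.1 τ.2.1).map t).sum * (N + 5) := by
  subst hτ
  have hdr : ∀ v, ∀ j < t v, extend (truncate T ω).2.2 v j = ω.2.2.2 (v, j) := fun v j hj => by
    simp [extend, truncate, hj.trans_le (ht v)]
  have hcount : ∀ c, (fun v => (List.range (t v)).countP fun j =>
        extend (truncate T ω).2.2 v j = c) =
      fun v => (List.range (t v)).countP fun j => ω.2.2.2 (v, j) = c := fun c => by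
    funext v
    exact List.countP_congr fun j hj => by rw [hdr v j (List.mem_range.1 hj)]
  simp only [hcount] at hN
  obtain ⟨s, h1, h2, h3, h4⟩ := colorSparse_eq_some hVS hΔ (G := G) (ω := ω) rfl
    (l := order G hVS (truncate T ω).1 (truncate T ω).2.1) rfl
    (draw := fun v j => ω.2.2.2 (v, j)) rfl (t := t) hN₁ hN (hgood.congr hdr)
  refine ⟨s, h1, fun w hw => ?_, h3, h4⟩
  rw [h2]
  exact run_greedyStep_of_not_mem G _ _ fun h => hw (mem_order.1 h).2

theorem savings_nonneg (W : Finset (Fin n)) (s : Fin n → Option (Fin (Δ + 1))) :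
    0 ≤ savings W s := by
  classical
  unfold savings
  rw [sub_nonneg]
  have h : surviving ∅ W ∅ s ⊆ (W.filter fun w => s w ≠ none).image fun w => (s w).getD 0 := by
    intro c hc
    obtain ⟨hc | ⟨w, hw, e⟩, -⟩ := mem_surviving.1 hc
    · simp at hc
    · exact Finset.mem_image.2 ⟨w, Finset.mem_filter.2 ⟨hw, by simp [e]⟩, by simp [e]⟩
  exact_mod_cast (Finset.card_le_card h).trans (Finset.card_image_le.trans_eq (by congr))

/-- The savings of One-Shot-Coloring are colours that remain available. -/
theorem savings_le_available {G : SimpleGraph (Fin n)} {VS : List (Fin n)} {s : State n Δ}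
    {s₀ : Fin n → Option (Fin (Δ + 1))} (hs : ∀ w, s₀ w ≠ none → s.color w = s₀ w) (z : Fin n) :
    (Δ : ℝ) + 1 - (listNbrs G VS z).card + savings (listNbrs G VS z) s₀ ≤
      (available G VS s z).ncard := by
  classical
  set W := listNbrs G VS z with hW
  have h1 : Finset.univ ⊆ ((available G VS s z).toFinset ∪ surviving ∅ W ∅ s₀) ∪
      (W.filter fun w => ¬ s₀ w ≠ none).image fun w => (s.color w).getD 0 := by
    intro c _
    simp only [Finset.mem_union, Set.mem_toFinset]
    by_cases hc : c ∈ available G VS s z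
    · exact Or.inl (Or.inl hc)
    · simp only [available, Set.mem_ofPred_eq] at hc
      push Not at hc
      obtain ⟨u, hu, hzu, e⟩ := hc
      have huW : u ∈ W := mem_listNbrs.2 ⟨hu, hzu⟩
      by_cases h0 : s₀ u = none
      · exact Or.inr (Finset.mem_image.2
          ⟨u, Finset.mem_filter.2 ⟨huW, not_not.2 h0⟩, by simp [e]⟩)
      · exact Or.inl (Or.inr (mem_surviving.2 ⟨Or.inr ⟨u, huW, by rw [← hs u h0, e]⟩, by simp⟩))
  have h2 := Finset.card_le_card h1
  rw [Finset.card_univ, Fintype.card_fin] at h2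
  have h3 := Finset.card_union_le ((available G VS s z).toFinset ∪ surviving ∅ W ∅ s₀)
    ((W.filter fun w => ¬ s₀ w ≠ none).image fun w => (s.color w).getD 0)
  have h4 := Finset.card_union_le (available G VS s z).toFinset (surviving ∅ W ∅ s₀)
  have h5 := Finset.card_image_le (s := W.filter fun w => ¬ s₀ w ≠ none)
    (f := fun w => (s.color w).getD 0)
  have h6 := Finset.card_filter_add_card_filter_not (s := W) fun w => s₀ w ≠ none
  have h7 : (available G VS s z).ncard = (available G VS s z).toFinset.card :=
    Set.ncard_eq_toFinset_card' _
  have h8 : Δ + 1 + (W.filter fun w => s₀ w ≠ none).card ≤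
      (available G VS s z).ncard + (surviving ∅ W ∅ s₀).card + W.card := by omega
  have h9 : (Δ : ℝ) + 1 + (W.filter fun w => s₀ w ≠ none).card ≤
      (available G VS s z).ncard + (surviving ∅ W ∅ s₀).card + W.card := by exact_mod_cast h8
  unfold savings
  convert (show (Δ : ℝ) + 1 - W.card + ((W.filter fun w => s₀ w ≠ none).card -
    (surviving ∅ W ∅ s₀).card) ≤ (available G VS s z).ncard by linarith)

/-- A failed run of the greedy phase within `T` rounds per vertex, using only that a vertex always
has a free colour. -/
theorem prob_not_succeeds_le (G : SimpleGraph (Fin n)) (hG : ∀ v, (nbrs G v).card ≤ Δ)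
    {VS : List (Fin n)} (hVS : VS.Nodup) (T : ℕ) :
    prob (fun τ : FiniteTape n Δ T => ¬ Succeeds G (fun _ => T) (extend τ.2.2)
        (order G hVS τ.1 τ.2.1) (oneShotColoring G VS τ.1)) ≤
      n * Real.exp (-(T / ((Δ : ℝ) + 1))) := by
  have key : ∀ x π, prob (fun dr : Fin n → Fin T → Fin (Δ + 1) => ¬ Succeeds G (fun _ => T)
      (extend dr) (order G hVS x π) (oneShotColoring G VS x)) ≤
      n * Real.exp (-(T / ((Δ : ℝ) + 1))) := by
    intro x π
    refine prob_greedy_fails_le G (fun _ => le_rfl) (order_nodup G hVS x π) _ (fun _ => 1)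
      (Real.exp_nonneg _) (fun v _ => by rw [one_mul]) fun dr pre v post _ => ?_
    have h1 := succ_le_card_free_add G (run (greedyStep G) (extend dr) pre
      (oneShotColoring G VS x)) v
    have h2 := (Finset.card_filter_le (nbrs G v) fun u => run (greedyStep G) (extend dr) pre
      (oneShotColoring G VS x) u ≠ none).trans (hG v)
    have h3 : 1 ≤ (free G (run (greedyStep G) (extend dr) pre (oneShotColoring G VS x)) v).card := by
      omega
    exact_mod_cast h3
  exact prob_prod_le fun x => prob_prod_le fun π => key x π

end Available

section Sparse

variable {n Δ : ℕ}

theorem card_nbrs_eq (G : SimpleGraph (Fin n)) (v : Fin n) :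
    (nbrs G v).card = (G.neighborSet v).ncard := by
  rw [← Set.ncard_coe_finset]
  congr 1
  ext u
  simp [mem_nbrs]

/-- As `ε` is small and `α` is large, the degree bound forces `Δ`, and with it `n`, to be huge. -/
theorem log_bounds {ε α : ℝ} (hΔ : 0 < Δ) (hΔn : Δ < n) (hε : 0 < ε) (hε1 : ε ≤ 1 / 5000)
    (hα : 5000 ^ 3 ≤ α) (h : α * Real.log n / ε ^ 2 < (Δ : ℝ) + 1) :
    1 ≤ Real.log n ∧ α * Real.log n - 1 ≤ ε ^ 2 * Δ ∧ 5000 ^ 3 ≤ (Δ : ℝ) := by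
  have hn2 : (2 : ℝ) ≤ n := by exact_mod_cast (by omega : 2 ≤ n)
  -- `n ≥ 2` already gives a lower bound for `Δ`, which in turn improves the bound for `n`
  have hlog2 : (1 / 2 : ℝ) ≤ Real.log n :=
    le_trans (by linarith [Real.log_two_gt_d9]) (Real.log_le_log (by norm_num) hn2)
  rw [div_lt_iff₀ (by positivity)] at h
  have hε2 : ε ^ 2 ≤ 1 / 25000000 := by nlinarith
  have h0 : (0 : ℝ) < Δ := by exact_mod_cast hΔ
  have h1 : 5000 ^ 3 / 2 ≤ α * Real.log n := by nlinarith
  have h2 : 5000 ^ 3 ≤ (Δ : ℝ) := by nlinarith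
  refine ⟨?_, by nlinarith, h2⟩
  rw [Real.le_log_iff_exp_le (by linarith)]
  have : (Δ : ℝ) ≤ n := by exact_mod_cast hΔn.le
  linarith [Real.exp_one_lt_d9]

/-- A union bound over all vertices of the probabilities of small savings. -/
theorem sparse_tail_le {ε α : ℝ} (hn : 0 < n) (hα : 5000 ^ 3 ≤ α) (hlog : 1 ≤ Real.log n)
    (h : α * Real.log n - 1 ≤ ε ^ 2 * Δ) :
    (n : ℝ) * (3 * n ^ 2 * Real.exp (-(ε ^ 2 * Δ / 100000))) ≤
      (n : ℝ) ^ (-(1 / 5000 ^ 3 * α)) / 2 := by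
  have hn' : (0 : ℝ) < n := by exact_mod_cast hn
  have h6 : (6 : ℝ) ≤ Real.exp 2 := by
    have := Real.exp_one_gt_d9
    rw [show (2 : ℝ) = 1 + 1 by norm_num, Real.exp_add]
    nlinarith
  have h3 : (n : ℝ) ^ 3 = Real.exp (3 * Real.log n) := by
    rw [mul_comm, Real.exp_mul, Real.exp_log hn']
    norm_cast
  rw [Real.rpow_def_of_pos hn', le_div_iff₀ (by norm_num)]
  calc _ = 6 * (n : ℝ) ^ 3 * Real.exp (-(ε ^ 2 * Δ / 100000)) := by ring
    _ ≤ Real.exp 2 * Real.exp (3 * Real.log n) * Real.exp (-(ε ^ 2 * Δ / 100000)) := by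
        rw [h3]; gcongr
    _ ≤ _ := by
        rw [← Real.exp_add, ← Real.exp_add]
        refine Real.exp_le_exp.2 ?_
        nlinarith [mul_le_mul_of_nonneg_right hα (by linarith : 0 ≤ Real.log n)]

/-- Outside an event of small probability, Color-Sparse terminates and every vertex has many
available colours. -/
theorem tapeMeasure_few_available_le {ε α : ℝ} {G : SimpleGraph (Fin n)} {VS : List (Fin n)}
    (hΔ : 0 < Δ) (hΔn : Δ < n) (hG : ∀ v, (G.neighborSet v).ncard ≤ Δ) (hε : 0 < ε)
    (hε1 : ε ≤ 1 / 5000) (hα : 5000 ^ 3 ≤ α) (h : α * Real.log n / ε ^ 2 < (Δ : ℝ) + 1)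
    (hVS : VS.Nodup) (hS : ∀ v ∈ VS, IsSparse G Δ ε v) :
    tapeMeasure n Δ {ω | ∃ s, colorSparse G VS ω = some s ∧
        ∀ v, ε ^ 2 * Δ / (9 * Real.exp 6) ≤ ((available G VS s v).ncard : ℝ)}ᶜ ≤
      ENNReal.ofReal ((n : ℝ) ^ (-(1 / 5000 ^ 3 * α))) := by
  classical
  obtain ⟨hlog, hεΔ, -⟩ := log_bounds hΔ hΔn hε hε1 hα h
  have hn : 0 < n := hΔ.trans hΔn
  have hn' : (0 : ℝ) < n := by exact_mod_cast hn
  have hG' : ∀ v, (nbrs G v).card ≤ Δ := fun v => (card_nbrs_eq G v).trans_le (hG v)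
  have h1000 : 1000 ≤ ε ^ 2 * Δ := by nlinarith
  -- the number of rounds is chosen so large that the greedy phase hardly ever lasts longer
  obtain ⟨T, hT⟩ : ∃ T : ℕ, (n : ℝ) * Real.exp (-(T / ((Δ : ℝ) + 1))) ≤
      (n : ℝ) ^ (-(1 / 5000 ^ 3 * α)) / 2 := by
    have hpos : 0 < (n : ℝ) ^ (-(1 / 5000 ^ 3 * α)) / 2 / n := by positivity
    obtain ⟨T, hT⟩ := exists_nat_ge
      (-Real.log ((n : ℝ) ^ (-(1 / 5000 ^ 3 * α)) / 2 / n) * ((Δ : ℝ) + 1))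
    refine ⟨T, ?_⟩
    rw [mul_comm, ← le_div_iff₀ hn', ← Real.le_log_iff_exp_le hpos]
    rw [← le_div_iff₀ (by positivity)] at hT
    linarith
  let bad : FiniteTape n Δ T → Prop := fun τ =>
    ¬ Succeeds G (fun _ => T) (extend τ.2.2) (order G hVS τ.1 τ.2.1) (oneShotColoring G VS τ.1) ∨
      ∃ z ∈ Finset.univ.filter fun z => (Δ : ℝ) + 1 - ε ^ 2 * Δ / 3600 ≤ (listNbrs G VS z).card,
        savings (listNbrs G VS z) (oneShotColoring G VS τ.1) ≤ ε ^ 2 * Δ / 3600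
  have hbad : prob bad ≤ (n : ℝ) ^ (-(1 / 5000 ^ 3 * α)) := by
    refine (prob_or_le _ _).trans ?_
    have h1 := prob_not_succeeds_le G hG' hVS T
    have h2 := prob_exists_le_card_mul
      (Finset.univ.filter fun z => (Δ : ℝ) + 1 - ε ^ 2 * Δ / 3600 ≤ (listNbrs G VS z).card)
      (fun z (τ : FiniteTape n Δ T) =>
        savings (listNbrs G VS z) (oneShotColoring G VS τ.1) ≤ ε ^ 2 * Δ / 3600)
      fun z hz => (prob_fst_eq fun x => savings (listNbrs G VS z) (oneShotColoring G VS x) ≤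
        ε ^ 2 * Δ / 3600).trans_le (prob_savings_le_of_sparse G hΔ hG' hε hε1 h1000 hVS hS
          (Finset.mem_filter.1 hz).2)
    have h3 := sparse_tail_le hn hα hlog hεΔ
    have h4 : ((Finset.univ.filter fun z =>
        (Δ : ℝ) + 1 - ε ^ 2 * Δ / 3600 ≤ (listNbrs G VS z).card).card : ℝ) *
        (3 * n ^ 2 * Real.exp (-(ε ^ 2 * Δ / 100000))) ≤
        n * (3 * n ^ 2 * Real.exp (-(ε ^ 2 * Δ / 100000))) := by
      gcongr
      exact (Finset.card_filter_le _ _).trans_eq (Finset.card_fin n)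
    linarith
  have he : (3600 : ℝ) ≤ 9 * Real.exp 6 := by
    have h1 : (400 : ℝ) ≤ Real.exp 6 := by
      rw [show (6 : ℝ) = (6 : ℕ) * 1 by norm_num, Real.exp_nat_mul]
      calc (400 : ℝ) ≤ 2.7182818283 ^ 6 := by norm_num
        _ ≤ _ := by
          gcongr
          exact Real.exp_one_gt_d9.le
    linarith
  have hsmall : ε ^ 2 * Δ / (9 * Real.exp 6) ≤ ε ^ 2 * Δ / 3600 := by gcongr
  calc _ ≤ tapeMeasure n Δ {ω | bad (truncate T ω)} := measure_mono fun ω hω => by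
        by_contra hgood
        set τ := truncate T ω with hτ
        obtain ⟨hgood, hsave⟩ := not_or.1 hgood
        rw [not_not] at hgood
        refine hω ?_
        obtain ⟨s, e, hs, -, -⟩ := colorSparse_of_succeeds hVS hΔn (fun _ => le_rfl) hτ hgood
          (N := n) (fun c => List.countP_le_length.trans (length_le_of_nodup hVS))
          fun s' hs' _ c => hs'.length_le c
        refine ⟨s, e, fun z => hsmall.trans ?_⟩
        have hav := savings_le_available (G := G) (VS := VS) hs z
        have hsav := savings_nonneg (listNbrs G VS z) (oneShotColoring G VS τ.1)
        by_cases hz : (Δ : ℝ) + 1 - ε ^ 2 * Δ / 3600 ≤ (listNbrs G VS z).card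
        · push Not at hsave
          have := hsave z (Finset.mem_filter.2 ⟨Finset.mem_univ _, hz⟩)
          have hz' : ((listNbrs G VS z).card : ℝ) ≤ Δ := by
            exact_mod_cast (Finset.card_le_card (listNbrs_subset G VS z)).trans (hG' z)
          linarith
        · linarith
    _ = ENNReal.ofReal (prob bad) := tapeMeasure_truncate T bad
    _ ≤ _ := ENNReal.ofReal_le_ofReal hbad

end Sparse

/-! ### Free colours during Greedy-Coloring -/

section FreeColours

variable {n Δ : ℕ}

theorem coin_of_oneShotColoring_ne_none (G : SimpleGraph (Fin n)) {VS : List (Fin n)}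
    {x : Fin n → Bool × Fin (Δ + 1)} {u : Fin n} (h : oneShotColoring G VS x u ≠ none) :
    (x u).1 = true := by
  have key : ∀ (l : List (Fin n)) (s : Fin n → Option (Fin (Δ + 1))),
      run (oneStep G) x l s u ≠ none → s u ≠ none ∨ (x u).1 = true := by
    intro l
    induction l with
    | nil => exact fun s h => Or.inl h
    | cons v l ih =>
      intro s h
      rw [run_cons] at h
      rcases ih _ h with h1 | h1
      · by_cases huv : u = v
        · subst huv
          by_cases hx : (x u).1 = true
          · exact Or.inr hx
          · rw [oneStep, if_neg hx] at h1
            exact Or.inl h1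
        · rw [oneStep_of_ne G s huv] at h1
          exact Or.inl h1
      · exact Or.inr h1
  exact (key VS _ h).resolve_left fun h => h rfl

open Classical in
theorem card_nbrs_mem_le (G : SimpleGraph (Fin n)) (S : List (Fin n)) (v : Fin n) :
    ((nbrs G v).filter fun u => u ∈ S).card ≤ (nbrPositions G S v).card := by
  refine (Finset.card_le_card (t := (nbrPositions G S v).image S.get) fun u hu => ?_).trans
    Finset.card_image_le
  obtain ⟨h1, h2⟩ := Finset.mem_filter.1 hu
  obtain ⟨i, rfl⟩ := List.mem_iff_get.1 h2
  exact Finset.mem_image.2 ⟨i, by simpa [nbrPositions] using mem_nbrs.1 h1, rfl⟩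

/-- The permutation of the positions of the leftover list. -/
noncomputable def leftoverPerm {G : SimpleGraph (Fin n)} {VS : List (Fin n)} (hVS : VS.Nodup)
    (x : Fin n → Bool × Fin (Δ + 1)) (π : (m : Fin (n + 1)) → Equiv.Perm (Fin m)) :
    Equiv.Perm (Fin (leftover G VS x).length) :=
  π ⟨_, Nat.lt_succ_of_le (length_le_of_nodup (leftover_nodup (G := G) hVS x))⟩

open Classical in
/-- Before `v` is treated, at least `max 1 ⌊j / b⌋` colours are free, where `j` is the number of
vertices after `v`: either `v` has many leftover neighbours, of which `⌊j / b⌋` are still blank, or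
so few that its coloured neighbours are not numerous. -/
theorem le_card_free (G : SimpleGraph (Fin n)) (hG : ∀ v, (nbrs G v).card ≤ Δ)
    {VS : List (Fin n)} (hVS : VS.Nodup) {x : Fin n → Bool × Fin (Δ + 1)}
    {π : (m : Fin (n + 1)) → Equiv.Perm (Fin m)} {b : ℕ} (hb : (n : ℝ) / b ≤ Δ / 8) {v : Fin n}
    (hcoin : (((nbrs G v).filter fun u => (x u).1 = true).card : ℝ) < 3 / 4 * Δ)
    (hblocks : (Δ : ℝ) / 8 ≤ (nbrPositions G (leftover G VS x) v).card →
      BlocksHit G (leftover G VS x) (leftoverPerm hVS x π) b v)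
    {pre post : List (Fin n)} (e : order G hVS x π = pre ++ v :: post)
    (draw : Fin n → ℕ → Fin (Δ + 1)) :
    max 1 (post.length / b) ≤
      (free G (run (greedyStep G) draw pre (oneShotColoring G VS x)) v).card := by
  set s := run (greedyStep G) draw pre (oneShotColoring G VS x) with hs
  have hfree := succ_le_card_free_add G s v
  have hsub : ((nbrs G v).filter fun u => s u ≠ none) ⊆ nbrs G v := Finset.filter_subset _ _
  have h1 := (Finset.card_le_card hsub).trans (hG v)
  refine max_le (by omega) ?_
  have hnd := order_nodup G hVS x π
  have hout : ∀ u, u ∉ pre → s u = oneShotColoring G VS x u := fun u hu =>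
    run_greedyStep_of_not_mem G draw _ hu
  by_cases hd : (Δ : ℝ) / 8 ≤ (nbrPositions G (leftover G VS x) v).card
  · have hlater := (hblocks hd).le_card (leftover_nodup hVS x) e
    have hdisj : ((nbrs G v).filter fun u => s u ≠ none) ⊆
        nbrs G v \ (nbrs G v).filter fun u => u ∈ post := by
      intro u hu
      obtain ⟨hu1, hu2⟩ := Finset.mem_filter.1 hu
      refine Finset.mem_sdiff.2 ⟨hu1, fun hu3 => hu2 ?_⟩
      have hpost := (Finset.mem_filter.1 hu3).2
      rw [hout u fun hpre => ?_]
      · exact (mem_order.1 (e ▸ (by simp [hpost] : u ∈ pre ++ v :: post))).2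
      · rw [e, List.nodup_append] at hnd
        exact hnd.2.2 u hpre u (by simp [hpost]) rfl
    have h2 := Finset.card_le_card hdisj
    rw [Finset.card_sdiff_of_subset (Finset.filter_subset _ _)] at h2
    have h3 := Finset.card_filter_le (nbrs G v) fun u => u ∈ post
    have h4 := hG v
    omega
  · have hcov : ((nbrs G v).filter fun u => s u ≠ none) ⊆
        ((nbrs G v).filter fun u => (x u).1 = true) ∪
          (nbrs G v).filter fun u => u ∈ leftover G VS x := by
      intro u hu
      obtain ⟨hu1, hu2⟩ := Finset.mem_filter.1 hu
      by_cases hpre : u ∈ pre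
      · refine Finset.mem_union_right _ (Finset.mem_filter.2 ⟨hu1, ?_⟩)
        have : u ∈ order G hVS x π := by rw [e]; simp [hpre]
        exact mem_shuffle.1 this
      · rw [hout u hpre] at hu2
        exact Finset.mem_union_left _
          (Finset.mem_filter.2 ⟨hu1, coin_of_oneShotColoring_ne_none G hu2⟩)
    have h2 := (Finset.card_le_card hcov).trans (Finset.card_union_le _ _)
    have h3 := card_nbrs_mem_le G (leftover G VS x) v
    have h4 : (((nbrs G v).filter fun u => s u ≠ none).card : ℝ) ≤
        ((nbrs G v).filter fun u => (x u).1 = true).card +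
          (nbrPositions G (leftover G VS x) v).card := by exact_mod_cast h2.trans (by gcongr)
    have h5 : ((Δ : ℝ) + 1) ≤ (free G s v).card +
        ((nbrs G v).filter fun u => s u ≠ none).card := by exact_mod_cast hfree
    have h6 : ((post.length / b : ℕ) : ℝ) ≤ Δ / 8 := by
      refine le_trans ?_ hb
      refine Nat.cast_div_le.trans ?_
      gcongr
      have : post.length ≤ (order G hVS x π).length := by rw [e]; simp; omega
      exact this.trans (length_le_of_nodup hnd)
    have h7 : ((post.length / b : ℕ) : ℝ) ≤ (free G s v).card := by
      rw [not_le] at hd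
      linarith
    exact_mod_cast h7

end FreeColours

/-! ### Counting rounds -/

section Rounds

variable {n Δ : ℕ}

/-- A number of rounds that suffices with high probability if `max 1 ⌊j / b⌋` colours are free. -/
noncomputable def roundBound (A : ℝ) (b j : ℕ) : ℕ := ⌈A / (max 1 (j / b) : ℕ)⌉₊

/-- The number of rounds granted to `v`, which depends on the number of vertices after `v`. -/
noncomputable def grant (A : ℝ) (b : ℕ) (l : List (Fin n)) (v : Fin n) : ℕ :=
  roundBound A b (l.length - (before l v).length - 1)

theorem roundBound_le {A : ℝ} (hA : 0 ≤ A) (b j : ℕ) : roundBound A b j ≤ ⌈A⌉₊ := by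
  refine Nat.ceil_le_ceil (div_le_self hA ?_)
  exact_mod_cast le_max_left 1 (j / b)

theorem sum_map_before (f : ℕ → ℕ) {l : List (Fin n)} (hl : l.Nodup) :
    (l.map fun v => f (l.length - (before l v).length - 1)).sum =
      ∑ j ∈ Finset.range l.length, f j := by
  induction l with
  | nil => simp
  | cons a l ih =>
    obtain ⟨ha, hl⟩ := List.nodup_cons.1 hl
    rw [List.map_cons, List.sum_cons, List.length_cons, Finset.sum_range_succ, ← ih hl, add_comm]
    congr 1
    · congr 1
      refine List.map_congr_left fun v hv => ?_
      have e : before (a :: l) v = a :: before l v :=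
        List.takeWhile_cons_of_pos (by simpa using (ne_of_mem_of_not_mem hv ha).symm)
      rw [e, List.length_cons]
      congr 1
      omega
    · simp [before]

theorem inv_max_le {b : ℕ} (hb : 0 < b) (j : ℕ) :
    ((max 1 (j / b) : ℕ) : ℝ)⁻¹ ≤ 2 * b * ((j : ℝ) + 1)⁻¹ := by
  have hm : (0 : ℝ) < (max 1 (j / b) : ℕ) := by exact_mod_cast lt_of_lt_of_le one_pos (le_max_left _ _)
  rw [← div_eq_mul_inv, inv_eq_one_div, div_le_div_iff₀ hm (by positivity), one_mul]
  have h : j + 1 ≤ 2 * b * max 1 (j / b) := by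
    have h1 : j < (j / b + 1) * b := by
      rw [mul_comm]
      exact Nat.lt_mul_div_succ j hb
    have h2 : j / b + 1 ≤ 2 * max 1 (j / b) := by omega
    calc j + 1 ≤ (j / b + 1) * b := h1
      _ ≤ 2 * max 1 (j / b) * b := by gcongr
      _ = _ := by ring
  exact_mod_cast h

/-- A harmonic sum: the numbers of rounds add up to `O(A b log n + n)`. -/
theorem sum_roundBound_le {A : ℝ} (hA : 0 ≤ A) {b : ℕ} (hb : 0 < b) (n : ℕ) :
    ((∑ j ∈ Finset.range n, roundBound A b j : ℕ) : ℝ) ≤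
      2 * b * A * (1 + Real.log n) + n := by
  have hharm : ∑ j ∈ Finset.range n, ((j : ℝ) + 1)⁻¹ ≤ 1 + Real.log n := by
    have := harmonic_le_one_add_log n
    simpa [harmonic] using this
  push_cast
  calc _ ≤ ∑ j ∈ Finset.range n, (A * (2 * b * ((j : ℝ) + 1)⁻¹) + 1) := by
        refine Finset.sum_le_sum fun j _ => ?_
        have h1 := (Nat.ceil_lt_add_one (show 0 ≤ A / (max 1 (j / b) : ℕ) by positivity)).le
        refine h1.trans ?_
        rw [div_eq_mul_inv]
        gcongr
        exact inv_max_le hb j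
    _ = 2 * b * A * (∑ j ∈ Finset.range n, ((j : ℝ) + 1)⁻¹) + n := by
        rw [Finset.sum_add_distrib, Finset.mul_sum]
        simp only [Finset.sum_const, Finset.card_range, nsmul_eq_mul, mul_one]
        congr 1
        exact Finset.sum_congr rfl fun j _ => by ring
    _ ≤ _ := by gcongr

theorem sum_grant_le {A : ℝ} (hA : 0 ≤ A) {b : ℕ} (hb : 0 < b) {l : List (Fin n)} (hl : l.Nodup) :
    ((l.map (grant A b l)).sum : ℝ) ≤ 2 * b * A * (1 + Real.log n) + n := by
  have h1 : (l.map (grant A b l)).sum ≤ ∑ j ∈ Finset.range n, roundBound A b j := by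
    rw [show (l.map (grant A b l)).sum = _ from sum_map_before (roundBound A b) hl]
    exact Finset.sum_le_sum_of_subset (Finset.range_subset_range.2 (length_le_of_nodup hl))
  exact (by exact_mod_cast h1 : ((l.map (grant A b l)).sum : ℝ) ≤ _).trans
    (sum_roundBound_le hA hb n)

open Classical in
theorem sum_map_countP_eq {T : ℕ} {t : Fin n → ℕ} (ht : ∀ v, t v ≤ T) {l : List (Fin n)}
    (hl : l.Nodup) (q : Fin n → ℕ → Prop) [∀ v, DecidablePred (q v)] :
    (l.map fun v => (List.range (t v)).countP fun j => q v j).sum =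
      Finset.card {p : Fin n × Fin T | (p.1 ∈ l ∧ (p.2 : ℕ) < t p.1) ∧ q p.1 p.2} := by
  rw [← List.sum_toFinset _ hl, Finset.card_filter, Fintype.sum_prod_type,
    ← Finset.sum_filter_add_sum_filter_not Finset.univ fun v => v ∈ l]
  have h0 : ∑ v ∈ Finset.univ.filter (fun v => ¬ v ∈ l), ∑ j : Fin T,
      (if (v ∈ l ∧ (j : ℕ) < t v) ∧ q v j then 1 else 0) = 0 :=
    Finset.sum_eq_zero fun v hv => Finset.sum_eq_zero fun j _ =>
      if_neg fun h => (Finset.mem_filter.1 hv).2 h.1.1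
  rw [h0, add_zero]
  refine Finset.sum_congr (by ext; simp) fun v hv => ?_
  have hv' : v ∈ l := (Finset.mem_filter.1 hv).2
  simp only [hv', true_and]
  rw [Fin.sum_univ_eq_sum_range (fun j => if j < t v ∧ q v j then 1 else 0) T,
    ← Finset.card_filter, List.countP_eq_length_filter,
    ← List.toFinset_card_of_nodup (List.nodup_range.filter _)]
  congr 1
  ext j
  simp only [List.mem_toFinset, List.mem_filter, List.mem_range, decide_eq_true_eq,
    Finset.mem_filter, Finset.mem_range]
  exact ⟨fun h => ⟨h.1.trans_le (ht v), h⟩, fun h => h.2⟩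

end Rounds

/-! ### Running time and list lengths -/

section Time

variable {n Δ : ℕ}

theorem prob_perm_apply (m : Fin (n + 1)) (p : Equiv.Perm (Fin m) → Prop) :
    prob (fun π : (m : Fin (n + 1)) → Equiv.Perm (Fin m) => p (π m)) = prob p :=
  (prob_comp_equiv (Equiv.piSplitAt m fun m : Fin (n + 1) => Equiv.Perm (Fin m))
    fun y => p y.1).trans (prob_fst_eq p)

open Classical in
/-- Of at most `Δ` coins, `3 Δ / 4` rarely show `true`, so that One-Shot-Coloring
rarely colours that many neighbours of a vertex. -/
theorem prob_many_coins_le (G : SimpleGraph (Fin n)) (hG : ∀ v, (nbrs G v).card ≤ Δ) (v : Fin n) :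
    prob (fun x : Fin n → Bool × Fin (Δ + 1) =>
      3 / 4 * (Δ : ℝ) ≤ ((nbrs G v).filter fun u => (x u).1 = true).card) ≤
      Real.exp (-((Δ : ℝ) / 40)) := by
  have h := prob_card_ge_le (nbrs G v)
    (fun _ => (Finset.univ.filter fun y : Bool × Fin (Δ + 1) => y.1 = true))
    (p := 1 / 2) (lam := 1 / 2) (a := 3 / 4 * (Δ : ℝ)) (by norm_num) fun i _ => by
      have e : (Finset.univ.filter fun y : Bool × Fin (Δ + 1) => y.1 = true) =
          {true} ×ˢ Finset.univ := by
        ext y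
        simp only [Finset.mem_filter, Finset.mem_univ, true_and, Finset.mem_product,
          Finset.mem_singleton, and_true]
      rw [e, Finset.card_product]
      simp
  refine (prob_mono fun x hx => ?_).trans (h.trans (Real.exp_le_exp.2 ?_))
  · simpa using hx
  · have h1 : Real.exp (1 / 2) ≤ 1.65 := by
      refine le_of_pow_le_pow_left₀ (n := 2) (by norm_num) (by norm_num) ?_
      rw [← Real.exp_nat_mul]
      norm_num
      linarith [Real.exp_one_lt_d9]
    have h2 : ((nbrs G v).card : ℝ) ≤ Δ := by exact_mod_cast hG v
    have h3 : ((nbrs G v).card : ℝ) * (1 / 2 * (Real.exp (1 / 2) - 1)) ≤ Δ * (1 / 2 * 0.65) := by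
      have : 0 ≤ Real.exp (1 / 2) - 1 := by linarith [Real.add_one_le_exp (1 / 2 : ℝ)]
      gcongr
      linarith
    have h4 : (0 : ℝ) ≤ Δ := Nat.cast_nonneg _
    linarith

/-- Of at most `K` uniformly random colours, hardly more than `2 K / (Δ + 1)` are equal to `c`. -/
theorem prob_color_count_le {ι : Type*} [Fintype ι] [DecidableEq ι] (J : Finset ι)
    (c : Fin (Δ + 1)) {K R : ℝ} (hK : (J.card : ℝ) ≤ K) :
    prob (fun x : ι → Fin (Δ + 1) =>
      2 * K / ((Δ : ℝ) + 1) + R ≤ (Finset.card {i ∈ J | x i = c} : ℕ)) ≤ Real.exp (-R) := by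
  classical
  have hΔ : (0 : ℝ) < (Δ : ℝ) + 1 := by positivity
  have h := prob_card_ge_le J (fun _ => ({c} : Finset (Fin (Δ + 1)))) (p := 1 / ((Δ : ℝ) + 1))
    (lam := 1) (a := 2 * K / ((Δ : ℝ) + 1) + R) zero_le_one fun i _ => by
      rw [Finset.card_singleton, Fintype.card_fin]
      push_cast
      field_simp
      rfl
  refine (prob_mono fun x hx => ?_).trans (h.trans (Real.exp_le_exp.2 ?_))
  · convert hx using 4
    simp
  · have h1 : Real.exp 1 - 1 ≤ 2 := by linarith [Real.exp_one_lt_d9]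
    have h2 : (J.card : ℝ) * (1 / ((Δ : ℝ) + 1) * (Real.exp 1 - 1)) ≤
        K * (1 / ((Δ : ℝ) + 1) * 2) := by
      have h0 : (0 : ℝ) ≤ J.card := Nat.cast_nonneg _
      have : 0 ≤ Real.exp 1 - 1 := by linarith [Real.add_one_le_exp (1 : ℝ)]
      gcongr
      linarith
    have h3 : K * (1 / ((Δ : ℝ) + 1) * 2) = 2 * K / ((Δ : ℝ) + 1) := by ring
    linarith

theorem prob_many_samples_le (VS : List (Fin n)) (hVS : VS.Nodup) (c : Fin (Δ + 1)) (R : ℝ) :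
    prob (fun x : Fin n → Bool × Fin (Δ + 1) =>
      2 * (n : ℝ) / ((Δ : ℝ) + 1) + R ≤ VS.countP fun v => (x v).2 = c) ≤ Real.exp (-R) := by
  classical
  rw [← prob_comp_equiv (Equiv.arrowProdEquivProdArrow (Fin n) (fun _ => Bool) fun _ => Fin (Δ + 1)).symm]
  refine (prob_mono fun y hy => ?_).trans ((prob_snd_eq (Ω := Fin n → Bool)
    fun x : Fin n → Fin (Δ + 1) => 2 * (n : ℝ) / ((Δ : ℝ) + 1) + R ≤
      (Finset.card {i ∈ Finset.univ | x i = c} : ℕ)).trans_le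
    (prob_color_count_le Finset.univ c (by simp)))
  refine le_trans hy ?_
  rw [List.countP_eq_length_filter, ← List.toFinset_card_of_nodup (hVS.filter _)]
  exact_mod_cast Finset.card_le_card fun v hv => by
    simpa using (List.mem_filter.1 (List.mem_toFinset.1 hv)).2

/-- The colours drawn in the while loops are evenly distributed. All draws of the first `t v` rounds are
counted, whether they are reached or not: the numbers `t v` are fixed before the draws, hence the
draws counted are independent. -/
theorem prob_many_draws_le {T : ℕ} {t : Fin n → ℕ} (ht : ∀ v, t v ≤ T) {l : List (Fin n)}
    (hl : l.Nodup) (c : Fin (Δ + 1)) {K : ℝ} (hK : ((l.map t).sum : ℝ) ≤ K) (R : ℝ) :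
    prob (fun dr : Fin n → Fin T → Fin (Δ + 1) => 2 * K / ((Δ : ℝ) + 1) + R ≤
      ((l.map fun v => (List.range (t v)).countP fun j => extend dr v j = c).sum : ℕ)) ≤
      Real.exp (-R) := by
  classical
  set J : Finset (Fin n × Fin T) := {p | p.1 ∈ l ∧ (p.2 : ℕ) < t p.1} with hJ
  have hcard : (J.card : ℝ) ≤ K := by
    have h := sum_map_countP_eq ht hl fun _ _ => True
    simp only [and_true, decide_true, List.countP_true, List.length_range] at h
    rw [hJ, ← h]
    exact hK
  rw [← prob_comp_equiv (Equiv.curry (Fin n) (Fin T) (Fin (Δ + 1)))]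
  refine (prob_mono fun x hx => ?_).trans (prob_color_count_le J c hcard)
  refine le_trans hx ?_
  rw [sum_map_countP_eq ht hl, hJ, Finset.filter_filter]
  refine le_of_eq ?_
  congr 2
  ext p
  simp [extend, Equiv.curry]

/-- The random choices before the draws are favourable: no vertex has too many neighbours with coin
`true`, and every vertex with many leftover neighbours meets one of them in each block. -/
def Favourable (G : SimpleGraph (Fin n)) {VS : List (Fin n)} (hVS : VS.Nodup) (b : ℕ)
    (x : Fin n → Bool × Fin (Δ + 1)) (π : (m : Fin (n + 1)) → Equiv.Perm (Fin m)) : Prop :=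
  open Classical in
  ∀ v, ¬ 3 / 4 * (Δ : ℝ) ≤ ((nbrs G v).filter fun u => (x u).1 = true).card ∧
    ¬ ((Δ : ℝ) / 8 ≤ (nbrPositions G (leftover G VS x) v).card ∧
      ¬ BlocksHit G (leftover G VS x) (leftoverPerm hVS x π) b v)

theorem prob_not_favourable_le (G : SimpleGraph (Fin n)) (hG : ∀ v, (nbrs G v).card ≤ Δ)
    {VS : List (Fin n)} (hVS : VS.Nodup) {b : ℕ} (hb : 0 < b) {e : ℝ}
    (h1 : Real.exp (-((Δ : ℝ) / 40)) ≤ e) (h2 : Real.exp (-((Δ : ℝ) / 8 * b / n)) ≤ e) (T : ℕ) :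
    prob (fun τ : FiniteTape n Δ T => ¬ Favourable G hVS b τ.1 τ.2.1) ≤ n * e + n * (n * e) := by
  classical
  have hcoin := prob_exists_le_card_mul (Finset.univ : Finset (Fin n))
    (fun v (τ : FiniteTape n Δ T) =>
      3 / 4 * (Δ : ℝ) ≤ ((nbrs G v).filter fun u => (τ.1 u).1 = true).card) (q := e)
    fun v _ => (prob_fst_eq fun x : Fin n → Bool × Fin (Δ + 1) =>
      3 / 4 * (Δ : ℝ) ≤ ((nbrs G v).filter fun u => (x u).1 = true).card).trans_le
        ((prob_many_coins_le G hG v).trans h1)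
  have he : 0 ≤ e := (Real.exp_nonneg _).trans h1
  have hblock : ∀ v (x : Fin n → Bool × Fin (Δ + 1)),
      prob (fun π : (m : Fin (n + 1)) → Equiv.Perm (Fin m) =>
        (Δ : ℝ) / 8 ≤ (nbrPositions G (leftover G VS x) v).card ∧
          ¬ BlocksHit G (leftover G VS x) (leftoverPerm hVS x π) b v) ≤ n * e := by
    intro v x
    by_cases hd : (Δ : ℝ) / 8 ≤ (nbrPositions G (leftover G VS x) v).card
    · refine (prob_mono fun π hπ => hπ.2).trans ?_
      refine (prob_perm_apply ⟨_, Nat.lt_succ_of_le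
        (length_le_of_nodup (leftover_nodup (G := G) hVS x))⟩ fun π =>
          ¬ BlocksHit G (leftover G VS x) π b v).trans_le ?_
      refine (prob_not_blocksHit_le G (leftover_nodup hVS x) hb v).trans ?_
      refine mul_le_mul_of_nonneg_left (le_trans (Real.exp_le_exp.2 ?_) h2) (Nat.cast_nonneg _)
      rw [neg_le_neg_iff]
      gcongr
    · refine (prob_mono (q := fun _ => False) fun π hπ => hd hπ.1).trans ?_
      have : (0 : ℝ) ≤ n * e := by positivity
      simpa [prob] using this
  have hblocks := prob_exists_le_card_mul (Finset.univ : Finset (Fin n))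
    (fun v (τ : FiniteTape n Δ T) =>
      (Δ : ℝ) / 8 ≤ (nbrPositions G (leftover G VS τ.1) v).card ∧
        ¬ BlocksHit G (leftover G VS τ.1) (leftoverPerm hVS τ.1 τ.2.1) b v) (q := n * e)
    fun v _ => prob_prod_le fun x => (prob_fst_eq fun π : (m : Fin (n + 1)) → Equiv.Perm (Fin m) =>
      (Δ : ℝ) / 8 ≤ (nbrPositions G (leftover G VS x) v).card ∧
        ¬ BlocksHit G (leftover G VS x) (leftoverPerm hVS x π) b v).trans_le (hblock v x)
  rw [Finset.card_univ, Fintype.card_fin] at hcoin hblocks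
  refine (prob_mono fun τ hτ => ?_).trans ((prob_or_le _ _).trans (add_le_add hcoin hblocks))
  by_contra hcon
  obtain ⟨c1, c2⟩ := not_or.1 hcon
  push Not at c1 c2
  refine hτ fun v => ⟨not_le.2 (c1 v (Finset.mem_univ v)), fun h => ?_⟩
  exact h.2 (c2 v (Finset.mem_univ v) h.1)

/-- The probability that some while loop exceeds its granted number of rounds although the choices
before the draws are favourable. -/
theorem prob_favourable_not_succeeds_le (G : SimpleGraph (Fin n))
    (hG : ∀ v, (nbrs G v).card ≤ Δ) {VS : List (Fin n)} (hVS : VS.Nodup) {b T : ℕ}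
    (hb : (n : ℝ) / b ≤ Δ / 8) {R : ℝ} (hR : 0 ≤ R) (hT : ⌈R * ((Δ : ℝ) + 1)⌉₊ ≤ T) :
    prob (fun τ : FiniteTape n Δ T => Favourable G hVS b τ.1 τ.2.1 ∧
      ¬ Succeeds G (grant (R * ((Δ : ℝ) + 1)) b (order G hVS τ.1 τ.2.1)) (extend τ.2.2)
        (order G hVS τ.1 τ.2.1) (oneShotColoring G VS τ.1)) ≤ n * Real.exp (-R) := by
  classical
  have hΔ : (0 : ℝ) < (Δ : ℝ) + 1 := by positivity
  have key : ∀ x π, prob (fun dr : Fin n → Fin T → Fin (Δ + 1) => Favourable G hVS b x π ∧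
      ¬ Succeeds G (grant (R * ((Δ : ℝ) + 1)) b (order G hVS x π)) (extend dr)
        (order G hVS x π) (oneShotColoring G VS x)) ≤ n * Real.exp (-R) := by
    intro x π
    by_cases hfav : Favourable G hVS b x π
    · refine (prob_mono fun dr h => h.2).trans ?_
      set l := order G hVS x π with hl
      have hnd : l.Nodup := order_nodup G hVS x π
      refine prob_greedy_fails_le G
        (fun v => (roundBound_le (by positivity) b _).trans hT) hnd _
        (fun v => ((max 1 ((l.length - (before l v).length - 1) / b) : ℕ) : ℝ))
        (Real.exp_nonneg _) (fun v _ => ?_) fun dr pre v post e => ?_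
      · refine Real.exp_le_exp.2 ?_
        rw [neg_le_neg_iff, le_div_iff₀ hΔ]
        have hm : (0 : ℝ) < (max 1 ((l.length - (before l v).length - 1) / b) : ℕ) := by
          exact_mod_cast lt_of_lt_of_le one_pos (le_max_left _ _)
        rw [← div_le_iff₀' hm]
        exact Nat.le_ceil _
      · have hlen : l.length - (before l v).length - 1 = post.length := by
          rw [before_eq hnd e, e, List.length_append, List.length_cons]
          omega
        rw [hlen]
        exact_mod_cast le_card_free G hG hVS hb (not_le.1 (hfav v).1)
          (fun h => not_not.1 fun h' => (hfav v).2 ⟨h, h'⟩) e (extend dr)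
    · refine (prob_mono (q := fun _ => False) fun dr h => hfav h.1).trans ?_
      have : (0 : ℝ) ≤ n * Real.exp (-R) := by positivity
      simpa [prob] using this
  exact prob_prod_le fun x => prob_prod_le fun π => key x π

end Time

section TimeBound

variable {n Δ : ℕ}

/-- The case of a degree of order `log n`: every while loop may last `O(Δ log n)` rounds and every
list may have `n` entries. -/
theorem tapeMeasure_slow_le_of_small {G : SimpleGraph (Fin n)} {VS : List (Fin n)} {D R : ℝ}
    (hΔ : 0 < Δ) (hΔn : Δ < n) (hG : ∀ v, (nbrs G v).card ≤ Δ) (hVS : VS.Nodup)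
    (hlog : 1 ≤ Real.log n) (hD : 5 ≤ D) (hR : R = D * Real.log n) (hsmall : (Δ : ℝ) ≤ 40 * R) :
    tapeMeasure n Δ {ω | ∃ s, colorSparse G VS ω = some s ∧
        (s.time : ℝ) ≤ 60000 * D ^ 4 * Real.log n ^ 6 * ((n : ℝ) ^ 2 / Δ) ∧
        ∀ c, ((s.L c).length : ℝ) ≤ 60000 * D ^ 4 * Real.log n ^ 6 * ((n : ℝ) / Δ)}ᶜ ≤
      ENNReal.ofReal (n * Real.exp (-R)) := by
  have hΔ' : (1 : ℝ) ≤ Δ := by exact_mod_cast hΔ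
  have hn' : (Δ : ℝ) ≤ n := by exact_mod_cast hΔn.le
  set L := Real.log n with hL
  have hR5 : 5 ≤ R := by rw [hR]; nlinarith
  set T := ⌈R * ((Δ : ℝ) + 1)⌉₊ with hT
  have hT1 : R * ((Δ : ℝ) + 1) ≤ T := Nat.le_ceil _
  have hT2 : (T : ℝ) ≤ 3 * R * Δ := by
    have := (Nat.ceil_lt_add_one (show 0 ≤ R * ((Δ : ℝ) + 1) by positivity)).le
    nlinarith
  have hD3 : D ^ 3 ≤ D ^ 4 := pow_le_pow_right₀ (by linarith) (by norm_num)
  have hL3 : L ^ 3 ≤ L ^ 6 := pow_le_pow_right₀ hlog (by norm_num)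
  have hR3 : R ^ 3 ≤ D ^ 4 * L ^ 6 := by
    rw [hR, mul_pow]
    gcongr
  have hR1 : R ≤ R ^ 3 := le_self_pow₀ (by linarith) (by norm_num)
  calc _ ≤ tapeMeasure n Δ {ω | ¬ Succeeds G (fun _ => T) (extend (truncate T ω).2.2)
          (order G hVS (truncate T ω).1 (truncate T ω).2.1)
          (oneShotColoring G VS (truncate T ω).1)} := measure_mono fun ω hω hgood => by
        refine hω ?_
        obtain ⟨s, e, -, hlen, htime⟩ := colorSparse_of_succeeds hVS hΔn (fun _ => le_rfl) rfl
          hgood (N := n) (fun c => List.countP_le_length.trans (length_le_of_nodup hVS))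
          fun s' hs' _ c => hs'.length_le c
        refine ⟨s, e, ?_, fun c => ?_⟩
        · have h1 : ((order G hVS (truncate T ω).1 (truncate T ω).2.1).map fun _ => T).sum ≤
              n * T := by
            rw [List.map_const', List.sum_replicate, smul_eq_mul]
            gcongr
            exact length_le_of_nodup (order_nodup G hVS _ _)
          have h2 : s.time ≤ n * (n + 13) + n * T * (n + 5) :=
            htime.trans (by gcongr)
          have h3 : (s.time : ℝ) ≤ n * (n + 13) + n * T * (n + 5) := by exact_mod_cast h2
          have hn1 : (1 : ℝ) ≤ n := hΔ'.trans hn'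
          have h4 : (n : ℝ) * (n + 13) + n * T * (n + 5) ≤ 32 * R * Δ * n ^ 2 := by
            have h5 : (n : ℝ) * (n + 13) ≤ 14 * n ^ 2 := by nlinarith
            have h6 : (n : ℝ) * T * (n + 5) ≤ n * (3 * R * Δ) * (6 * n) := by
              gcongr
              linarith
            have h7 : (1 : ℝ) ≤ R * Δ := by nlinarith
            have h8 : (14 : ℝ) * n ^ 2 ≤ 14 * n ^ 2 * (R * Δ) :=
              le_mul_of_one_le_right (by positivity) h7
            linarith
          calc (s.time : ℝ) ≤ 32 * R * Δ * n ^ 2 := h3.trans h4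
            _ = 32 * R * Δ ^ 2 * (n ^ 2 / Δ) := by field_simp
            _ ≤ 32 * R * (40 * R) ^ 2 * (n ^ 2 / Δ) := by gcongr
            _ = 51200 * R ^ 3 * (n ^ 2 / Δ) := by ring
            _ ≤ 60000 * (D ^ 4 * L ^ 6) * (n ^ 2 / Δ) := by gcongr; norm_num
            _ = _ := by ring
        · calc ((s.L c).length : ℝ) ≤ n := by exact_mod_cast hlen c
            _ = Δ * ((n : ℝ) / Δ) := by field_simp
            _ ≤ 40 * R * ((n : ℝ) / Δ) := by gcongr
            _ ≤ 60000 * (D ^ 4 * L ^ 6) * ((n : ℝ) / Δ) := by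
              gcongr
              · norm_num
              · exact hR1.trans hR3
            _ = _ := by ring
    _ = ENNReal.ofReal (prob fun τ : FiniteTape n Δ T => ¬ Succeeds G (fun _ => T)
          (extend τ.2.2) (order G hVS τ.1 τ.2.1) (oneShotColoring G VS τ.1)) :=
        tapeMeasure_truncate T fun τ => ¬ Succeeds G (fun _ => T) (extend τ.2.2)
          (order G hVS τ.1 τ.2.1) (oneShotColoring G VS τ.1)
    _ ≤ _ := by
        refine ENNReal.ofReal_le_ofReal ((prob_not_succeeds_le G hG hVS T).trans ?_)
        gcongr
        rwa [le_div_iff₀ (by positivity)]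

/-- The case of a degree much larger than `log n`: the while loops last `O(n log³ n)` rounds
altogether, and the colours of their draws are evenly distributed. -/
theorem tapeMeasure_slow_le_of_large {G : SimpleGraph (Fin n)} {VS : List (Fin n)} {D R : ℝ}
    (hΔ : 0 < Δ) (hΔn : Δ < n) (hG : ∀ v, (nbrs G v).card ≤ Δ) (hVS : VS.Nodup)
    (hlog : 1 ≤ Real.log n) (hD : 5 ≤ D) (hR : R = D * Real.log n) (hlarge : 40 * R ≤ Δ) :
    tapeMeasure n Δ {ω | ∃ s, colorSparse G VS ω = some s ∧
        (s.time : ℝ) ≤ 60000 * D ^ 4 * Real.log n ^ 6 * ((n : ℝ) ^ 2 / Δ) ∧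
        ∀ c, ((s.L c).length : ℝ) ≤ 60000 * D ^ 4 * Real.log n ^ 6 * ((n : ℝ) / Δ)}ᶜ ≤
      ENNReal.ofReal (5 * n ^ 2 * Real.exp (-R)) := by
  classical
  have hΔ' : (1 : ℝ) ≤ Δ := by exact_mod_cast hΔ
  have hn' : (Δ : ℝ) ≤ n := by exact_mod_cast hΔn.le
  have hn1 : (1 : ℝ) ≤ n := hΔ'.trans hn'
  have hn0 : (0 : ℝ) < n := by linarith
  set L := Real.log n with hL
  have hR5 : 5 ≤ R := by rw [hR]; nlinarith
  set P : ℝ := (n : ℝ) / Δ with hP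
  have hP1 : 1 ≤ P := by rw [hP, one_le_div (by linarith)]; exact hn'
  have hPΔ : P * Δ = n := by rw [hP]; field_simp
  -- blocks so long that each of them meets the neighbourhoods with high probability
  set b := ⌈8 * R * P⌉₊ with hb
  have hb1 : 8 * R * P ≤ b := Nat.le_ceil _
  have hb2 : (b : ℝ) ≤ 9 * R * P := by
    have := (Nat.ceil_lt_add_one (show 0 ≤ 8 * R * P by positivity)).le
    nlinarith
  have hb0 : 0 < b := by
    have : (0 : ℝ) < b := lt_of_lt_of_le (by positivity) hb1
    exact_mod_cast this
  have hbΔ : R * n ≤ Δ / 8 * b := by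
    rw [← hPΔ]
    nlinarith
  have hnb : (n : ℝ) / b ≤ Δ / 8 := by
    rw [div_le_iff₀ (by exact_mod_cast hb0)]
    nlinarith
  -- `A / f` rounds suffice at a vertex with `f` free colours, except with probability `exp (-R)`
  set A := R * ((Δ : ℝ) + 1) with hA
  have hA0 : 0 ≤ A := by positivity
  set T := ⌈A⌉₊ with hT
  -- up to constants, `X * n` bounds the total number of rounds
  set X := D ^ 2 * L ^ 3 with hX
  have hXR : 5 * R ≤ X := by
    have h1 : D * L ≤ D * L ^ 3 := by
      gcongr
      exact le_self_pow₀ hlog (by norm_num)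
    have h2 : 5 * (D * L ^ 3) ≤ D * (D * L ^ 3) := by gcongr
    calc 5 * R ≤ 5 * (D * L ^ 3) := by rw [hR]; gcongr
      _ ≤ D * (D * L ^ 3) := h2
      _ = X := by rw [hX]; ring
  have hX25 : 25 ≤ X := by linarith
  set K : ℝ := 2 * b * A * (1 + L) + n with hK
  have hKX : K ≤ 73 * X * n := by
    have h1 : 2 * b * A * (1 + L) ≤ 2 * (9 * R * P) * (R * (2 * Δ)) * (2 * L) := by
      rw [hA]
      gcongr <;> linarith
    have h2 : 2 * (9 * R * P) * (R * (2 * Δ)) * (2 * L) = 72 * X * n := by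
      rw [← hPΔ, hX, hR]; ring
    have h3 : (n : ℝ) ≤ X * n := le_mul_of_one_le_left hn0.le (by linarith)
    linarith
  let bad : FiniteTape n Δ T → Prop := fun τ =>
    (¬ Favourable G hVS b τ.1 τ.2.1 ∨ (Favourable G hVS b τ.1 τ.2.1 ∧
      ¬ Succeeds G (grant A b (order G hVS τ.1 τ.2.1)) (extend τ.2.2)
        (order G hVS τ.1 τ.2.1) (oneShotColoring G VS τ.1))) ∨
    ((∃ c ∈ (Finset.univ : Finset (Fin (Δ + 1))), 2 * (n : ℝ) / ((Δ : ℝ) + 1) + R ≤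
      VS.countP fun v => (τ.1 v).2 = c) ∨
    ∃ c ∈ (Finset.univ : Finset (Fin (Δ + 1))), 2 * K / ((Δ : ℝ) + 1) + R ≤
      (((order G hVS τ.1 τ.2.1).map fun v => (List.range
        (grant A b (order G hVS τ.1 τ.2.1) v)).countP fun j => extend τ.2.2 v j = c).sum : ℕ))
  have hbad : prob bad ≤ 5 * n ^ 2 * Real.exp (-R) := by
    set e := Real.exp (-R) with he
    have he0 : 0 ≤ e := Real.exp_nonneg _
    have p1 := prob_not_favourable_le G hG hVS hb0 (e := e) (Real.exp_le_exp.2 (by linarith))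
      (Real.exp_le_exp.2 (by
        rw [neg_le_neg_iff, le_div_iff₀ hn0]
        exact hbΔ)) T
    have p2 := prob_favourable_not_succeeds_le G hG hVS (T := T) hnb (by linarith : 0 ≤ R) le_rfl
    have p3 := prob_exists_le_card_mul (Finset.univ : Finset (Fin (Δ + 1)))
      (fun c (τ : FiniteTape n Δ T) => 2 * (n : ℝ) / ((Δ : ℝ) + 1) + R ≤
        VS.countP fun v => (τ.1 v).2 = c) (q := e)
      fun c _ => (prob_fst_eq fun x : Fin n → Bool × Fin (Δ + 1) =>
        2 * (n : ℝ) / ((Δ : ℝ) + 1) + R ≤ VS.countP fun v => (x v).2 = c).trans_le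
          (prob_many_samples_le VS hVS c R)
    have key : ∀ (c : Fin (Δ + 1)) (x : Fin n → Bool × Fin (Δ + 1))
        (π : (m : Fin (n + 1)) → Equiv.Perm (Fin m)), prob (fun dr : Fin n → Fin T → Fin (Δ + 1) =>
        2 * K / ((Δ : ℝ) + 1) + R ≤ (((order G hVS x π).map fun v => (List.range
          (grant A b (order G hVS x π) v)).countP fun j => extend dr v j = c).sum : ℕ)) ≤ e :=
      fun c x π => prob_many_draws_le (fun v => roundBound_le hA0 b _) (order_nodup G hVS x π) c
        (sum_grant_le hA0 hb0 (order_nodup G hVS x π)) R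
    have p4 := prob_exists_le_card_mul (Finset.univ : Finset (Fin (Δ + 1)))
      (fun c (τ : FiniteTape n Δ T) => 2 * K / ((Δ : ℝ) + 1) + R ≤
        (((order G hVS τ.1 τ.2.1).map fun v => (List.range
          (grant A b (order G hVS τ.1 τ.2.1) v)).countP fun j => extend τ.2.2 v j = c).sum : ℕ))
      (q := e) fun c _ => prob_prod_le fun x => prob_prod_le fun π => key c x π
    have hcard : (((Finset.univ : Finset (Fin (Δ + 1))).card : ℕ) : ℝ) ≤ n := by
      rw [Finset.card_univ, Fintype.card_fin]
      exact_mod_cast hΔn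
    have hce : (((Finset.univ : Finset (Fin (Δ + 1))).card : ℕ) : ℝ) * e ≤ n * e := by gcongr
    have hne : n * e ≤ n ^ 2 * e := by
      gcongr
      exact le_self_pow₀ hn1 (by norm_num)
    refine (prob_or_le _ _).trans ?_
    have q1 := (prob_or_le _ _).trans (add_le_add p1 p2)
    have q2 := (prob_or_le _ _).trans (add_le_add p3 p4)
    refine (add_le_add q1 q2).trans ?_
    have : (n : ℝ) * (n * e) = n ^ 2 * e := by ring
    linarith
  calc _ ≤ tapeMeasure n Δ {ω | bad (truncate T ω)} := measure_mono fun ω hω => by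
        by_contra hgood
        set τ := truncate T ω with hτ
        obtain ⟨hgood, hcount⟩ := not_or.1 hgood
        obtain ⟨hfav, hsucc⟩ := not_or.1 hgood
        rw [not_not] at hfav
        have hsucc := not_not.1 fun h => hsucc ⟨hfav, h⟩
        obtain ⟨hc1, hc2⟩ := not_or.1 hcount
        push Not at hc1 hc2
        set l := order G hVS τ.1 τ.2.1 with hl
        have hdiv1 : 2 * (n : ℝ) / ((Δ : ℝ) + 1) ≤ 2 * P := by
          rw [div_le_iff₀ (by positivity), ← hPΔ]
          nlinarith
        have hdiv2 : 2 * K / ((Δ : ℝ) + 1) ≤ 146 * X * P := by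
          rw [div_le_iff₀ (by positivity)]
          have : 146 * X * P * Δ = 2 * (73 * X * n) := by rw [← hPΔ]; ring
          have : 0 ≤ 146 * X * P := by positivity
          linarith
        have hXP : X ≤ X * P := le_mul_of_one_le_right (by linarith) hP1
        have h2P : 25 * P ≤ X * P := by gcongr
        -- the bound for the list lengths
        set N := ⌊150 * X * P⌋₊ with hN
        have hNle : (N : ℝ) ≤ 150 * X * P := Nat.floor_le (by positivity)
        obtain ⟨s, e, -, hlen, htime⟩ := colorSparse_of_succeeds hVS hΔn (N := N)
          (fun v => roundBound_le hA0 b _) hτ hsucc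
          (fun c => Nat.le_floor (by
            have := hc1 c (Finset.mem_univ c)
            linarith))
          (fun s' _ h c => Nat.le_floor (by
            have h1 := hc1 c (Finset.mem_univ c)
            have h2 := hc2 c (Finset.mem_univ c)
            have h3 : ((s'.L c).length : ℝ) ≤ (VS.countP fun v => (τ.1 v).2 = c) +
                ((l.map fun v => (List.range (grant A b l v)).countP fun j =>
                  extend τ.2.2 v j = c).sum : ℕ) := by exact_mod_cast h c
            linarith))
        refine hω ⟨s, e, ?_, fun c => ?_⟩
        · have h1 : (s.time : ℝ) ≤ n * (N + 13) + (l.map (grant A b l)).sum * (N + 5) := by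
            exact_mod_cast htime
          have h2 : ((l.map (grant A b l)).sum : ℝ) ≤ 73 * X * n :=
            (sum_grant_le hA0 hb0 (order_nodup G hVS τ.1 τ.2.1)).trans hKX
          have h3 : (N : ℝ) + 13 ≤ 151 * X * P := by linarith
          calc (s.time : ℝ) ≤ n * (151 * X * P) + 73 * X * n * (151 * X * P) := by
                refine h1.trans ?_
                gcongr
                linarith
            _ = (1 + 73 * X) * (151 * X * (n * P)) := by ring
            _ ≤ (74 * X) * (151 * X * (n * P)) := by
                gcongr
                linarith
            _ = 11174 * X ^ 2 * (n * P) := by ring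
            _ ≤ 60000 * X ^ 2 * (n * P) := by gcongr; norm_num
            _ = _ := by rw [hX, hP]; ring
        · calc ((s.L c).length : ℝ) ≤ N := by exact_mod_cast hlen c
            _ ≤ 150 * X * P := hNle
            _ ≤ 60000 * X ^ 2 * P := by
                gcongr
                · norm_num
                · exact le_self_pow₀ (by linarith) (by norm_num)
            _ = _ := by rw [hX]; ring
    _ = ENNReal.ofReal (prob bad) := tapeMeasure_truncate T bad
    _ ≤ _ := ENNReal.ofReal_le_ofReal hbad

/-- Outside an event of probability at most `n ^ (-d)`, Color-Sparse terminates, its running time is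
`O(n² / Δ)` and its list lengths are `O(n / Δ)`, up to powers of `log n`. -/
theorem tapeMeasure_slow_le {G : SimpleGraph (Fin n)} {VS : List (Fin n)} (d : ℕ)
    (hΔ : 0 < Δ) (hΔn : Δ < n) (hG : ∀ v, (G.neighborSet v).ncard ≤ Δ) (hVS : VS.Nodup)
    (hlog : 1 ≤ Real.log n) :
    tapeMeasure n Δ {ω | ∃ s, colorSparse G VS ω = some s ∧
        (s.time : ℝ) ≤ 60000 * ((d : ℝ) + 5) ^ 4 * Real.log n ^ 6 * ((n : ℝ) ^ 2 / Δ) ∧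
        ∀ c, ((s.L c).length : ℝ) ≤
          60000 * ((d : ℝ) + 5) ^ 4 * Real.log n ^ 6 * ((n : ℝ) / Δ)}ᶜ ≤
      ENNReal.ofReal ((n : ℝ) ^ (-(d : ℝ))) := by
  have hG' : ∀ v, (nbrs G v).card ≤ Δ := fun v => (card_nbrs_eq G v).trans_le (hG v)
  have hn : (1 : ℝ) ≤ n := by exact_mod_cast hΔ.trans hΔn
  have hn0 : (0 : ℝ) < n := by linarith
  have hd : (0 : ℝ) ≤ d := Nat.cast_nonneg d
  have hfinal : 5 * (n : ℝ) ^ 2 * Real.exp (-(((d : ℝ) + 5) * Real.log n)) ≤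
      (n : ℝ) ^ (-(d : ℝ)) := by
    have h5 : (5 : ℝ) ≤ Real.exp 2 := by
      have := Real.exp_one_gt_d9
      rw [show (2 : ℝ) = 1 + 1 by norm_num, Real.exp_add]
      nlinarith
    have h2 : (n : ℝ) ^ 2 = Real.exp (2 * Real.log n) := by
      rw [mul_comm, Real.exp_mul, Real.exp_log hn0]
      norm_cast
    rw [Real.rpow_def_of_pos hn0, h2]
    calc _ ≤ Real.exp 2 * Real.exp (2 * Real.log n) *
          Real.exp (-(((d : ℝ) + 5) * Real.log n)) := by gcongr
      _ ≤ _ := by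
          rw [← Real.exp_add, ← Real.exp_add]
          exact Real.exp_le_exp.2 (by linarith)
  -- the exponent `d + 5` absorbs the factor `5 n²` from the union bounds
  rcases le_total (Δ : ℝ) (40 * (((d : ℝ) + 5) * Real.log n)) with h | h
  · refine (tapeMeasure_slow_le_of_small hΔ hΔn hG' hVS hlog (by linarith) rfl h).trans
      (ENNReal.ofReal_le_ofReal (le_trans ?_ hfinal))
    gcongr
    nlinarith
  · exact (tapeMeasure_slow_le_of_large hΔ hΔn hG' hVS hlog (by linarith) rfl h).trans
      (ENNReal.ofReal_le_ofReal hfinal)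

end TimeBound

end SparseColoring

theorem mainTheorem3 :
    ∃ γ : ℝ, 1 ≤ γ * 5000 ^ 3 ∧ ∃ k : ℕ, ∀ d : ℕ, ∃ C : ℝ,
      ∀ (n Δ : ℕ) (ε α : ℝ) (G : SimpleGraph (Fin n)) (VS : List (Fin n)),
        0 < Δ → Δ < n → (∀ v, (G.neighborSet v).ncard ≤ Δ) →
        0 < ε → ε ≤ 1 / 5000 → 5000 ^ 3 ≤ α → α * Real.log n / ε ^ 2 < (Δ : ℝ) + 1 →
        VS.Nodup → (∀ v ∈ VS, SparseColoring.IsSparse G Δ ε v) →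
        SparseColoring.tapeMeasure n Δ
            {ω | ∃ s, SparseColoring.colorSparse G VS ω = some s ∧
              (s.time : ℝ) ≤ C * Real.log n ^ k * ((n : ℝ) ^ 2 / Δ) ∧
              ∀ c, ((s.L c).length : ℝ) ≤ C * Real.log n ^ k * ((n : ℝ) / Δ)}ᶜ
          ≤ ENNReal.ofReal ((n : ℝ) ^ (-(d : ℝ))) ∧
        SparseColoring.tapeMeasure n Δ
            {ω | ∃ s, SparseColoring.colorSparse G VS ω = some s ∧
              ∀ v, ε ^ 2 * Δ / (9 * Real.exp 6) ≤
                ((SparseColoring.available G VS s v).ncard : ℝ)}ᶜ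
          ≤ ENNReal.ofReal ((n : ℝ) ^ (-(γ * α))) := by
  refine ⟨1 / 5000 ^ 3, by norm_num, 6, fun d => ⟨60000 * ((d : ℝ) + 5) ^ 4, ?_⟩⟩
  intro n Δ ε α G VS hΔ hΔn hG hε hε1 hα h hVS hS
  exact ⟨SparseColoring.tapeMeasure_slow_le d hΔ hΔn hG hVS
      (SparseColoring.log_bounds hΔ hΔn hε hε1 hα h).1,
    SparseColoring.tapeMeasure_few_available_le hΔ hΔn hG hε hε1 hα h hVS hS⟩
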